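/- For a bounded set $F\subset\mathbb{R}$ and $a>0$ let $N(F,a)$ be the minimal number of intervals of length $a$ needed to cover $F$. For $E\subset[1,2]$ let $$\dim_{\mathrm M}E=\inf\{a>0:\exists c>0\ \forall \delta\in(0,1),\ N(E,\delta)\le c\,\delta^{-a}\}$$ be the (upper) Minkowski dimension, and for $\theta\in[0,1]$ let $$\overline{\dim}_{\mathrm A,\theta}E=\inf\{a>0:\exists c>0\ \forall\delta\in(0,1)\ \forall\text{ bounded intervals } I \text{ with } |I|\ge\delta^\theta,\ N(E\cap I,\delta)\le c\,(\delta/|I|)^{-a}\}$$ be the upper Assouad spectrum. It is non-decreasing in $\theta$, and $\dim_{\mathrm{qA}}E=\lim_{\theta\nearrow1}\overline{\dim}_{\mathrm A,\theta}E$ is the quasi-Assouad dimension. With $\beta=\dim_{\mathrm M}E$ and $\gamma=\dim_{\mathrm{qA}}E$, the set $E\subset[1,2]$ is called quasi-Assouad regular if either $\gamma=0$ or $\overline{\dim}_{\mathrm A,\theta}E=\gamma$ for all $\theta\in(1-\beta/\gamma,1)$. On $\mathbb{R}^2$ let $A_tf(x)=\int_{\mathbb{S}^1}f(x-ty)\,d\sigma(y)$,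 with $\sigma$ the normalized arc length measure on the unit circle $\mathbb{S}^1$, and $M_Ef(x)=\sup_{t\in E}|A_tf(x)|$. The radial type set $\mathcal{T}_E^{rad}$ is the set of all $(1/p,1/q)\in[0,1]^2$ such that $M_E$ is bounded from $L^p_{rad}(\mathbb{R}^2)$, the radial functions in $L^p(\mathbb{R}^2)$, to $L^q(\mathbb{R}^2)$. For $0\le\beta\le1$ and $\beta+1\le2\gamma\le2$ let $\theta=\frac{1-\beta}{2(\gamma-\beta)}$ if $\beta<1$ and $\theta=1$ if $\beta=1$, and let $\mathcal{Q}(\beta,\gamma)$ be the closed (possibly degenerate) convex quadrilateral with vertices $$(0,0),\quad \Big(\tfrac1{1+\beta},\tfrac1{1+\beta}\Big),\quad \Big(\tfrac{2-\beta(1-\theta)}{2(1+\gamma\theta)},\tfrac1{2(1+\gamma\theta)}\Big),\quad \Big(\tfrac1{1+\gamma},\tfrac1{2(1+\gamma)}\Big).$$ **Corollary.** Let $m\ge1$ and $E=\bigcup_{j=1}^mE_j$, where each $E_j\subset[1,2]$ is quasi-Assouad regular and $\beta_j=\dim_{\mathrm M}E_j$, $\gamma_j=\dim_{\mathrm{qA}}E_j$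 satisfy $2\gamma_j\ge\beta_j+1$. Then $$\overline{\mathcal{T}_E^{rad}}=\bigcap_{j=1}^m\mathcal{Q}(\beta_j,\gamma_j).$$ -/

import Mathlib

open Set Filter Topology MeasureTheory
open scoped ENNReal NNReal

namespace RadialCircular

/-! ### Covering numbers and dimensions of subsets of the line -/

/-- `N(F, a)`: the minimal number of intervals of length `a` needed to cover `F`
(for bounded `F` and `a > 0`; closed intervals are no restriction). -/
noncomputable def coveringNumber (F : Set ℝ) (a : ℝ) : ℕ :=
  sInf {n : ℕ | ∃ c : Fin n → ℝ, F ⊆ ⋃ i, Icc (c i) (c i + a)}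

/-- The (upper) Minkowski dimension. -/
noncomputable def minkowskiDim (E : Set ℝ) : ℝ :=
  sInf {a : ℝ | 0 < a ∧ ∃ c : ℝ, 0 < c ∧ ∀ δ ∈ Ioo (0 : ℝ) 1,
    (coveringNumber E δ : ℝ) ≤ c * δ ^ (-a)}

/-- The upper Assouad spectrum at `θ ∈ [0, 1]`; the intervals are `I = [u, v]`. -/
noncomputable def upperAssouadSpectrum (E : Set ℝ) (θ : ℝ) : ℝ :=
  sInf {a : ℝ | 0 < a ∧ ∃ c : ℝ, 0 < c ∧ ∀ δ ∈ Ioo (0 : ℝ) 1, ∀ u v : ℝ, δ ^ θ ≤ v - u →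
    (coveringNumber (E ∩ Icc u v) δ : ℝ) ≤ c * (δ / (v - u)) ^ (-a)}

/-- The quasi-Assouad dimension: the limit of the upper Assouad spectrum as `θ` increases to `1`.
The limit exists, see `tendsto_upperAssouadSpectrum`. -/
noncomputable def quasiAssouadDim (E : Set ℝ) : ℝ :=
  limUnder (𝓝[<] (1 : ℝ)) (upperAssouadSpectrum E)

theorem coveringNumber_inter_Icc_le (E : Set ℝ) {δ u v : ℝ} (hδ : 0 < δ) (h : δ ≤ v - u) :
    (coveringNumber (E ∩ Icc u v) δ : ℝ) ≤ 2 * ((v - u) / δ) := by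
  have h1 : coveringNumber (E ∩ Icc u v) δ ≤ ⌊(v - u) / δ⌋₊ + 1 := by
    apply Nat.sInf_le
    refine ⟨fun i => u + (i : ℕ) * δ, ?_⟩
    rintro x ⟨-, hxu, hxv⟩
    have hx0 : 0 ≤ (x - u) / δ := div_nonneg (by linarith) hδ.le
    have hle : ⌊(x - u) / δ⌋₊ ≤ ⌊(v - u) / δ⌋₊ := by
      apply Nat.floor_le_floor
      gcongr
    refine mem_iUnion.2 ⟨⟨⌊(x - u) / δ⌋₊, by omega⟩, ?_⟩
    have ha := (le_div_iff₀ hδ).1 (Nat.floor_le hx0)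
    have hb := (div_lt_iff₀ hδ).1 (Nat.lt_floor_add_one ((x - u) / δ))
    constructor
    · change u + (⌊(x - u) / δ⌋₊ : ℝ) * δ ≤ x
      linarith
    · change x ≤ u + (⌊(x - u) / δ⌋₊ : ℝ) * δ + δ
      linarith
  have h2 : (1 : ℝ) ≤ (v - u) / δ := (one_le_div hδ).2 h
  have h3 : (⌊(v - u) / δ⌋₊ : ℝ) ≤ (v - u) / δ := Nat.floor_le (by linarith)
  have h4 : (coveringNumber (E ∩ Icc u v) δ : ℝ) ≤ (⌊(v - u) / δ⌋₊ : ℝ) + 1 := by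
    exact_mod_cast h1
  linarith

theorem tendsto_upperAssouadSpectrum (E : Set ℝ) :
    Tendsto (upperAssouadSpectrum E) (𝓝[<] (1 : ℝ)) (𝓝 (quasiAssouadDim E)) := by
  have hone : ∀ θ ∈ Ioo (0 : ℝ) 1, (1 : ℝ) ∈ {a : ℝ | 0 < a ∧ ∃ c : ℝ, 0 < c ∧
      ∀ δ ∈ Ioo (0 : ℝ) 1, ∀ u v : ℝ, δ ^ θ ≤ v - u →
      (coveringNumber (E ∩ Icc u v) δ : ℝ) ≤ c * (δ / (v - u)) ^ (-a)} := by
    intro θ hθ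
    refine ⟨one_pos, 2, two_pos, fun δ hδ u v huv => ?_⟩
    have h : δ ≤ v - u := by
      refine le_trans ?_ huv
      simpa using Real.rpow_le_rpow_of_exponent_ge hδ.1 hδ.2.le hθ.2.le
    rw [Real.rpow_neg_one, inv_div]
    exact coveringNumber_inter_Icc_le E hδ.1 h
  have hbdd : ∀ θ : ℝ, BddBelow {a : ℝ | 0 < a ∧ ∃ c : ℝ, 0 < c ∧
      ∀ δ ∈ Ioo (0 : ℝ) 1, ∀ u v : ℝ, δ ^ θ ≤ v - u →
      (coveringNumber (E ∩ Icc u v) δ : ℝ) ≤ c * (δ / (v - u)) ^ (-a)} :=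
    fun θ => ⟨0, fun a ha => ha.1.le⟩
  have hmono : MonotoneOn (upperAssouadSpectrum E) (Ioo (0 : ℝ) 1) := by
    intro θ hθ θ' hθ' hle
    apply csInf_le_csInf (hbdd θ) ⟨1, hone θ' hθ'⟩
    rintro a ⟨ha, c, hc, H⟩
    refine ⟨ha, c, hc, fun δ hδ u v huv => H δ hδ u v (le_trans ?_ huv)⟩
    exact Real.rpow_le_rpow_of_exponent_ge hδ.1 hδ.2.le hle
  have hB : BddAbove (upperAssouadSpectrum E '' Ioo (0 : ℝ) 1) := by
    refine ⟨1, ?_⟩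
    rintro _ ⟨θ, hθ, rfl⟩
    exact csInf_le (hbdd θ) (hone θ hθ)
  have hlim := hmono.tendsto_nhdsWithin_Ioo_left (nonempty_Ioo.2 one_pos) hB
  exact tendsto_nhds_limUnder ⟨_, hlim⟩

/-- Quasi-Assouad regular subsets of `[1, 2]`, with `β = minkowskiDim E`, `γ = quasiAssouadDim E`. -/
def IsQuasiAssouadRegular (E : Set ℝ) : Prop :=
  E ⊆ Icc 1 2 ∧
    (quasiAssouadDim E = 0 ∨
      ∀ θ ∈ Ioo (1 - minkowskiDim E / quasiAssouadDim E) 1,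
        upperAssouadSpectrum E θ = quasiAssouadDim E)

/-! ### The circular maximal operator and the radial type set -/

/-- The Euclidean plane. -/
abbrev Plane : Type := EuclideanSpace ℝ (Fin 2)

/-- The point of the unit circle at angle `φ`. -/
noncomputable def circlePoint (φ : ℝ) : Plane := !₂[Real.cos φ, Real.sin φ]

/-- `A_t f (x) = ∫_{S¹} f(x - t y) dσ(y)`, with `σ` the normalized arc length on the unit circle. -/
noncomputable def circularMean (t : ℝ) (f : Plane → ℂ) (x : Plane) : ℂ :=
  ((2 * Real.pi)⁻¹ : ℝ) • ∫ φ in (0 : ℝ)..(2 * Real.pi), f (x - t • circlePoint φ)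

/-- `M_E f (x) = sup_{t ∈ E} |A_t f (x)|`. -/
noncomputable def maximalFunction (E : Set ℝ) (f : Plane → ℂ) (x : Plane) : ℝ≥0∞ :=
  ⨆ t ∈ E, ‖circularMean t f x‖ₑ

/-- Radial functions on the plane. -/
def IsRadial (f : Plane → ℂ) : Prop := ∀ x y : Plane, ‖x‖ = ‖y‖ → f x = f y

/-- `M_E` is bounded from `L^p_rad` to `L^q`. The first conjunct says that `M_E f` is well defined:
at almost every point all the circular means entering it are convergent integrals. -/
def IsRadialStrongType (E : Set ℝ) (p q : ℝ≥0∞) : Prop :=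
  ∃ C : ℝ≥0, ∀ f : Plane → ℂ, IsRadial f → MemLp f p volume →
    (∀ᵐ x ∂(volume : Measure Plane), ∀ t ∈ E,
      IntervalIntegrable (fun φ : ℝ => f (x - t • circlePoint φ)) volume 0 (2 * Real.pi)) ∧
    eLpNorm (maximalFunction E f) q volume ≤ C * eLpNorm f p volume

/-- The radial type set: all `(1/p, 1/q) ∈ [0, 1]²` such that `M_E` is bounded from `L^p_rad`
to `L^q`. The coordinate `0` corresponds to the exponent `∞`. -/
def radialTypeSet (E : Set ℝ) : Set (ℝ × ℝ) :=
  {P | P.1 ∈ Icc (0 : ℝ) 1 ∧ P.2 ∈ Icc (0 : ℝ) 1 ∧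
    IsRadialStrongType E (ENNReal.ofReal P.1)⁻¹ (ENNReal.ofReal P.2)⁻¹}

/-! ### The quadrilaterals (in dimension two) -/

/-- The vertex `Q₁(β)`. -/
noncomputable def vertexQ₁ (β : ℝ) : ℝ × ℝ := (1 / (1 + β), 1 / (1 + β))

/-- The vertex `Q₂(β)`. -/
noncomputable def vertexQ₂ (β : ℝ) : ℝ × ℝ := (2 / (3 + β), 1 / (3 + β))

/-- The parameter `θ(β, γ)` in the definition of `Q₃(β, γ)`; `θ(1, 1) = 1`. -/
noncomputable def thetaParam (β γ : ℝ) : ℝ :=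
  open Classical in if β = 1 then 1 else (1 - β) / (2 * (γ - β))

/-- The vertex `Q₃(β, γ)`. -/
noncomputable def vertexQ₃ (β γ : ℝ) : ℝ × ℝ :=
  ((2 - β * (1 - thetaParam β γ)) / (2 * (1 + γ * thetaParam β γ)),
    1 / (2 * (1 + γ * thetaParam β γ)))

/-- The closed (convex) quadrilateral with vertices `O, Q₁(β), Q₃(β, γ), Q₂(2γ - 1)`. -/
noncomputable def quadrilateral (β γ : ℝ) : Set (ℝ × ℝ) :=
  convexHull ℝ {(0, 0), vertexQ₁ β, vertexQ₃ β γ, vertexQ₂ (2 * γ - 1)}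

end RadialCircular

/-! For a radial function with profile g, the circular mean at radius r is the integral of g against
`radialKernel r t` over |r - t| < s < r + t. When r ≠ t the kernel has inverse square root
singularities at s = r + t and at s = |r - t|. This leaves a one-dimensional weighted inequality. In
the coordinates x = 1/p, y = 1/q, everything is compared with the four inequalities in `halfPlanes`:
y ≤ x, x ≤ 2y, 2x ≤ 1 + (1-β)y and 2γx ≤ β + (4γ-2β-2βγ)y. Under β + 1 ≤ 2γ they cut out exactly the
quadrilateral.

Sufficiency (`profileBounded_of_interior`). The kernel is cut dyadically, according to the size of r
or s and the distance of s to the relevant singularity. On one piece the kernel is at most κ and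
lives in windows of radius δ around σr + τt. The supremum over E is dominated by an ℓ^q sum over a
δ-net. Hölder in the window and Fubini then give an L^p to L^q bound in which E enters only through
the number ν of net points that can see a given s (`Piece.Admissible.exists_majorant`). For r of
size at least one, ν is a global count governed by β. For r near 2^{-m} only net points within about
2^{-m} of s matter, so a local count governed by γ competes with the global one. A geometric mean of
the two counts gives decay in both dyadic parameters exactly under the fourth inequality
(`exists_convex_weight`). With strict inequalities all pieces sum geometrically.

Necessity. Each inequality comes from one family of annuli: a large ball (y ≤ x), a thin annulus of
radius t focusing at the origin (x ≤ 2y), a small ball (the inequality in β), and a thin annulus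
tested on radii comparable to |I| with an antipodal arc of angle (δ/|I|)^{1/2} (the inequality in β
and γ). The last test is used with |I| ≥ δ^θ and θ slightly above 1 - β/γ. Quasi-Assouad regularity
enters only here: it makes the spectrum equal to γ at such θ.

Unions. Necessity passes to subsets of E, and sufficiency passes to finite unions by adding
majorants. Each point of the intersection of the half-planes is a limit along a segment towards a
point strictly inside all of them, so the closure is the full intersection. -/

namespace RadialCircular

/-! ### Radial functions and polar coordinates -/

/-- The length of the unit circle of the plane. -/
noncomputable def circleMass : ℝ≥0∞ := (volume : Measure Plane).toSphere univ

lemma circleMass_ne_zero : circleMass ≠ 0 := by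
  simpa [circleMass] using (Metric.measure_ball_pos (volume : Measure Plane) 0 one_pos).ne'

lemma circleMass_ne_top : circleMass ≠ ∞ := measure_ne_top _ _

lemma lintegral_norm_plane {h : ℝ → ℝ≥0∞} (hh : Measurable h) :
    ∫⁻ x : Plane, h ‖x‖ = circleMass * ∫⁻ r in Ioi (0 : ℝ), h r * ENNReal.ofReal r := by
  have hmp := (volume : Measure Plane).measurePreserving_homeomorphUnitSphereProd
  calc
    ∫⁻ x : Plane, h ‖x‖ = ∫⁻ x : ({(0)}ᶜ : Set Plane), h ‖x.1‖ ∂(volume.comap Subtype.val) := by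
      rw [lintegral_subtype_comap (measurableSet_singleton _).compl fun x : Plane ↦ h ‖x‖,
        restrict_compl_singleton]
    _ = ∫⁻ x, h x.2 ∂(volume : Measure Plane).toSphere.prod
          (.volumeIoiPow (Module.finrank ℝ Plane - 1)) := by
      rw [← hmp.lintegral_comp_emb (Homeomorph.measurableEmbedding _)]
      simp
    _ = circleMass * ∫⁻ x : Ioi (0 : ℝ), h x ∂.volumeIoiPow (Module.finrank ℝ Plane - 1) := by
      rw [lintegral_prod _ (by fun_prop)]
      simp [circleMass, mul_comm]
    _ = _ := by
      congr 1
      have h1 : Module.finrank ℝ Plane - 1 = 1 := by simp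
      rw [h1, Measure.volumeIoiPow, lintegral_withDensity_eq_lintegral_mul _ (by fun_prop)
        (by fun_prop)]
      simp only [Pi.mul_apply]
      rw [lintegral_subtype_comap measurableSet_Ioi
        fun a : ℝ ↦ ENNReal.ofReal (a ^ 1) * h a]
      simp [mul_comm]

lemma ae_norm_of_ae {P : ℝ → Prop} (hP : ∀ᵐ r ∂(volume.restrict (Ioi (0 : ℝ))), P r) :
    ∀ᵐ x : Plane, P ‖x‖ := by
  obtain ⟨N, hN, hNm, hN0⟩ := exists_measurable_superset_of_null hP
  have h1 : ∫⁻ x : Plane, N.indicator 1 ‖x‖ = 0 := by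
    rw [lintegral_norm_plane (measurable_one.indicator hNm)]
    refine mul_eq_zero.2 (Or.inr ?_)
    rw [lintegral_eq_zero_iff' (by
      exact ((measurable_one.indicator hNm).mul (by fun_prop)).aemeasurable)]
    filter_upwards [(measure_eq_zero_iff_ae_notMem).1 hN0] with r hr
    simp [hr]
  rw [lintegral_eq_zero_iff' (by
    exact ((measurable_one.indicator hNm).comp measurable_norm).aemeasurable)] at h1
  filter_upwards [h1] with x hx
  by_contra hcon
  have : ‖x‖ ∈ N := hN hcon
  simp [this] at hx

lemma norm_circlePoint (φ : ℝ) : ‖circlePoint φ‖ = 1 := by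
  simp [circlePoint, EuclideanSpace.norm_eq]

/-- The radial profile of a function on the plane. -/
noncomputable def profile (f : Plane → ℂ) (r : ℝ) : ℂ := f (r • circlePoint 0)

lemma IsRadial.eq_profile {f : Plane → ℂ} (hf : IsRadial f) (x : Plane) :
    f x = profile f ‖x‖ := hf _ _ (by simp [norm_smul, norm_circlePoint])

/-- By Fubini in polar coordinates, f agrees with a measurable representative at almost every radius
along almost every ray. One such ray supplies G. -/
lemma IsRadial.exists_measurable_profile {f : Plane → ℂ} (hf : IsRadial f)
    (hm : AEStronglyMeasurable f volume) :
    ∃ G : ℝ → ℂ, Measurable G ∧ ∀ᵐ r ∂(volume.restrict (Ioi (0 : ℝ))), profile f r = G r := by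
  obtain ⟨g, hg, hfg⟩ := hm
  have hmp := (volume : Measure Plane).measurePreserving_homeomorphUnitSphereProd
  have h1 : ∀ᵐ x : ({(0)}ᶜ : Set Plane) ∂(volume.comap Subtype.val), f x = g x := by
    rw [← ae_restrict_iff_subtype (p := fun x => f x = g x) (measurableSet_singleton _).compl]
    exact ae_restrict_of_ae hfg
  have h2 : ∀ᵐ z ∂(volume : Measure Plane).toSphere.prod
      (.volumeIoiPow (Module.finrank ℝ Plane - 1)),
      f ((homeomorphUnitSphereProd Plane).symm z) = g ((homeomorphUnitSphereProd Plane).symm z) := by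
    rw [← hmp.map_eq, (Homeomorph.measurableEmbedding _).ae_map_iff]
    simpa using h1
  have h3 := Measure.ae_ae_of_ae_prod h2
  have : (ae (volume : Measure Plane).toSphere).NeBot :=
    ae_neBot.2 (Measure.toSphere_ne_zero _)
  obtain ⟨ω, hω⟩ := h3.exists
  refine ⟨fun r => g (r • (ω : Plane)), hg.measurable.comp (by fun_prop), ?_⟩
  have h1 : Module.finrank ℝ Plane - 1 = 1 := by simp
  rw [h1, Measure.volumeIoiPow, ae_withDensity_iff (by fun_prop)] at hω
  rw [ae_restrict_iff_subtype (p := fun r => profile f r = g (r • (ω : Plane))) measurableSet_Ioi]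
  filter_upwards [hω] with r hr
  have hr0 : (0 : ℝ) < r := r.2
  have h4 := hr (by simpa using hr0)
  rw [hf.eq_profile] at h4
  simpa [norm_smul, abs_of_pos hr0] using h4

/-! ### Circular means in polar coordinates -/

/-- The distance between points of polar coordinates `(r, 0)` and `(t, φ)`. -/
noncomputable def chord (r t φ : ℝ) : ℝ := √(r ^ 2 + t ^ 2 - 2 * r * t * Real.cos φ)

lemma norm_smul_circlePoint_sub (r t ψ φ : ℝ) :
    ‖r • circlePoint ψ - t • circlePoint φ‖ = chord r t (φ - ψ) := by
  rw [chord, EuclideanSpace.norm_eq]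
  congr 1
  simp [circlePoint, Real.cos_sub]
  linear_combination r ^ 2 * Real.sin_sq_add_cos_sq ψ + t ^ 2 * Real.sin_sq_add_cos_sq φ

lemma exists_polar (x : Plane) : ∃ ψ : ℝ, x = ‖x‖ • circlePoint ψ := by
  set z : ℂ := ⟨x 0, x 1⟩
  have hz : ‖z‖ = ‖x‖ := by
    rw [EuclideanSpace.norm_eq, Complex.norm_def, Complex.normSq_apply]
    simp [z, ← pow_two]
  refine ⟨z.arg, ?_⟩
  ext i
  fin_cases i
  · simpa [circlePoint, z, hz] using (Complex.norm_mul_cos_arg z).symm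
  · simpa [circlePoint, z, hz] using (Complex.norm_mul_sin_arg z).symm

lemma chord_periodic (r t : ℝ) : Function.Periodic (chord r t) (2 * Real.pi) := by
  intro φ; simp [chord]

lemma chord_continuous (r t : ℝ) : Continuous (chord r t) := by
  unfold chord; fun_prop

lemma lintegral_periodic {h : ℝ → ℝ≥0∞} {T : ℝ} (hT : 0 < T) (hh : Function.Periodic h T)
    (a b : ℝ) : ∫⁻ φ in Ioc a (a + T), h φ = ∫⁻ φ in Ioc b (b + T), h φ := by
  refine (isAddFundamentalDomain_Ioc hT a).setLIntegral_eq (isAddFundamentalDomain_Ioc hT b) _ ?_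
  rintro ⟨g, hg⟩ x
  obtain ⟨n, rfl⟩ := AddSubgroup.mem_zmultiples_iff.1 hg
  have := hh.zsmul n x
  rw [add_comm] at this
  exact this

lemma lintegral_circle_norm (x : Plane) (t : ℝ) (h : ℝ → ℝ≥0∞) :
    ∫⁻ φ in Ioc 0 (2 * Real.pi), h ‖x - t • circlePoint φ‖ =
      ∫⁻ φ in Ioc 0 (2 * Real.pi), h (chord ‖x‖ t φ) := by
  obtain ⟨ψ, hψ⟩ := exists_polar x
  have h1 : ∀ φ, ‖x - t • circlePoint φ‖ = chord ‖x‖ t (φ - ψ) := by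
    intro φ
    conv_lhs => rw [hψ]
    exact norm_smul_circlePoint_sub _ _ _ _
  simp_rw [h1]
  have hper : Function.Periodic (fun φ => h (chord ‖x‖ t φ)) (2 * Real.pi) :=
    fun φ => by simp only [chord_periodic _ _ φ]
  have h2 : ∫⁻ φ in Ioc 0 (2 * Real.pi), h (chord ‖x‖ t (φ - ψ)) =
      ∫⁻ φ in Ioc (0 - ψ) (0 - ψ + 2 * Real.pi), h (chord ‖x‖ t φ) := by
    have := (measurePreserving_sub_right volume ψ).setLIntegral_comp_preimage_emb
      (MeasurableEquiv.subRight ψ).measurableEmbedding (fun φ => h (chord ‖x‖ t φ))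
      (Ioc (0 - ψ) (0 - ψ + 2 * Real.pi))
    rw [← this]
    congr 2
    simp
  rw [h2, lintegral_periodic Real.two_pi_pos hper _ 0, zero_add]

lemma integral_circle_norm (x : Plane) (t : ℝ) (h : ℝ → ℂ) :
    ∫ φ in (0 : ℝ)..(2 * Real.pi), h ‖x - t • circlePoint φ‖ =
      ∫ φ in (0 : ℝ)..(2 * Real.pi), h (chord ‖x‖ t φ) := by
  obtain ⟨ψ, hψ⟩ := exists_polar x
  have h1 : ∀ φ, ‖x - t • circlePoint φ‖ = chord ‖x‖ t (φ - ψ) := by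
    intro φ
    conv_lhs => rw [hψ]
    exact norm_smul_circlePoint_sub _ _ _ _
  simp_rw [h1]
  have hper : Function.Periodic (fun φ => h (chord ‖x‖ t φ)) (2 * Real.pi) :=
    fun φ => by simp only [chord_periodic _ _ φ]
  rw [intervalIntegral.integral_comp_sub_right (fun φ => h (chord ‖x‖ t φ))]
  have := hper.intervalIntegral_add_eq (0 - ψ) 0
  rw [zero_add] at this
  rw [← this]
  congr 1
  ring

/-- The kernel of the circular mean of radius `t` on radial functions. -/
noncomputable def radialKernel (r t s : ℝ) : ℝ :=
  2 * s / √(((r + t) ^ 2 - s ^ 2) * (s ^ 2 - (r - t) ^ 2))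

lemma chord_mem_Ioo {r t φ : ℝ} (hr : 0 < r) (ht : 0 < t) (hφ : φ ∈ Ioo 0 Real.pi) :
    chord r t φ ∈ Ioo |r - t| (r + t) := by
  have h1 : Real.cos φ < 1 := by
    have := Real.cos_lt_cos_of_nonneg_of_le_pi le_rfl hφ.2.le hφ.1
    simpa using this
  have h2 : -1 < Real.cos φ := by
    have := Real.cos_lt_cos_of_nonneg_of_le_pi hφ.1.le le_rfl hφ.2
    simpa using this
  have h3 : 0 < r * t := mul_pos hr ht
  constructor
  · rw [chord, ← Real.sqrt_sq_eq_abs]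
    exact Real.sqrt_lt_sqrt (sq_nonneg _) (by nlinarith)
  · rw [chord, Real.sqrt_lt' (by positivity)]
    nlinarith

lemma chord_sq {r t φ : ℝ} (hr : 0 < r) (ht : 0 < t) :
    chord r t φ ^ 2 = r ^ 2 + t ^ 2 - 2 * r * t * Real.cos φ := by
  rw [chord, Real.sq_sqrt]
  nlinarith [Real.cos_le_one φ, mul_pos hr ht, sq_nonneg (r - t)]

/-- Substitution s = `chord r t φ`. The derivative is r t sin φ / s, and the product under the root
in `radialKernel` equals (2 r t sin φ)², so the kernel is the inverse Jacobian. The inequality only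
comes from enlarging the image to the full interval. -/
lemma lintegral_chord_le {r t : ℝ} (hr : 0 < r) (ht : 0 < t) (h : ℝ → ℝ≥0∞) :
    ∫⁻ φ in Ioo 0 Real.pi, h (chord r t φ) ≤
      ∫⁻ s in Ioo |r - t| (r + t), ENNReal.ofReal (radialKernel r t s) * h s := by
  have hpos : ∀ φ ∈ Ioo 0 Real.pi, 0 < chord r t φ := fun φ hφ =>
    (abs_nonneg _).trans_lt (chord_mem_Ioo hr ht hφ).1
  have hder : ∀ φ ∈ Ioo 0 Real.pi, HasDerivWithinAt (chord r t)
      (r * t * Real.sin φ / chord r t φ) (Ioo 0 Real.pi) φ := by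
    intro φ hφ
    have h0 : r ^ 2 + t ^ 2 - 2 * r * t * Real.cos φ ≠ 0 := by
      rw [← chord_sq hr ht]; exact (pow_pos (hpos φ hφ) 2).ne'
    have h1 : HasDerivAt (fun φ => r ^ 2 + t ^ 2 - 2 * r * t * Real.cos φ)
        (2 * r * t * Real.sin φ) φ := by
      refine (((Real.hasDerivAt_cos φ).const_mul (2 * r * t)).const_sub
        (r ^ 2 + t ^ 2)).congr_deriv ?_
      ring
    have h2 := (h1.sqrt h0).hasDerivWithinAt (s := Ioo 0 Real.pi)
    refine h2.congr_deriv ?_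
    rw [chord]
    field_simp
  have hinj : InjOn (chord r t) (Ioo 0 Real.pi) := by
    intro φ hφ φ' hφ' he
    have h1 : chord r t φ ^ 2 = chord r t φ' ^ 2 := by rw [he]
    rw [chord_sq hr ht, chord_sq hr ht] at h1
    have h3 : 0 < 2 * r * t := by positivity
    exact Real.injOn_cos (Ioo_subset_Icc_self hφ) (Ioo_subset_Icc_self hφ')
      (mul_left_cancel₀ h3.ne' (by linarith))
  have key := lintegral_image_eq_lintegral_abs_deriv_mul measurableSet_Ioo hder hinj
    (fun s => ENNReal.ofReal (radialKernel r t s) * h s)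
  calc ∫⁻ φ in Ioo 0 Real.pi, h (chord r t φ)
      = ∫⁻ φ in Ioo 0 Real.pi, ENNReal.ofReal |r * t * Real.sin φ / chord r t φ| *
        (ENNReal.ofReal (radialKernel r t (chord r t φ)) * h (chord r t φ)) := by
        refine setLIntegral_congr_fun measurableSet_Ioo fun φ hφ => ?_
        have hsin := Real.sin_pos_of_mem_Ioo hφ
        have hs := hpos φ hφ
        have h1 : ((r + t) ^ 2 - chord r t φ ^ 2) * (chord r t φ ^ 2 - (r - t) ^ 2) =
            (2 * r * t * Real.sin φ) ^ 2 := by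
          rw [chord_sq hr ht]
          linear_combination (-4 * r ^ 2 * t ^ 2) * Real.sin_sq_add_cos_sq φ
        have h2 : |r * t * Real.sin φ / chord r t φ| * radialKernel r t (chord r t φ) = 1 := by
          rw [radialKernel, h1, Real.sqrt_sq (by positivity), abs_of_pos (by positivity)]
          field_simp
        rw [← mul_assoc, ← ENNReal.ofReal_mul (abs_nonneg _), h2, ENNReal.ofReal_one, one_mul]
    _ = _ := key.symm
    _ ≤ _ := by
        refine lintegral_mono_set ?_
        rintro _ ⟨φ, hφ, rfl⟩
        exact chord_mem_Ioo hr ht hφ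

lemma lintegral_circle_le {x : Plane} (hx : x ≠ 0) {t : ℝ} (ht : 0 < t) (h : ℝ → ℝ≥0∞) :
    ∫⁻ φ in Ioc 0 (2 * Real.pi), h ‖x - t • circlePoint φ‖ ≤
      2 * ∫⁻ s in Ioo |‖x‖ - t| (‖x‖ + t), ENNReal.ofReal (radialKernel ‖x‖ t s) * h s := by
  have hr : 0 < ‖x‖ := norm_pos_iff.2 hx
  have h1 := lintegral_chord_le hr ht h
  have h2 : ∫⁻ φ in Ioo Real.pi (2 * Real.pi), h (chord ‖x‖ t φ) =
      ∫⁻ φ in Ioo 0 Real.pi, h (chord ‖x‖ t φ) := by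
    have h3 : ∀ φ, chord ‖x‖ t φ = chord ‖x‖ t (2 * Real.pi - φ) := by intro φ; simp [chord]
    have h4 := (Measure.measurePreserving_sub_left volume
      (2 * Real.pi)).setLIntegral_comp_preimage_emb
      (MeasurableEquiv.subLeft (2 * Real.pi)).measurableEmbedding
      (fun φ => h (chord ‖x‖ t φ)) (Ioo 0 Real.pi)
    rw [← h4]
    simp only [← h3]
    congr 2
    ext φ
    simp only [mem_preimage, mem_Ioo]
    constructor <;> rintro ⟨h, h'⟩ <;> constructor <;> linarith
  calc ∫⁻ φ in Ioc 0 (2 * Real.pi), h ‖x - t • circlePoint φ‖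
      = ∫⁻ φ in Ioc 0 (2 * Real.pi), h (chord ‖x‖ t φ) := lintegral_circle_norm _ _ _
    _ = ∫⁻ φ in Ioc 0 Real.pi ∪ Ioc Real.pi (2 * Real.pi), h (chord ‖x‖ t φ) := by
        rw [Ioc_union_Ioc_eq_Ioc Real.pi_pos.le (by linarith [Real.pi_pos])]
    _ ≤ (∫⁻ φ in Ioc 0 Real.pi, h (chord ‖x‖ t φ)) +
          ∫⁻ φ in Ioc Real.pi (2 * Real.pi), h (chord ‖x‖ t φ) := lintegral_union_le _ _ _
    _ = (∫⁻ φ in Ioo 0 Real.pi, h (chord ‖x‖ t φ)) +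
          ∫⁻ φ in Ioo Real.pi (2 * Real.pi), h (chord ‖x‖ t φ) := by
        rw [restrict_Ioo_eq_restrict_Ioc, restrict_Ioo_eq_restrict_Ioc]
    _ ≤ _ := by
        rw [h2, two_mul]
        exact add_le_add h1 h1

/-- The distribution of the norm on each circle is dominated by a density, so a null set of radii is
negligible on every circle with x ≠ 0. No value of t is exceptional, which matters because the
supremum runs over a possibly uncountable E. -/
lemma ae_circle_of_ae {P : ℝ → Prop} (hP : ∀ᵐ r ∂(volume.restrict (Ioi (0 : ℝ))), P r)
    {x : Plane} (hx : x ≠ 0) {t : ℝ} (ht : 0 < t) :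
    ∀ᵐ φ ∂(volume.restrict (Ioc 0 (2 * Real.pi))), P ‖x - t • circlePoint φ‖ := by
  obtain ⟨N, hN, hNm, hN0⟩ := exists_measurable_superset_of_null hP
  have h1 : ∫⁻ φ in Ioc 0 (2 * Real.pi), N.indicator 1 ‖x - t • circlePoint φ‖ = 0 := by
    refine le_antisymm ((lintegral_circle_le hx ht _).trans ?_) zero_le
    have h2 : volume.restrict (Ioo |‖x‖ - t| (‖x‖ + t)) N = 0 := by
      refine le_antisymm ((Measure.restrict_mono ?_ le_rfl N).trans hN0.le) zero_le
      exact fun s hs => (abs_nonneg _).trans_lt hs.1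
    have h3 : ∫⁻ s in Ioo |‖x‖ - t| (‖x‖ + t),
        ENNReal.ofReal (radialKernel ‖x‖ t s) * N.indicator 1 s = 0 := by
      rw [← lintegral_zero]
      refine lintegral_congr_ae ?_
      filter_upwards [(measure_eq_zero_iff_ae_notMem).1 h2] with s hs
      simp [hs]
    rw [h3, mul_zero]
  have hc : Continuous fun φ : ℝ => ‖x - t • circlePoint φ‖ := by
    unfold circlePoint
    fun_prop
  rw [lintegral_eq_zero_iff' (by
    exact ((measurable_one.indicator hNm).comp hc.measurable).aemeasurable)] at h1
  filter_upwards [h1] with φ hφ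
  by_contra hcon
  have : ‖x - t • circlePoint φ‖ ∈ N := hN hcon
  simp [this] at hφ

/-! ### Grid cells, covering numbers and dimensions -/

/-- The indices of the cells `[iη, (i+1)η)` that meet `E`. -/
def cells (E : Set ℝ) (η : ℝ) : Set ℤ := (fun t => ⌊t / η⌋) '' E

lemma cells_finite {E : Set ℝ} (hE : E ⊆ Icc 1 2) {η : ℝ} (hη : 0 < η) : (cells E η).Finite := by
  refine (Set.finite_Icc ⌊1 / η⌋ ⌊2 / η⌋).subset ?_
  rintro _ ⟨t, ht, rfl⟩
  have := hE ht
  exact ⟨Int.floor_le_floor (by gcongr; exact this.1), Int.floor_le_floor (by gcongr; exact this.2)⟩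

lemma coveringNumber_le_ncard_cells {E : Set ℝ} (hE : E ⊆ Icc 1 2) {η : ℝ} (hη : 0 < η) :
    coveringNumber E η ≤ (cells E η).ncard := by
  have hf := cells_finite hE hη
  apply Nat.sInf_le
  have : Finite (cells E η) := hf
  let e : cells E η ≃ Fin (cells E η).ncard := Finite.equivFin (cells E η)
  refine ⟨fun i => (e.symm i : ℤ) * η, fun t ht => mem_iUnion.2 ⟨e ⟨_, mem_image_of_mem _ ht⟩, ?_⟩⟩
  simp only [Equiv.symm_apply_apply]
  have h1 := Int.floor_le (t / η)
  have h2 := (Int.lt_floor_add_one (t / η)).le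
  rw [le_div_iff₀ hη] at h1
  rw [div_le_iff₀ hη] at h2
  exact ⟨h1, by linarith⟩

lemma exists_cover {E : Set ℝ} (hE : E ⊆ Icc 1 2) {η : ℝ} (hη : 0 < η) :
    ∃ c : Fin (coveringNumber E η) → ℝ, E ⊆ ⋃ i, Icc (c i) (c i + η) := by
  have hne : {n : ℕ | ∃ c : Fin n → ℝ, E ⊆ ⋃ i, Icc (c i) (c i + η)}.Nonempty := by
    have hf := cells_finite hE hη
    have : Finite (cells E η) := hf
    let e : cells E η ≃ Fin (cells E η).ncard := Finite.equivFin (cells E η)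
    refine ⟨(cells E η).ncard, fun i => (e.symm i : ℤ) * η,
      fun t ht => mem_iUnion.2 ⟨e ⟨_, mem_image_of_mem _ ht⟩, ?_⟩⟩
    simp only [Equiv.symm_apply_apply]
    have h1 := Int.floor_le (t / η)
    have h2 := (Int.lt_floor_add_one (t / η)).le
    rw [le_div_iff₀ hη] at h1
    rw [div_le_iff₀ hη] at h2
    exact ⟨h1, by linarith⟩
  exact Nat.sInf_mem hne

/-- An interval of length η meets at most two consecutive grid cells. -/
lemma ncard_cells_le {E : Set ℝ} (hE : E ⊆ Icc 1 2) {η : ℝ} (hη : 0 < η) :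
    (cells E η).ncard ≤ 2 * coveringNumber E η := by
  obtain ⟨c, hc⟩ := exists_cover hE hη
  have hsub : cells E η ⊆ ((Finset.univ.image fun i => ⌊c i / η⌋) ∪
      (Finset.univ.image fun i => ⌊c i / η⌋ + 1) : Finset ℤ) := by
    rintro _ ⟨t, ht, rfl⟩
    obtain ⟨i, h1, h2⟩ := mem_iUnion.1 (hc ht)
    have h3 : ⌊c i / η⌋ ≤ ⌊t / η⌋ := Int.floor_le_floor (by gcongr)
    have h4 : ⌊t / η⌋ ≤ ⌊c i / η⌋ + 1 := by
      rw [← Int.floor_add_one]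
      apply Int.floor_le_floor
      rw [div_add_one hη.ne']
      gcongr
    simp only [Finset.coe_union, Finset.coe_image, Finset.coe_univ, image_univ, mem_union, mem_range]
    rcases (by omega : ⌊c i / η⌋ = ⌊t / η⌋ ∨ ⌊c i / η⌋ + 1 = ⌊t / η⌋) with h | h
    · exact Or.inl ⟨i, h⟩
    · exact Or.inr ⟨i, h⟩
  refine (Set.ncard_le_ncard hsub (Finset.finite_toSet _)).trans ?_
  rw [Set.ncard_coe_finset]
  refine (Finset.card_union_le _ _).trans ?_
  have h1 := Finset.card_image_le (s := Finset.univ) (f := fun i => ⌊c i / η⌋)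
  have h2 := Finset.card_image_le (s := Finset.univ) (f := fun i => ⌊c i / η⌋ + 1)
  simp only [Finset.card_univ, Fintype.card_fin] at h1 h2
  omega

/-! ### Comparison of the dimensions, and counting bounds for grid cells. -/

lemma one_mem_spectrum (E : Set ℝ) {θ : ℝ} (hθ : θ < 1) :
    (1 : ℝ) ∈ {a : ℝ | 0 < a ∧ ∃ c : ℝ, 0 < c ∧
      ∀ δ ∈ Ioo (0 : ℝ) 1, ∀ u v : ℝ, δ ^ θ ≤ v - u →
      (coveringNumber (E ∩ Icc u v) δ : ℝ) ≤ c * (δ / (v - u)) ^ (-a)} := by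
  refine ⟨one_pos, 2, two_pos, fun δ hδ u v huv => ?_⟩
  have h : δ ≤ v - u := by
    refine le_trans ?_ huv
    simpa using Real.rpow_le_rpow_of_exponent_ge hδ.1 hδ.2.le hθ.le
  rw [Real.rpow_neg_one, inv_div]
  exact coveringNumber_inter_Icc_le E hδ.1 h

lemma spectrum_bddBelow (E : Set ℝ) (θ : ℝ) : BddBelow {a : ℝ | 0 < a ∧ ∃ c : ℝ, 0 < c ∧
      ∀ δ ∈ Ioo (0 : ℝ) 1, ∀ u v : ℝ, δ ^ θ ≤ v - u →
      (coveringNumber (E ∩ Icc u v) δ : ℝ) ≤ c * (δ / (v - u)) ^ (-a)} :=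
  ⟨0, fun _ ha => ha.1.le⟩

lemma minkowski_bddBelow (E : Set ℝ) : BddBelow {a : ℝ | 0 < a ∧ ∃ c : ℝ, 0 < c ∧
    ∀ δ ∈ Ioo (0 : ℝ) 1, (coveringNumber E δ : ℝ) ≤ c * δ ^ (-a)} :=
  ⟨0, fun _ ha => ha.1.le⟩

lemma minkowskiDim_nonneg (E : Set ℝ) : 0 ≤ minkowskiDim E :=
  Real.sInf_nonneg fun _ ha => ha.1.le

lemma spectrum_subset_minkowski {E : Set ℝ} (hE : E ⊆ Icc 1 2) {θ : ℝ} (hθ : 0 ≤ θ) :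
    {a : ℝ | 0 < a ∧ ∃ c : ℝ, 0 < c ∧
      ∀ δ ∈ Ioo (0 : ℝ) 1, ∀ u v : ℝ, δ ^ θ ≤ v - u →
      (coveringNumber (E ∩ Icc u v) δ : ℝ) ≤ c * (δ / (v - u)) ^ (-a)} ⊆
    {a : ℝ | 0 < a ∧ ∃ c : ℝ, 0 < c ∧
    ∀ δ ∈ Ioo (0 : ℝ) 1, (coveringNumber E δ : ℝ) ≤ c * δ ^ (-a)} := by
  rintro a ⟨ha, c, hc, H⟩
  refine ⟨ha, c, hc, fun δ hδ => ?_⟩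
  have := H δ hδ 1 2 ?_
  · rwa [inter_eq_left.2 hE, show (2 : ℝ) - 1 = 1 by norm_num, div_one] at this
  · rw [show (2 : ℝ) - 1 = 1 by norm_num]
    exact Real.rpow_le_one hδ.1.le hδ.2.le hθ

lemma minkowskiDim_le_spectrum {E : Set ℝ} (hE : E ⊆ Icc 1 2) {θ : ℝ} (hθ : θ ∈ Ico (0 : ℝ) 1) :
    minkowskiDim E ≤ upperAssouadSpectrum E θ :=
  csInf_le_csInf (minkowski_bddBelow E) ⟨1, one_mem_spectrum E hθ.2⟩
    (spectrum_subset_minkowski hE hθ.1)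

lemma minkowskiDim_le_quasiAssouadDim {E : Set ℝ} (hE : E ⊆ Icc 1 2) :
    minkowskiDim E ≤ quasiAssouadDim E := by
  refine ge_of_tendsto (tendsto_upperAssouadSpectrum E) ?_
  filter_upwards [Ico_mem_nhdsLT (show (0 : ℝ) < 1 by norm_num)] with θ hθ
  exact minkowskiDim_le_spectrum hE hθ

lemma quasiAssouadDim_le_one (E : Set ℝ) : quasiAssouadDim E ≤ 1 := by
  refine le_of_tendsto (tendsto_upperAssouadSpectrum E) ?_
  filter_upwards [self_mem_nhdsWithin] with θ hθ
  exact csInf_le (spectrum_bddBelow E θ) (one_mem_spectrum E hθ)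

lemma ncard_cells_le_rpow {E : Set ℝ} (hE : E ⊆ Icc 1 2) {a : ℝ} (ha : minkowskiDim E < a) :
    ∃ C : ℝ, 0 < C ∧ ∀ δ ∈ Ioo (0 : ℝ) 1, ((cells E δ).ncard : ℝ) ≤ C * δ ^ (-a) := by
  obtain ⟨b, ⟨-, c, hc, H⟩, hba⟩ := exists_lt_of_csInf_lt
    ⟨1, spectrum_subset_minkowski hE le_rfl (one_mem_spectrum E zero_lt_one)⟩ ha
  refine ⟨2 * c, by positivity, fun δ hδ => ?_⟩
  have h1 : ((cells E δ).ncard : ℝ) ≤ 2 * coveringNumber E δ := by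
    exact_mod_cast ncard_cells_le hE hδ.1
  have h2 : δ ^ (-b) ≤ δ ^ (-a) :=
    Real.rpow_le_rpow_of_exponent_ge hδ.1 hδ.2.le (by linarith)
  have h3 := H δ hδ
  nlinarith

/-- The spectrum at some θ > 1 - ε controls intervals of length at least δ^θ. On shorter ones the
trivial count costs only δ^{-ε}. The loss δ^{-ε} makes the bound available at all scales ρ ≥ δ. -/
lemma ncard_cells_near_le {E : Set ℝ} (hE : E ⊆ Icc 1 2) {a ε : ℝ} (ha : quasiAssouadDim E < a)
    (ha0 : 0 ≤ a) (hε : 0 < ε) :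
    ∃ C : ℝ, 0 < C ∧ ∀ δ ∈ Ioo (0 : ℝ) 1, ∀ ρ x : ℝ, δ ≤ ρ →
      ({i ∈ cells E δ | |(i : ℝ) * δ - x| ≤ ρ}.ncard : ℝ) ≤ C * (δ ^ (-ε) * (ρ / δ) ^ a) := by
  have hev : ∀ᶠ θ in 𝓝[<] (1 : ℝ), upperAssouadSpectrum E θ < a ∧ θ ∈ Ioo (max 0 (1 - ε)) 1 :=
    ((tendsto_upperAssouadSpectrum E).eventually_lt_const ha).and
      (Ioo_mem_nhdsLT (by simp [hε]))
  obtain ⟨θ, hθa, hθ0, hθ1⟩ := hev.exists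
  rw [max_lt_iff] at hθ0
  obtain ⟨b, ⟨hb0, c, hc, H⟩, hba⟩ := exists_lt_of_csInf_lt ⟨1, one_mem_spectrum E hθ1⟩ hθa
  have key : ∀ δ ∈ Ioo (0 : ℝ) 1, ∀ u v : ℝ, δ ≤ v - u →
      (coveringNumber (E ∩ Icc u v) δ : ℝ) ≤ (c + 2) * (δ ^ (-ε) * ((v - u) / δ) ^ a) := by
    intro δ hδ u v huv
    have hl : 1 ≤ (v - u) / δ := (one_le_div hδ.1).2 huv
    have h1 : 1 ≤ ((v - u) / δ) ^ a := Real.one_le_rpow hl ha0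
    have h2 : 1 ≤ δ ^ (-ε) := Real.one_le_rpow_of_pos_of_le_one_of_nonpos hδ.1 hδ.2.le (by linarith)
    rcases le_or_gt (δ ^ θ) (v - u) with h | h
    · have h3 := H δ hδ u v h
      rw [Real.rpow_neg (div_nonneg hδ.1.le (by linarith [hδ.1])),
        ← Real.inv_rpow (div_nonneg hδ.1.le (by linarith [hδ.1])), inv_div] at h3
      have h4 : ((v - u) / δ) ^ b ≤ ((v - u) / δ) ^ a :=
        Real.rpow_le_rpow_of_exponent_le hl hba.le
      calc _ ≤ _ := h3
        _ ≤ (c + 2) * (1 * ((v - u) / δ) ^ a) := by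
          rw [one_mul]; gcongr; linarith
        _ ≤ _ := by gcongr
    -- Short interval: its length over δ is below δ^{θ-1}, hence at most δ^{-ε}.
    · have h3 := coveringNumber_inter_Icc_le E hδ.1 huv
      have h4 : (v - u) / δ ≤ δ ^ (-ε) := by
        calc (v - u) / δ ≤ δ ^ θ / δ := by have := hδ.1; gcongr
          _ = δ ^ (θ - 1) := by rw [Real.rpow_sub_one hδ.1.ne']
          _ ≤ δ ^ (-ε) := Real.rpow_le_rpow_of_exponent_ge hδ.1 hδ.2.le (by linarith [hθ0.2])
      calc _ ≤ _ := h3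
        _ ≤ (c + 2) * (δ ^ (-ε) * 1) := by
          rw [mul_one]
          exact mul_le_mul (by linarith) h4 (by linarith) (by linarith)
        _ ≤ _ := by gcongr
  refine ⟨2 * (c + 2) * 3 ^ a, by positivity, fun δ hδ ρ x hρ => ?_⟩
  have hδ0 := hδ.1
  -- A cell with left endpoint within ρ of x contains points up to x + ρ + δ. The interval has
  -- length at most 3ρ, whence the factor 3^a.
  set F := E ∩ Icc (x - ρ) (x + ρ + δ)
  have hF : F ⊆ Icc 1 2 := inter_subset_left.trans hE
  have hsub : {i ∈ cells E δ | |(i : ℝ) * δ - x| ≤ ρ} ⊆ cells F δ := by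
    rintro i ⟨⟨t, ht, rfl⟩, hi⟩
    refine ⟨t, ⟨ht, ?_⟩, rfl⟩
    rw [abs_le] at hi
    have h1 := Int.floor_le (t / δ)
    have h2 := (Int.lt_floor_add_one (t / δ)).le
    rw [le_div_iff₀ hδ.1] at h1
    rw [div_le_iff₀ hδ.1] at h2
    constructor <;> nlinarith [hi.1, hi.2]
  have h1 : ({i ∈ cells E δ | |(i : ℝ) * δ - x| ≤ ρ}.ncard : ℝ) ≤ 2 * coveringNumber F δ := by
    exact_mod_cast (Set.ncard_le_ncard hsub (cells_finite hF hδ.1)).trans (ncard_cells_le hF hδ.1)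
  have h2 := key δ hδ (x - ρ) (x + ρ + δ) (by linarith)
  have h3 : ((x + ρ + δ - (x - ρ)) / δ) ^ a ≤ 3 ^ a * (ρ / δ) ^ a := by
    rw [← Real.mul_rpow (by norm_num) (div_nonneg (by linarith) hδ.1.le)]
    refine Real.rpow_le_rpow (div_nonneg (by linarith) hδ.1.le) ?_ ha0
    rw [← mul_div_assoc]
    gcongr
    linarith
  calc _ ≤ 2 * ((c + 2) * (δ ^ (-ε) * (3 ^ a * (ρ / δ) ^ a))) := by
        refine h1.trans ?_
        gcongr
        refine h2.trans ?_
        gcongr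
    _ = _ := by ring

/-! ### A single-scale estimate -/

/-- The window of radius `δ` around the point `σ r + τ t`, inside `S`. -/
def window (S : Set ℝ) (σ τ δ r t : ℝ) : Set ℝ := {s ∈ S | |s - σ * r - τ * t| ≤ δ}

lemma window_mono (S : Set ℝ) {σ τ δ δ' r t t' : ℝ} (hτ : |τ| = 1) (h : |t - t'| + δ ≤ δ') :
    window S σ τ δ r t ⊆ window S σ τ δ' r t' := by
  rintro s ⟨hs, h1⟩
  refine ⟨hs, ?_⟩
  have h2 : |τ * (t - t')| = |t - t'| := by rw [abs_mul, hτ, one_mul]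
  calc |s - σ * r - τ * t'| = |(s - σ * r - τ * t) + τ * (t - t')| := by ring_nf
    _ ≤ _ := (abs_add_le _ _).trans (by linarith)

lemma measurableSet_window_prod {S : Set ℝ} (hS : MeasurableSet S) (σ τ δ t : ℝ) :
    MeasurableSet {z : ℝ × ℝ | z.2 ∈ window S σ τ δ z.1 t} := by
  have h : {z : ℝ × ℝ | z.2 ∈ window S σ τ δ z.1 t} =
      Prod.snd ⁻¹' S ∩ {z : ℝ × ℝ | |z.2 - σ * z.1 - τ * t| ≤ δ} := rfl
  rw [h]
  exact (measurable_snd hS).inter (measurableSet_le (by fun_prop) (by fun_prop))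

lemma measurableSet_window {S : Set ℝ} (hS : MeasurableSet S) (σ τ δ r t : ℝ) :
    MeasurableSet (window S σ τ δ r t) := by
  have := measurable_prodMk_left (x := r) (measurableSet_window_prod hS σ τ δ t)
  exact this

lemma lintegral_window {S : Set ℝ} (hS : MeasurableSet S) (σ τ δ r t : ℝ) (h : ℝ → ℝ≥0∞) :
    ∫⁻ s in window S σ τ δ r t, h s =
      ∫⁻ s, {z : ℝ × ℝ | z.2 ∈ window S σ τ δ z.1 t}.indicator (fun z => h z.2) (r, s) := by
  rw [← lintegral_indicator (measurableSet_window hS σ τ δ r t)]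
  rfl

lemma measurable_lintegral_window {S : Set ℝ} (hS : MeasurableSet S) (σ τ δ t : ℝ)
    {h : ℝ → ℝ≥0∞} (hh : Measurable h) :
    Measurable fun r => ∫⁻ s in window S σ τ δ r t, h s := by
  simp_rw [lintegral_window hS]
  exact Measurable.lintegral_prod_right'
    ((hh.comp measurable_snd).indicator (measurableSet_window_prod hS σ τ δ t))

lemma volume_window_le (S : Set ℝ) (σ τ δ r t : ℝ) :
    volume (window S σ τ δ r t) ≤ ENNReal.ofReal (2 * δ) := by
  calc volume (window S σ τ δ r t) ≤ volume (Icc (σ * r + τ * t - δ) (σ * r + τ * t + δ)) := by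
        refine measure_mono fun s hs => ?_
        have := abs_le.1 hs.2
        constructor <;> linarith
    _ = _ := by rw [Real.volume_Icc]; congr 1; ring

lemma lintegral_rpow_le_of_volume_le {A : Set ℝ} {L : ℝ≥0∞} (hA : volume A ≤ L)
    {h : ℝ → ℝ≥0∞} (hh : Measurable h) {p q : ℝ} (hp : 1 < p) (hq : 0 ≤ q) :
    (∫⁻ s in A, h s) ^ q ≤ L ^ (q * (1 - 1 / p)) * (∫⁻ s in A, h s ^ p) ^ (q / p) := by
  have h1 := ENNReal.lintegral_mul_le_Lp_mul_Lq (volume.restrict A)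
    (Real.HolderConjugate.conjExponent hp) hh.aemeasurable (g := fun _ => 1) aemeasurable_const
  have hc : 1 / p.conjExponent = 1 - 1 / p := by
    rw [Real.conjExponent]
    field_simp
  simp only [Pi.mul_apply, mul_one, ENNReal.one_rpow, lintegral_one, Measure.restrict_apply_univ,
    hc] at h1
  have h2 : 0 ≤ 1 - 1 / p := by
    rw [sub_nonneg, div_le_one (by linarith)]
    exact hp.le
  calc (∫⁻ s in A, h s) ^ q
      ≤ ((∫⁻ s in A, h s ^ p) ^ (1 / p) * L ^ (1 - 1 / p)) ^ q := by
        refine ENNReal.rpow_le_rpow (h1.trans ?_) hq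
        gcongr
    _ = _ := by
        rw [ENNReal.mul_rpow_of_nonneg _ _ hq, ← ENNReal.rpow_mul, ← ENNReal.rpow_mul, mul_comm]
        congr 2 <;> ring

/-- The parameters of an elementary piece of the kernel of the maximal operator: on `R × S` it
has size at most `κ` and lives in windows of radius `δ` around `σ r + τ t`. -/
structure Piece where
  /-- The size of the kernel. -/
  κ : ℝ
  /-- The radius of the windows. -/
  δ : ℝ
  /-- The sign of `r`. -/
  σ : ℝ
  /-- The sign of `t`. -/
  τ : ℝ
  /-- The range of the output variable. -/
  R : Set ℝ
  /-- The range of the input variable. -/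
  S : Set ℝ
  /-- An upper bound for the output variable. -/
  W : ℝ
  /-- A lower bound for the input variable. -/
  V : ℝ
  /-- A bound for the number of net points seen by a point of `S`. -/
  ν : ℝ

/-- The weighted norm of the input. -/
noncomputable def weightedEnergy (p : ℝ) (h : ℝ → ℝ≥0∞) : ℝ≥0∞ :=
  ∫⁻ s in Ioi (0 : ℝ), h s ^ p * ENNReal.ofReal s

/-- The maximal operator of a piece. -/
noncomputable def Piece.maximal (P : Piece) (E : Set ℝ) (h : ℝ → ℝ≥0∞) (r : ℝ) : ℝ≥0∞ :=
  P.R.indicator (fun r => ENNReal.ofReal P.κ * ⨆ t ∈ E, ∫⁻ s in window P.S P.σ P.τ P.δ r t, h s) r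

/-- Compatibility of the parameters of a piece with the set `E`. -/
structure Piece.Admissible (P : Piece) (E : Set ℝ) : Prop where
  κ_pos : 0 < P.κ
  δ_pos : 0 < P.δ
  W_pos : 0 < P.W
  V_pos : 0 < P.V
  ν_nonneg : 0 ≤ P.ν
  abs_σ : |P.σ| = 1
  abs_τ : |P.τ| = 1
  measurableSet_R : MeasurableSet P.R
  measurableSet_S : MeasurableSet P.S
  le_W : ∀ r ∈ P.R, r ≤ P.W
  V_le : ∀ s ∈ P.S, P.V ≤ s
  exists_net : ∃ T : Finset ℝ, (∀ t ∈ E, ∃ t' ∈ T, |t - t'| ≤ P.δ) ∧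
    ∀ s ∈ P.S, ({t ∈ (T : Set ℝ) | ∃ r ∈ P.R, |s - P.σ * r - P.τ * t| ≤ 2 * P.δ}.ncard : ℝ) ≤ P.ν

/-- The bound for the norm of the operator of a piece. -/
noncomputable def Piece.bound (P : Piece) (p q : ℝ) : ℝ :=
  P.κ * P.W ^ (1 / q) * P.V ^ (-(1 / p)) * (4 * P.δ) ^ (1 - 1 / p + 1 / q) * P.ν ^ (1 / q)

/-- Fubini: for fixed s and t, the admissible r form a set of measure at most 2δ, which is empty
unless t is one of the at most ν points seen from s. -/
lemma lintegral_lintegral_window_le {R S : Set ℝ} (hR : MeasurableSet R) (hS : MeasurableSet S)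
    {σ τ δ : ℝ} (hσ : |σ| = 1) (T : Finset ℝ) {ν : ℝ≥0∞}
    (hν : ∀ s ∈ S, ({t ∈ (T : Set ℝ) | ∃ r ∈ R, |s - σ * r - τ * t| ≤ δ}.ncard : ℝ≥0∞) ≤ ν)
    {g : ℝ → ℝ≥0∞} (hg : Measurable g) :
    ∑ t ∈ T, ∫⁻ r in R, ∫⁻ s in window S σ τ δ r t, g s ≤
      ENNReal.ofReal (2 * δ) * ν * ∫⁻ s in S, g s := by
  classical
  have h1 : ∀ t ∈ T, ∫⁻ r in R, ∫⁻ s in window S σ τ δ r t, g s =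
      ∫⁻ s in S, g s * volume {r ∈ R | |s - σ * r - τ * t| ≤ δ} := by
    intro t _
    have hm : Measurable ({z : ℝ × ℝ | z.2 ∈ window S σ τ δ z.1 t}.indicator (fun z => g z.2)) :=
      (hg.comp measurable_snd).indicator (measurableSet_window_prod hS σ τ δ t)
    simp_rw [lintegral_window hS]
    rw [lintegral_lintegral_swap (f := fun r s =>
      {z : ℝ × ℝ | z.2 ∈ window S σ τ δ z.1 t}.indicator (fun z => g z.2) (r, s)) hm.aemeasurable, ← lintegral_indicator hS]
    refine lintegral_congr fun s => ?_
    by_cases hs : s ∈ S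
    · rw [indicator_of_mem hs]
      have hms : MeasurableSet {r : ℝ | |s - σ * r - τ * t| ≤ δ} :=
        measurableSet_le (by fun_prop) (by fun_prop)
      have : ∀ r, {z : ℝ × ℝ | z.2 ∈ window S σ τ δ z.1 t}.indicator (fun z => g z.2) (r, s) =
          {r : ℝ | |s - σ * r - τ * t| ≤ δ}.indicator (fun _ => g s) r := by
        intro r
        by_cases hr : |s - σ * r - τ * t| ≤ δ
        · rw [indicator_of_mem (show r ∈ {r : ℝ | |s - σ * r - τ * t| ≤ δ} from hr),
            indicator_of_mem (show (r, s) ∈ {z : ℝ × ℝ | z.2 ∈ window S σ τ δ z.1 t} from ⟨hs, hr⟩)]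
        · rw [indicator_of_notMem (show r ∉ {r : ℝ | |s - σ * r - τ * t| ≤ δ} from hr),
            indicator_of_notMem (show (r, s) ∉ {z : ℝ × ℝ | z.2 ∈ window S σ τ δ z.1 t} from
              fun h => hr h.2)]
      simp_rw [this]
      rw [lintegral_indicator hms, setLIntegral_const, Measure.restrict_apply hms, inter_comm]
      rfl
    · rw [indicator_of_notMem hs]
      rw [← lintegral_zero]
      refine lintegral_congr fun r => ?_
      exact indicator_of_notMem (fun h => hs h.1) _
  have hvol : ∀ s t, volume {r ∈ R | |s - σ * r - τ * t| ≤ δ} ≤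
      if ∃ r ∈ R, |s - σ * r - τ * t| ≤ δ then ENNReal.ofReal (2 * δ) else 0 := by
    intro s t
    split_ifs with hex
    · have hss : σ * σ = 1 := by
        rw [← abs_mul_abs_self, hσ, one_mul]
      calc _ ≤ volume (Icc (σ * (s - τ * t) - δ) (σ * (s - τ * t) + δ)) := by
            refine measure_mono fun r hr => ?_
            have h2 : |r - σ * (s - τ * t)| ≤ δ := by
              have : |r - σ * (s - τ * t)| = |-σ| * |s - σ * r - τ * t| := by
                rw [← abs_mul]
                congr 1
                linear_combination (-r) * hss
              rw [this, abs_neg, hσ, one_mul]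
              exact hr.2
            have := abs_le.1 h2
            constructor <;> linarith
        _ = _ := by rw [Real.volume_Icc]; congr 1; ring
    · rw [nonpos_iff_eq_zero]
      convert measure_empty (μ := (volume : Measure ℝ))
      ext r
      simp only [mem_ofPred_eq, mem_empty_iff_false, iff_false]
      exact fun h => hex ⟨r, h⟩
  rw [Finset.sum_congr rfl h1]
  have hmeas : ∀ t ∈ T, Measurable fun s => g s * volume {r ∈ R | |s - σ * r - τ * t| ≤ δ} := by
    intro t _
    refine hg.mul ?_
    have hle : MeasurableSet {z : ℝ × ℝ | |z.1 - σ * z.2 - τ * t| ≤ δ} :=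
      measurableSet_le (by fun_prop) (by fun_prop)
    have : MeasurableSet {z : ℝ × ℝ | z.2 ∈ R ∧ |z.1 - σ * z.2 - τ * t| ≤ δ} :=
      (measurable_snd hR).inter hle
    exact measurable_measure_prodMk_left this
  rw [← lintegral_finsetSum _ hmeas, ← lintegral_const_mul _ hg]
  refine setLIntegral_mono' hS fun s hs => ?_
  rw [← Finset.mul_sum, mul_comm]
  refine mul_le_mul_left ?_ _
  calc ∑ t ∈ T, volume {r ∈ R | |s - σ * r - τ * t| ≤ δ}
      ≤ ∑ t ∈ T, if ∃ r ∈ R, |s - σ * r - τ * t| ≤ δ then ENNReal.ofReal (2 * δ) else 0 :=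
        Finset.sum_le_sum fun t _ => hvol s t
    _ = ENNReal.ofReal (2 * δ) * ({t ∈ (T : Set ℝ) | ∃ r ∈ R, |s - σ * r - τ * t| ≤ δ}.ncard) := by
        rw [Finset.sum_ite, Finset.sum_const_zero, add_zero, Finset.sum_const, nsmul_eq_mul,
          mul_comm, ← Set.ncard_coe_finset]
        congr 3
        ext t
        simp
    _ ≤ _ := by gcongr; exact hν s hs

/-- A measurable majorant is produced because the supremum over an uncountable E need not be
measurable. -/
theorem Piece.Admissible.exists_majorant {P : Piece} {E : Set ℝ} (hP : P.Admissible E) {p q : ℝ}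
    (hp : 1 < p) (hpq : p ≤ q) {h : ℝ → ℝ≥0∞} (hh : Measurable h) :
    ∃ B : ℝ → ℝ≥0∞, Measurable B ∧ (∀ r, P.maximal E h r ^ q ≤ B r) ∧
      ∫⁻ r in Ioi (0 : ℝ), B r * ENNReal.ofReal r ≤
        ENNReal.ofReal (P.bound p q ^ q) * weightedEnergy p h ^ (q / p) := by
  obtain ⟨T, hT, hν⟩ := hP.exists_net
  have hq0 : 0 < q := by linarith
  have hp0 : 0 < p := by linarith
  have hV := hP.V_pos
  have hW := hP.W_pos
  have hδ := hP.δ_pos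
  have hκ := hP.κ_pos
  have hν0 := hP.ν_nonneg
  set J : ℝ → ℝ → ℝ≥0∞ := fun t r => ∫⁻ s in window P.S P.σ P.τ (2 * P.δ) r t, h s with hJ
  set H : ℝ → ℝ → ℝ≥0∞ := fun t r => ∫⁻ s in window P.S P.σ P.τ (2 * P.δ) r t, h s ^ p with hH
  set Y : ℝ≥0∞ := ∫⁻ s in P.S, h s ^ p with hY
  have hJm : ∀ t, Measurable (J t) := fun t =>
    measurable_lintegral_window hP.measurableSet_S _ _ _ _ hh
  have hHm : ∀ t, Measurable (H t) := fun t =>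
    measurable_lintegral_window hP.measurableSet_S _ _ _ _ (hh.pow_const p)
  -- The supremum over E is replaced by an ℓ^q sum over the net. Moving t to a net point at distance
  -- at most δ is paid for by doubling the window.
  refine ⟨P.R.indicator fun r => ENNReal.ofReal P.κ ^ q * ∑ t ∈ T, J t r ^ q, ?_, ?_, ?_⟩
  · refine Measurable.indicator ?_ hP.measurableSet_R
    exact (Finset.measurable_fun_sum _ fun t _ => (hJm t).pow_const q).const_mul _
  · intro r
    rw [Piece.maximal]
    by_cases hr : r ∈ P.R
    · rw [indicator_of_mem hr, indicator_of_mem hr, ENNReal.mul_rpow_of_nonneg _ _ hq0.le]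
      gcongr
      rw [← ENNReal.le_rpow_inv_iff hq0]
      refine iSup₂_le fun t ht => ?_
      obtain ⟨t', ht', htt⟩ := hT t ht
      rw [ENNReal.le_rpow_inv_iff hq0]
      calc _ ≤ J t' r ^ q := by
            gcongr
            exact lintegral_mono_set (window_mono _ hP.abs_τ (by linarith))
        _ ≤ _ := Finset.single_le_sum (f := fun t => J t r ^ q) (fun _ _ => zero_le) ht'
    · rw [indicator_of_notMem hr, ENNReal.zero_rpow_of_pos hq0]
      exact zero_le
  · have hYX : ENNReal.ofReal P.V * Y ≤ weightedEnergy p h := by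
      rw [hY, ← lintegral_const_mul _ (hh.pow_const p), weightedEnergy]
      calc _ ≤ ∫⁻ s in P.S, h s ^ p * ENNReal.ofReal s := by
            refine setLIntegral_mono' hP.measurableSet_S fun s hs => ?_
            rw [mul_comm]
            gcongr
            exact hP.V_le s hs
        _ ≤ _ := lintegral_mono_set fun s hs => hV.trans_le (hP.V_le s hs)
    have hY' : Y ≤ ENNReal.ofReal (P.V⁻¹) * weightedEnergy p h := by
      calc Y = ENNReal.ofReal (P.V⁻¹) * (ENNReal.ofReal P.V * Y) := by
            rw [← mul_assoc, ← ENNReal.ofReal_mul (by positivity), inv_mul_cancel₀ hV.ne']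
            simp
        _ ≤ _ := by gcongr
    -- Hölder in a window of length 4δ. As p ≤ q, all but one power of the local energy is bounded
    -- by the global energy Y; the remaining first power is linear and can be summed by Fubini.
    have hJH : ∀ t r, J t r ^ q ≤ ENNReal.ofReal (4 * P.δ) ^ (q * (1 - 1 / p)) *
        Y ^ (q / p - 1) * H t r := by
      intro t r
      have hv := volume_window_le P.S P.σ P.τ (2 * P.δ) r t
      rw [show 2 * (2 * P.δ) = 4 * P.δ by ring] at hv
      refine (lintegral_rpow_le_of_volume_le hv hh hp hq0.le).trans ?_
      rw [mul_assoc]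
      gcongr
      have hle : H t r ≤ Y := lintegral_mono_set fun s hs => hs.1
      have h1 : 0 ≤ q / p - 1 := by rw [sub_nonneg, one_le_div hp0]; exact hpq
      calc H t r ^ (q / p) = H t r ^ (q / p - 1) * H t r ^ (1 : ℝ) := by
            rw [← ENNReal.rpow_add_of_nonneg _ _ h1 zero_le_one]; congr 1; ring
        _ ≤ _ := by rw [ENNReal.rpow_one]; gcongr
    have hsum := lintegral_lintegral_window_le (σ := P.σ) (τ := P.τ) (δ := 2 * P.δ)
      (ν := ENNReal.ofReal P.ν) hP.measurableSet_R hP.measurableSet_S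
      hP.abs_σ T (fun s hs => by
        rw [← ENNReal.ofReal_natCast]
        exact ENNReal.ofReal_le_ofReal (hν s hs)) (hh.pow_const p)
    set K : ℝ≥0∞ := ENNReal.ofReal P.κ ^ q * ENNReal.ofReal P.W *
      (ENNReal.ofReal (4 * P.δ) ^ (q * (1 - 1 / p)) * Y ^ (q / p - 1)) with hK
    calc ∫⁻ r in Ioi (0 : ℝ), (P.R.indicator
          (fun r => ENNReal.ofReal P.κ ^ q * ∑ t ∈ T, J t r ^ q)) r * ENNReal.ofReal r
        ≤ ∫⁻ r, P.R.indicator (fun r => K * ∑ t ∈ T, H t r) r := by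
          refine (setLIntegral_le_lintegral _ _).trans (lintegral_mono fun r => ?_)
          by_cases hr : r ∈ P.R
          · rw [indicator_of_mem hr, indicator_of_mem hr, hK, Finset.mul_sum, Finset.mul_sum,
              Finset.sum_mul]
            refine Finset.sum_le_sum fun t _ => ?_
            calc ENNReal.ofReal P.κ ^ q * J t r ^ q * ENNReal.ofReal r
                ≤ ENNReal.ofReal P.κ ^ q * (ENNReal.ofReal (4 * P.δ) ^ (q * (1 - 1 / p)) *
                    Y ^ (q / p - 1) * H t r) * ENNReal.ofReal P.W := by
                  gcongr
                  · exact hJH t r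
                  · exact hP.le_W r hr
              _ = _ := by ring
          · simp [hr]
      _ = K * ∑ t ∈ T, ∫⁻ r in P.R, H t r := by
          rw [lintegral_indicator hP.measurableSet_R, lintegral_const_mul,
            lintegral_finsetSum _ fun t _ => hHm t]
          exact Finset.measurable_fun_sum _ fun t _ => hHm t
      _ ≤ K * (ENNReal.ofReal (2 * (2 * P.δ)) * ENNReal.ofReal P.ν * Y) := by
          gcongr
      _ = ENNReal.ofReal P.κ ^ q * ENNReal.ofReal P.W *
          (ENNReal.ofReal (4 * P.δ) ^ (q * (1 - 1 / p)) * ENNReal.ofReal (4 * P.δ)) *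
          ENNReal.ofReal P.ν * (Y ^ (q / p - 1) * Y ^ (1 : ℝ)) := by
          rw [hK, show 2 * (2 * P.δ) = 4 * P.δ by ring, ENNReal.rpow_one]
          ring
      _ = ENNReal.ofReal P.κ ^ q * ENNReal.ofReal P.W *
          (ENNReal.ofReal (4 * P.δ) ^ (q * (1 - 1 / p)) * ENNReal.ofReal (4 * P.δ)) *
          ENNReal.ofReal P.ν * Y ^ (q / p) := by
          rw [← ENNReal.rpow_add_of_nonneg _ _ (by
            rw [sub_nonneg, one_le_div hp0]; exact hpq) zero_le_one, sub_add_cancel]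
      _ ≤ ENNReal.ofReal P.κ ^ q * ENNReal.ofReal P.W *
          (ENNReal.ofReal (4 * P.δ) ^ (q * (1 - 1 / p)) * ENNReal.ofReal (4 * P.δ)) *
          ENNReal.ofReal P.ν *
          (ENNReal.ofReal (P.V⁻¹) ^ (q / p) * weightedEnergy p h ^ (q / p)) := by
          rw [← ENNReal.mul_rpow_of_nonneg _ _ (by positivity)]
          gcongr
      _ = _ := by
          rw [ENNReal.ofReal_rpow_of_pos hκ, ENNReal.ofReal_rpow_of_pos (by positivity),
            ENNReal.ofReal_rpow_of_pos (by positivity), ← ENNReal.ofReal_mul (by positivity),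
            ← ENNReal.ofReal_mul (by positivity), ← ENNReal.ofReal_mul (by positivity),
            ← ENNReal.ofReal_mul (by positivity), ← mul_assoc, ← ENNReal.ofReal_mul (by positivity)]
          congr 2
          have e1 : (P.W ^ (1 / q)) ^ q = P.W := by
            rw [← Real.rpow_mul hW.le]; field_simp; simp
          have e2 : (P.ν ^ (1 / q)) ^ q = P.ν := by
            rw [← Real.rpow_mul hν0]; field_simp; simp
          have e3 : (P.V ^ (-(1 / p))) ^ q = P.V⁻¹ ^ (q / p) := by
            rw [← Real.rpow_mul hV.le, Real.inv_rpow hV.le, ← Real.rpow_neg hV.le]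
            congr 1; ring
          have e4 : ((4 * P.δ) ^ (1 - 1 / p + 1 / q)) ^ q =
              (4 * P.δ) ^ (q * (1 - 1 / p)) * (4 * P.δ) := by
            rw [← Real.rpow_mul (by positivity), ← Real.rpow_add_one (by positivity)]
            congr 1; field_simp
          have hD : 0 < 4 * P.δ := by positivity
          rw [Piece.bound]
          generalize 4 * P.δ = D at *
          rw [Real.mul_rpow (by positivity) (by positivity),
            Real.mul_rpow (by positivity) (by positivity),
            Real.mul_rpow (by positivity) (by positivity),
            Real.mul_rpow (by positivity) (by positivity), e1, e2, e3, e4]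
          ring

/-! ### Summing pieces -/

/-- Each A_i / ε_i is at most the q-th root of the weighted sum on the right. This replaces the
triangle inequality in L^q by a pointwise bound, so measurable majorants can be added directly. -/
lemma rpow_tsum_le {ι : Type*} {q : ℝ} (hq : 0 < q) (A ε : ι → ℝ≥0∞) (hε0 : ∀ i, ε i ≠ 0)
    (hε : ∀ i, ε i ≠ ∞) :
    (∑' i, A i) ^ q ≤ (∑' i, ε i) ^ q * ∑' i, ε i ^ (-q) * A i ^ q := by
  set Z := ∑' i, ε i ^ (-q) * A i ^ q
  have h1 : ∀ i, A i ≤ ε i * Z ^ q⁻¹ := by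
    intro i
    have h2 : (A i / ε i) ^ q ≤ Z := by
      rw [ENNReal.div_rpow_of_nonneg _ _ hq.le, div_eq_mul_inv, ← ENNReal.rpow_neg, mul_comm]
      exact ENNReal.le_tsum (f := fun i => ε i ^ (-q) * A i ^ q) i
    rw [← ENNReal.le_rpow_inv_iff hq] at h2
    rw [mul_comm]
    exact (ENNReal.div_le_iff (hε0 i) (hε i)).1 h2
  calc (∑' i, A i) ^ q ≤ (∑' i, ε i * Z ^ q⁻¹) ^ q := by
        gcongr with i
        exact h1 i
    _ = _ := by
        rw [ENNReal.tsum_mul_right, ENNReal.mul_rpow_of_nonneg _ _ hq.le, ← ENNReal.rpow_mul,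
          inv_mul_cancel₀ hq.ne', ENNReal.rpow_one]

lemma tsum_two_rpow_lt_top {n : ℕ} (C η : Fin n → ℝ) (hη : ∀ c, 0 < η c) :
    ∑' i : Fin n × ℕ × ℕ, ENNReal.ofReal (C i.1 * 2 ^ (-(η i.1 * ((i.2.1 : ℝ) + i.2.2)))) < ∞ := by
  have h1 := ENNReal.tsum_prod (f := fun (c : Fin n) (z : ℕ × ℕ) =>
    ENNReal.ofReal (C c * 2 ^ (-(η c * ((z.1 : ℝ) + z.2)))))
  rw [h1, tsum_fintype]
  refine ENNReal.sum_lt_top.2 fun c _ => ?_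
  have h2 := ENNReal.tsum_prod (f := fun (m k : ℕ) =>
    ENNReal.ofReal (C c * 2 ^ (-(η c * ((m : ℝ) + k)))))
  rw [h2]
  set x : ℝ≥0∞ := ENNReal.ofReal (2 ^ (-(η c)))
  have hx : x < 1 := by
    rw [← ENNReal.ofReal_one]
    refine (ENNReal.ofReal_lt_ofReal_iff one_pos).2 ?_
    exact Real.rpow_lt_one_of_one_lt_of_neg one_lt_two (by linarith [hη c])
  have h3 : ∀ m k : ℕ, ENNReal.ofReal (C c * 2 ^ (-(η c * ((m : ℝ) + k)))) =
      ENNReal.ofReal (C c) * x ^ m * x ^ k := by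
    intro m k
    rw [← ENNReal.ofReal_pow (by positivity), ← ENNReal.ofReal_pow (by positivity),
      ← ENNReal.ofReal_mul' (by positivity), ← ENNReal.ofReal_mul' (by positivity),
      ← Real.rpow_natCast, ← Real.rpow_natCast, ← Real.rpow_mul (by norm_num),
      ← Real.rpow_mul (by norm_num), mul_assoc, ← Real.rpow_add (by norm_num)]
    congr 3
    ring
  simp_rw [h3, ENNReal.tsum_mul_left, ENNReal.tsum_mul_right, ENNReal.tsum_mul_left,
    ENNReal.tsum_geometric]
  have h4 : (1 - x)⁻¹ < ∞ := by
    rw [ENNReal.inv_lt_top]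
    exact tsub_pos_of_lt hx
  exact ENNReal.mul_lt_top (ENNReal.mul_lt_top ENNReal.ofReal_lt_top h4) h4

/-- The maximal operator in polar coordinates. -/
noncomputable def profileMaximal (E : Set ℝ) (h : ℝ → ℝ≥0∞) (r : ℝ) : ℝ≥0∞ :=
  ⨆ t ∈ E, ∫⁻ s in Ioo |r - t| (r + t), ENNReal.ofReal (radialKernel r t s) * h s

/-- The weighted bound for the maximal operator in polar coordinates, by a measurable majorant. -/
def ProfileBounded (E : Set ℝ) (p q : ℝ) : Prop :=
  ∃ C : ℝ≥0∞, C ≠ ∞ ∧ ∀ h : ℝ → ℝ≥0∞, Measurable h →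
    ∃ B : ℝ → ℝ≥0∞, Measurable B ∧ (∀ r, 0 < r → profileMaximal E h r ^ q ≤ B r) ∧
      ∫⁻ r in Ioi (0 : ℝ), B r * ENNReal.ofReal r ≤ C * weightedEnergy p h ^ (q / p)

/-- The pieces cover the support of the kernel, so the operator is at most the sum of the pieces,
and geometric decay of their norms makes the sum converge. -/
theorem profileBounded_of_pieces {n : ℕ} {E : Set ℝ} {p q : ℝ} (hp : 1 < p) (hpq : p ≤ q)
    (P : Fin n → ℕ → ℕ → Piece) (hadm : ∀ c m k, (P c m k).Admissible E)
    (hbound : ∀ c, ∃ C η : ℝ, 0 < η ∧ ∀ m k : ℕ,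
      (P c m k).bound p q ≤ C * 2 ^ (-(η * ((m : ℝ) + k))))
    (hcover : ∀ r t s, 0 < r → t ∈ E → s ∈ Ioo |r - t| (r + t) → ∃ c m k, r ∈ (P c m k).R ∧
      s ∈ window (P c m k).S (P c m k).σ (P c m k).τ (P c m k).δ r t ∧
      radialKernel r t s ≤ (P c m k).κ) :
    ProfileBounded E p q := by
  choose C η hη hC using hbound
  have hq0 : 0 < q := by linarith
  have hp0 : 0 < p := by linarith
  set Q : Fin n × ℕ × ℕ → Piece := fun i => P i.1 i.2.1 i.2.2
  -- The weights take half of the decay rate: a piece has norm at most a constant times e², so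
  -- e^{-q}(e²)^q = e^q is still summable.
  set e : Fin n × ℕ × ℕ → ℝ := fun i => 2 ^ (-(η i.1 / 2 * ((i.2.1 : ℝ) + i.2.2))) with he
  have he0 : ∀ i, 0 < e i := fun i => by simp only [he]; positivity
  set ε : Fin n × ℕ × ℕ → ℝ≥0∞ := fun i => ENNReal.ofReal (e i) with hε
  have hε0 : ∀ i, ε i ≠ 0 := fun i => by simp [hε, he0 i]
  have hεt : ∀ i, ε i ≠ ∞ := fun i => ENNReal.ofReal_ne_top
  have hsum1 : ∑' i, ε i < ∞ := by
    have := tsum_two_rpow_lt_top (n := n) (fun _ => 1) (fun c => η c / 2) (fun c => by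
      have := hη c; positivity)
    simpa [hε, he] using this
  have hsum2 := tsum_two_rpow_lt_top (n := n) (fun c => (|C c|) ^ q) (fun c => η c / 2 * q)
    (fun c => by have := hη c; positivity)
  refine ⟨(∑' i, ε i) ^ q * ∑' i : Fin n × ℕ × ℕ,
    ENNReal.ofReal (|C i.1| ^ q * 2 ^ (-(η i.1 / 2 * q * ((i.2.1 : ℝ) + i.2.2)))),
    (ENNReal.mul_lt_top (ENNReal.rpow_lt_top_of_nonneg hq0.le hsum1.ne) hsum2).ne, ?_⟩
  intro h hh
  choose B hBm hB1 hB2 using fun i : Fin n × ℕ × ℕ =>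
    (hadm i.1 i.2.1 i.2.2).exists_majorant hp hpq hh
  refine ⟨fun r => (∑' i, ε i) ^ q * ∑' i, ε i ^ (-q) * B i r, ?_, ?_, ?_⟩
  · exact (Measurable.tsum fun i => (hBm i).const_mul _).const_mul _
  · intro r hr
    have h1 : profileMaximal E h r ≤ ∑' i, (Q i).maximal E h r := by
      refine iSup₂_le fun t ht => ?_
      calc ∫⁻ s in Ioo |r - t| (r + t), ENNReal.ofReal (radialKernel r t s) * h s
          ≤ ∫⁻ s in Ioo |r - t| (r + t), ∑' i, (Q i).R.indicator (fun _ => ENNReal.ofReal (Q i).κ *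
              (window (Q i).S (Q i).σ (Q i).τ (Q i).δ r t).indicator h s) r := by
            refine setLIntegral_mono' measurableSet_Ioo fun s hs => ?_
            obtain ⟨c, m, k, h1, h2, h3⟩ := hcover r t s hr ht hs
            refine le_trans ?_ (ENNReal.le_tsum (c, m, k))
            simp only [Q]
            rw [indicator_of_mem h1, indicator_of_mem h2]
            gcongr
        _ ≤ ∫⁻ s, ∑' i, (Q i).R.indicator (fun _ => ENNReal.ofReal (Q i).κ *
              (window (Q i).S (Q i).σ (Q i).τ (Q i).δ r t).indicator h s) r :=
            setLIntegral_le_lintegral _ _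
        _ = ∑' i, ∫⁻ s, (Q i).R.indicator (fun _ => ENNReal.ofReal (Q i).κ *
              (window (Q i).S (Q i).σ (Q i).τ (Q i).δ r t).indicator h s) r := by
            refine lintegral_tsum fun i => ?_
            by_cases hr : r ∈ (Q i).R
            · simp only [indicator_of_mem hr]
              have := measurableSet_window (hadm i.1 i.2.1 i.2.2).measurableSet_S
                (Q i).σ (Q i).τ (Q i).δ r t
              exact ((hh.indicator this).const_mul _).aemeasurable
            · simp only [indicator_of_notMem hr]
              exact aemeasurable_const
        _ ≤ _ := by
            refine ENNReal.tsum_le_tsum fun i => ?_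
            rw [Piece.maximal]
            by_cases hr : r ∈ (Q i).R
            · simp only [indicator_of_mem hr]
              have := measurableSet_window (hadm i.1 i.2.1 i.2.2).measurableSet_S
                (Q i).σ (Q i).τ (Q i).δ r t
              rw [lintegral_const_mul _ (hh.indicator this), lintegral_indicator this]
              gcongr
              exact le_iSup₂ (f := fun t _ => ∫⁻ s in window (Q i).S (Q i).σ (Q i).τ (Q i).δ r t,
                h s) t ht
            · simp [indicator_of_notMem hr]
    calc profileMaximal E h r ^ q ≤ (∑' i, (Q i).maximal E h r) ^ q := by gcongr
      _ ≤ _ := rpow_tsum_le hq0 _ ε hε0 hεt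
      _ ≤ _ := by
        exact mul_le_mul_right (ENNReal.tsum_le_tsum fun i => mul_le_mul_right (hB1 i r) _) _
  · have hm : ∀ i, Measurable fun r => ε i ^ (-q) * B i r * ENNReal.ofReal r :=
      fun i => ((hBm i).const_mul _).mul (by fun_prop)
    calc ∫⁻ r in Ioi (0 : ℝ), (∑' i, ε i) ^ q * (∑' i, ε i ^ (-q) * B i r) * ENNReal.ofReal r
        = (∑' i, ε i) ^ q * ∑' i, ε i ^ (-q) * ∫⁻ r in Ioi (0 : ℝ), B i r * ENNReal.ofReal r := by
          simp_rw [mul_assoc, ← ENNReal.tsum_mul_right]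
          rw [lintegral_const_mul _ (Measurable.tsum hm), lintegral_tsum
            fun i => (hm i).aemeasurable]
          congr 2
          ext i
          simp_rw [mul_assoc]
          exact lintegral_const_mul _ ((hBm i).mul (by fun_prop))
      _ ≤ (∑' i, ε i) ^ q * ∑' i : Fin n × ℕ × ℕ,
          ENNReal.ofReal (|C i.1| ^ q * 2 ^ (-(η i.1 / 2 * q * ((i.2.1 : ℝ) + i.2.2)))) *
            weightedEnergy p h ^ (q / p) := by
          refine mul_le_mul_right (ENNReal.tsum_le_tsum fun i => ?_) _
          refine (mul_le_mul_right (hB2 i) _).trans ?_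
          rw [← mul_assoc]
          refine mul_le_mul_left ?_ _
          rw [hε, ENNReal.ofReal_rpow_of_pos (he0 i), ← ENNReal.ofReal_mul (by
            have := he0 i; positivity)]
          refine ENNReal.ofReal_le_ofReal ?_
          have hb0 : 0 ≤ (Q i).bound p q := by
            have := hadm i.1 i.2.1 i.2.2
            have h1 := this.κ_pos
            have h2 := this.W_pos
            have h3 := this.V_pos
            have h4 := this.δ_pos
            have h5 := this.ν_nonneg
            simp only [Q, Piece.bound]
            positivity
          have hb1 : (Q i).bound p q ≤ |C i.1| * (e i * e i) := by
            refine (hC i.1 i.2.1 i.2.2).trans ?_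
            rw [he]
            simp only
            rw [← Real.rpow_add (by norm_num)]
            refine mul_le_mul (le_abs_self _) (le_of_eq ?_) (by positivity) (abs_nonneg _)
            congr 1
            ring
          have hee : e i ^ (-q) * (e i ^ q * e i ^ q) = e i ^ q := by
            have := he0 i
            rw [← Real.rpow_add this, ← Real.rpow_add this]
            congr 1
            ring
          calc e i ^ (-q) * (Q i).bound p q ^ q ≤ e i ^ (-q) * (|C i.1| * (e i * e i)) ^ q := by
                have := he0 i
                gcongr
            _ = |C i.1| ^ q * (e i ^ (-q) * (e i ^ q * e i ^ q)) := by
                have := he0 i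
                rw [Real.mul_rpow (abs_nonneg _) (by positivity), Real.mul_rpow this.le this.le]
                ring
            _ = _ := by
                rw [hee, he]
                simp only
                rw [← Real.rpow_mul (by norm_num)]
                congr 2
                ring
      _ = _ := by
          rw [ENNReal.tsum_mul_right, mul_assoc]

/-! ### Decomposition of the kernel -/

/-- Squared form of the bound, with the radicand split into four positive linear factors so that
each can be estimated separately. -/
lemma radialKernel_le_of_sq {r t s κ : ℝ} (hs : s ∈ Ioo |r - t| (r + t)) (hκ : 0 < κ)
    (h : 4 * s ^ 2 ≤ κ ^ 2 * ((r + t - s) * (r + t + s) * (s - |r - t|) * (s + |r - t|))) :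
    radialKernel r t s ≤ κ := by
  have hs0 : 0 < s := (abs_nonneg _).trans_lt hs.1
  have hA : ((r + t) ^ 2 - s ^ 2) * (s ^ 2 - (r - t) ^ 2) =
      (r + t - s) * (r + t + s) * (s - |r - t|) * (s + |r - t|) := by
    rw [← sq_abs (r - t)]; ring
  have hpos : 0 < (r + t - s) * (r + t + s) * (s - |r - t|) * (s + |r - t|) := by
    have h1 : 0 < r + t - s := by linarith [hs.2]
    have h2 : 0 < r + t + s := by linarith [hs.2]
    have h3 : 0 < s - |r - t| := by linarith [hs.1]
    have h4 : 0 < s + |r - t| := by linarith [abs_nonneg (r - t)]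
    positivity
  rw [radialKernel, hA, div_le_iff₀ (Real.sqrt_pos.2 hpos)]
  have h5 : κ * √((r + t - s) * (r + t + s) * (s - |r - t|) * (s + |r - t|)) =
      √(κ ^ 2 * ((r + t - s) * (r + t + s) * (s - |r - t|) * (s + |r - t|))) := by
    rw [Real.sqrt_mul (sq_nonneg κ), Real.sqrt_sq hκ.le]
  rw [h5]
  refine Real.le_sqrt_of_sq_le ?_
  linarith

lemma abs_sub_eq_max_sub_min' (r t : ℝ) : |r - t| = max r t - min r t :=
  (max_sub_min_eq_abs' r t).symm

/-- Outer singularity: for s ≥ max(r, t) one has s - |r - t| ≥ min(r, t), while r + t + s and s + |r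
- t| are at least s. Only r + t - s can degenerate. -/
lemma radialKernel_le_of_max_le {r t s κ : ℝ} (hr : 0 < r) (ht : 0 < t)
    (hs : s ∈ Ioo |r - t| (r + t)) (hκ : 0 < κ) (hmax : max r t ≤ s)
    (h : 4 ≤ κ ^ 2 * (min r t * (r + t - s))) : radialKernel r t s ≤ κ := by
  refine radialKernel_le_of_sq hs hκ ?_
  have hM : 0 < max r t := lt_max_of_lt_left hr
  have hm : 0 < min r t := lt_min hr ht
  have hmM : min r t ≤ max r t := min_le_max
  have hx : 0 < r + t - s := by linarith [hs.2]
  have h1 : s ≤ r + t + s := by linarith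
  have h2 : min r t ≤ s - |r - t| := by rw [abs_sub_eq_max_sub_min']; linarith
  have h3 : s ≤ s + |r - t| := by linarith [abs_nonneg (r - t)]
  have hs0 : 0 < s := hM.trans_le hmax
  calc 4 * s ^ 2 ≤ (κ ^ 2 * (min r t * (r + t - s))) * s ^ 2 := by gcongr
    _ = κ ^ 2 * ((r + t - s) * s * min r t * s) := by ring
    _ ≤ _ := by
      have h4 : 0 ≤ r + t + s := by linarith
      have h5 : 0 ≤ s - |r - t| := by linarith
      gcongr

/-- Inner singularity: for s ≤ max(r, t) one has r + t - s ≥ min(r, t) and r + t + s ≥ max(r, t),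
with product at least r t. Only s - |r - t| degenerates, relative to s. -/
lemma radialKernel_le_of_le_max {r t s κ : ℝ} (hr : 0 < r) (ht : 0 < t)
    (hs : s ∈ Ioo |r - t| (r + t)) (hκ : 0 < κ) (hmax : s ≤ max r t)
    (h : 4 * s ≤ κ ^ 2 * (r * t * (s - |r - t|))) : radialKernel r t s ≤ κ := by
  refine radialKernel_le_of_sq hs hκ ?_
  have hM : 0 < max r t := lt_max_of_lt_left hr
  have hm : 0 < min r t := lt_min hr ht
  have hmM : min r t * max r t = r * t := min_mul_max r t
  have hsum : min r t + max r t = r + t := min_add_max r t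
  have hy : 0 < s - |r - t| := by linarith [hs.1]
  have hs0 : 0 < s := (abs_nonneg _).trans_lt hs.1
  have h1 : min r t ≤ r + t - s := by linarith
  have h2 : max r t ≤ r + t + s := by linarith
  have h3 : s ≤ s + |r - t| := by linarith [abs_nonneg (r - t)]
  calc 4 * s ^ 2 = (4 * s) * s := by ring
    _ ≤ (κ ^ 2 * (r * t * (s - |r - t|))) * s := by gcongr
    _ = κ ^ 2 * (min r t * max r t * (s - |r - t|) * s) := by rw [hmM]; ring
    _ ≤ _ := by
      have h4 : 0 ≤ r + t + s := by linarith
      have h5 : 0 ≤ r + t - s := by linarith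
      gcongr

lemma exists_two_rpow_near {x : ℝ} (h0 : 0 < x) (h1 : x ≤ 1) :
    ∃ k : ℕ, (2 : ℝ) ^ (-(k : ℝ) - 1) < x ∧ x ≤ (2 : ℝ) ^ (-(k : ℝ)) := by
  obtain ⟨k, hk1, hk2⟩ := exists_nat_pow_near_of_lt_one h0 h1 (y := 1 / 2) (by norm_num)
    (by norm_num)
  have e : ∀ n : ℕ, ((1 : ℝ) / 2) ^ n = 2 ^ (-(n : ℝ)) := by
    intro n
    rw [Real.rpow_neg (by norm_num), Real.rpow_natCast, one_div, inv_pow]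
  rw [e] at hk1 hk2
  refine ⟨k, ?_, hk2⟩
  rwa [show -(k : ℝ) - 1 = -((k + 1 : ℕ) : ℝ) by push_cast; ring]

/-! ### Nets -/

/-- The net consists of the left endpoints of the cells that meet E; they need not lie in E. -/
lemma exists_net_of_cells {E : Set ℝ} (hE : E ⊆ Icc 1 2) {η δ ν : ℝ} (hη : 0 < η) (hηδ : η ≤ δ)
    {Q : ℝ → ℝ → Prop} {S : Set ℝ}
    (hν : ∀ s ∈ S, ({i ∈ cells E η | Q s (i * η)}.ncard : ℝ) ≤ ν) :
    ∃ T : Finset ℝ, (∀ t ∈ E, ∃ t' ∈ T, |t - t'| ≤ δ) ∧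
      ∀ s ∈ S, ({t ∈ (T : Set ℝ) | Q s t}.ncard : ℝ) ≤ ν := by
  classical
  have hf := cells_finite hE hη
  refine ⟨hf.toFinset.image fun i : ℤ => (i : ℝ) * η, fun t ht => ⟨⌊t / η⌋ * η, ?_, ?_⟩, ?_⟩
  · simp only [Finset.mem_image, Finite.mem_toFinset]
    exact ⟨_, mem_image_of_mem _ ht, rfl⟩
  · have h1 := Int.floor_le (t / η)
    have h2 := (Int.lt_floor_add_one (t / η)).le
    rw [le_div_iff₀ hη] at h1
    rw [div_le_iff₀ hη] at h2
    rw [abs_le]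
    constructor <;> linarith
  · intro s hs
    refine le_trans ?_ (hν s hs)
    have hsub : {t ∈ ((hf.toFinset.image fun i : ℤ => (i : ℝ) * η : Finset ℝ) : Set ℝ) | Q s t} ⊆
        (fun i : ℤ => (i : ℝ) * η) '' {i ∈ cells E η | Q s (i * η)} := by
      rintro t ⟨ht, hQ⟩
      simp only [Finset.coe_image, Finite.coe_toFinset] at ht
      obtain ⟨i, hi, rfl⟩ := ht
      exact ⟨i, ⟨hi, hQ⟩, rfl⟩
    have hfin : {i ∈ cells E η | Q s (i * η)}.Finite := hf.subset fun i hi => hi.1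
    exact_mod_cast (Set.ncard_le_ncard hsub (hfin.image _)).trans (Set.ncard_image_le hfin)

/-! ### The three families of pieces -/

/-- Pieces for `r ≥ 1/2` away from the origin of the input variable. -/
noncomputable def pieceFar (C a σ τ : ℝ) (m k : ℕ) : Piece where
  κ := 2 ^ ((k : ℝ) / 2 + 3 / 2)
  δ := 2 ^ (1 - (k : ℝ))
  σ := σ
  τ := τ
  R := Icc (2 ^ ((m : ℝ) - 1)) (2 ^ (m : ℝ))
  S := Ici (2 ^ ((m : ℝ) - 2))
  W := 2 ^ (m : ℝ)
  V := 2 ^ ((m : ℝ) - 2)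
  ν := C * 2 ^ (((k : ℝ) + 1) * a)

/-- Pieces for small `r`. -/
noncomputable def pieceNear (C a a' ε σ τ : ℝ) (m k : ℕ) : Piece where
  κ := 2 ^ ((m : ℝ) + k / 2 + 2)
  δ := 2 ^ (-((m : ℝ) + k))
  σ := σ
  τ := τ
  R := Icc (2 ^ (-(m : ℝ) - 1)) (2 ^ (-(m : ℝ)))
  S := Ici (2 ^ (-1 : ℝ))
  W := 2 ^ (-(m : ℝ))
  V := 2 ^ (-1 : ℝ)
  ν := C * 2 ^ min (((m : ℝ) + k + 1) * a) (((m : ℝ) + k + 1) * ε + (k + 3) * a')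

/-- Pieces for `r` of size one and input variable near the origin. -/
noncomputable def pieceFocus (C a σ τ : ℝ) (m k : ℕ) : Piece where
  κ := 2 ^ ((k : ℝ) / 2 + 2)
  δ := 2 ^ (2 - ((m : ℝ) + k))
  σ := σ
  τ := τ
  R := Icc (1 / 2) 4
  S := Icc (2 ^ (1 - (m : ℝ))) (2 ^ (2 - (m : ℝ)))
  W := 2 ^ (2 : ℝ)
  V := 2 ^ (1 - (m : ℝ))
  ν := C * 2 ^ (((m : ℝ) + k + 1) * a)

lemma two_rpow_mem_Ioo {x : ℝ} (hx : 0 < x) : (2 : ℝ) ^ (-x) ∈ Ioo (0 : ℝ) 1 :=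
  ⟨by positivity, Real.rpow_lt_one_of_one_lt_of_neg one_lt_two (by linarith)⟩

lemma two_rpow_rpow (x y : ℝ) : ((2 : ℝ) ^ x) ^ y = 2 ^ (x * y) :=
  (Real.rpow_mul (by norm_num) x y).symm

lemma two_rpow_le {x y : ℝ} (h : x ≤ y) : (2 : ℝ) ^ x ≤ 2 ^ y :=
  Real.rpow_le_rpow_of_exponent_le one_le_two h

lemma ncard_sep_le {E : Set ℝ} (hE : E ⊆ Icc 1 2) {η : ℝ} (hη : 0 < η) (Q : ℤ → Prop) :
    ({i ∈ cells E η | Q i}.ncard : ℝ) ≤ (cells E η).ncard := by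
  exact_mod_cast Set.ncard_le_ncard (sep_subset _ _) (cells_finite hE hη)

lemma pieceFar_admissible {E : Set ℝ} (hE : E ⊆ Icc 1 2) {C a σ τ : ℝ} (hC : 0 < C)
    (hσ : |σ| = 1) (hτ : |τ| = 1)
    (hcard : ∀ δ ∈ Ioo (0 : ℝ) 1, ((cells E δ).ncard : ℝ) ≤ C * δ ^ (-a)) (m k : ℕ) :
    (pieceFar C a σ τ m k).Admissible E where
  κ_pos := by simp only [pieceFar]; positivity
  δ_pos := by simp only [pieceFar]; positivity
  W_pos := by simp only [pieceFar]; positivity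
  V_pos := by simp only [pieceFar]; positivity
  ν_nonneg := by simp only [pieceFar]; positivity
  abs_σ := hσ
  abs_τ := hτ
  measurableSet_R := measurableSet_Icc
  measurableSet_S := measurableSet_Ici
  le_W := fun r hr => hr.2
  V_le := fun s hs => hs
  exists_net := by
    -- The exponent k + 1 keeps the mesh strictly below 1 even for k = 0, as the counting bounds
    -- require.
    have hη := two_rpow_mem_Ioo (x := (k : ℝ) + 1) (by positivity)
    refine exists_net_of_cells hE hη.1 (two_rpow_le (by linarith)) fun s _ => ?_
    refine (ncard_sep_le hE hη.1 _).trans ((hcard _ hη).trans (le_of_eq ?_))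
    simp only [pieceFar]
    rw [two_rpow_rpow]
    congr 2
    ring

lemma pieceFocus_admissible {E : Set ℝ} (hE : E ⊆ Icc 1 2) {C a σ τ : ℝ} (hC : 0 < C)
    (hσ : |σ| = 1) (hτ : |τ| = 1)
    (hcard : ∀ δ ∈ Ioo (0 : ℝ) 1, ((cells E δ).ncard : ℝ) ≤ C * δ ^ (-a)) (m k : ℕ) :
    (pieceFocus C a σ τ m k).Admissible E where
  κ_pos := by simp only [pieceFocus]; positivity
  δ_pos := by simp only [pieceFocus]; positivity
  W_pos := by simp only [pieceFocus]; positivity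
  V_pos := by simp only [pieceFocus]; positivity
  ν_nonneg := by simp only [pieceFocus]; positivity
  abs_σ := hσ
  abs_τ := hτ
  measurableSet_R := measurableSet_Icc
  measurableSet_S := measurableSet_Icc
  le_W := fun r hr => by
    have : r ≤ 4 := hr.2
    simp only [pieceFocus]
    norm_num
    exact this
  V_le := fun s hs => hs.1
  exists_net := by
    have hη := two_rpow_mem_Ioo (x := (m : ℝ) + k + 1) (by positivity)
    refine exists_net_of_cells hE hη.1 (two_rpow_le (by linarith)) fun s _ => ?_
    refine (ncard_sep_le hE hη.1 _).trans ((hcard _ hη).trans (le_of_eq ?_))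
    simp only [pieceFocus]
    rw [two_rpow_rpow]
    congr 2
    ring

lemma pieceNear_admissible {E : Set ℝ} (hE : E ⊆ Icc 1 2) {C a a' ε σ : ℝ} (hC : 0 < C)
    (hσ : |σ| = 1)
    (hcard : ∀ δ ∈ Ioo (0 : ℝ) 1, ((cells E δ).ncard : ℝ) ≤ C * δ ^ (-a))
    (hnear : ∀ δ ∈ Ioo (0 : ℝ) 1, ∀ ρ x : ℝ, δ ≤ ρ →
      ({i ∈ cells E δ | |(i : ℝ) * δ - x| ≤ ρ}.ncard : ℝ) ≤ C * (δ ^ (-ε) * (ρ / δ) ^ a'))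
    (m k : ℕ) : (pieceNear C a a' ε σ 1 m k).Admissible E where
  κ_pos := by simp only [pieceNear]; positivity
  δ_pos := by simp only [pieceNear]; positivity
  W_pos := by simp only [pieceNear]; positivity
  V_pos := by simp only [pieceNear]; positivity
  ν_nonneg := by simp only [pieceNear]; positivity
  abs_σ := hσ
  abs_τ := abs_one
  measurableSet_R := measurableSet_Icc
  measurableSet_S := measurableSet_Ici
  le_W := fun r hr => hr.2
  V_le := fun s hs => hs
  exists_net := by
    have hη := two_rpow_mem_Ioo (x := (m : ℝ) + k + 1) (by positivity)
    refine exists_net_of_cells hE hη.1 (two_rpow_le (by linarith)) fun s _ => ?_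
    simp only [pieceNear]
    have hk0 : (0 : ℝ) ≤ k := by positivity
    rcases min_choice (((m : ℝ) + k + 1) * a) (((m : ℝ) + k + 1) * ε + (k + 3) * a') with h | h
    · rw [h]
      refine (ncard_sep_le hE hη.1 _).trans ((hcard _ hη).trans (le_of_eq ?_))
      rw [two_rpow_rpow]
      congr 2
      ring
    · rw [h]
      -- A visible net point is within r + 2δ ≤ 3·2^{-m} of s, so radius 4·2^{-m} suffices. Its
      -- ratio to the mesh is 2^{k+3}.
      have h1 := hnear _ hη (2 ^ (2 - (m : ℝ))) s (two_rpow_le (by linarith))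
      rw [← Real.rpow_sub (by norm_num), two_rpow_rpow, two_rpow_rpow,
        ← Real.rpow_add (by norm_num)] at h1
      refine le_trans ?_ (h1.trans (le_of_eq ?_))
      · refine Nat.cast_le.2 (Set.ncard_le_ncard ?_ ((cells_finite hE hη.1).subset (sep_subset _ _)))
        rintro i ⟨hi, r, hr, hir⟩
        refine ⟨hi, ?_⟩
        have h2 : (2 : ℝ) ^ (-((m : ℝ) + k)) ≤ 2 ^ (-(m : ℝ)) := two_rpow_le (by linarith)
        have h3 : (2 : ℝ) ^ (2 - (m : ℝ)) = 4 * 2 ^ (-(m : ℝ)) := by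
          rw [sub_eq_add_neg, Real.rpow_add (by norm_num)]
          norm_num
        have h4 : |σ * r| ≤ 2 ^ (-(m : ℝ)) := by
          rw [abs_mul, hσ, one_mul, abs_of_pos (lt_of_lt_of_le (by positivity) hr.1)]
          exact hr.2
        rw [h3]
        rw [abs_le] at hir h4 ⊢
        constructor <;> linarith [hir.1, hir.2, h4.1, h4.2]
      · congr 2
        ring

lemma Piece.bound_eq_two_rpow {P : Piece} {p q C e₁ e₂ e₃ e₄ e₅ : ℝ} (hC : 0 < C)
    (h1 : P.κ = 2 ^ e₁) (h2 : P.W = 2 ^ e₂) (h3 : P.V = 2 ^ e₃) (h4 : P.δ = 2 ^ e₄)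
    (h5 : P.ν = C * 2 ^ e₅) :
    P.bound p q = C ^ (1 / q) * 2 ^ (e₁ + e₂ * (1 / q) - e₃ * (1 / p) +
      (2 + e₄) * (1 - 1 / p + 1 / q) + e₅ * (1 / q)) := by
  have h6 : 4 * (2 : ℝ) ^ e₄ = 2 ^ (2 + e₄) := by
    rw [Real.rpow_add (by norm_num)]; norm_num
  rw [Piece.bound, h1, h2, h3, h4, h5, h6, Real.mul_rpow hC.le (by positivity)]
  simp only [two_rpow_rpow]
  rw [show ∀ A B D F G H : ℝ, A * B * D * F * (G * H) = G * (A * B * D * F * H) by intros; ring]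
  simp only [← Real.rpow_add (show (0 : ℝ) < 2 by norm_num)]
  congr 2
  ring

/-- With x = 1/p and y = 1/q, the decay rate in m is x - y, from the weights on input and output;
the rate in k is 1/2 - x + y - ya. -/
lemma pieceFar_bound {C a p q : ℝ} (hC : 0 < C) (hpq : 1 / q < 1 / p)
    (h : 1 / q * a < 1 / 2 - 1 / p + 1 / q) (σ τ : ℝ) :
    ∃ D η : ℝ, 0 < η ∧ ∀ m k : ℕ, (pieceFar C a σ τ m k).bound p q ≤
      D * 2 ^ (-(η * ((m : ℝ) + k))) := by
  generalize hx : 1 / p = x at *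
  generalize hy : 1 / q = y at *
  set η := min (x - y) (1 / 2 - x + y - y * a) with hη
  refine ⟨C ^ y * 2 ^ (3 / 2 + 2 * x + 3 * (1 - x + y) + y * a), η,
    lt_min (by linarith) (by linarith), fun m k => ?_⟩
  rw [Piece.bound_eq_two_rpow hC rfl rfl rfl rfl rfl, hx, hy, mul_assoc (C ^ y),
    ← Real.rpow_add (by norm_num)]
  refine mul_le_mul_of_nonneg_left (two_rpow_le ?_) (by positivity)
  have h1 : η * m ≤ (x - y) * m := by gcongr; exact min_le_left _ _
  have h2 : η * k ≤ (1 / 2 - x + y - y * a) * k := by gcongr; exact min_le_right _ _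
  nlinarith

/-- Here m measures the smallness of s: the weight costs 2^{mx} and the window gains 2^{-m(1-x+y)},
which gives the rate 1 - 2x + y - ya in m. -/
lemma pieceFocus_bound {C a p q : ℝ} (hC : 0 < C) (h' : 1 / q * a < 1 - 2 * (1 / p) + 1 / q)
    (h : 1 / q * a < 1 / 2 - 1 / p + 1 / q) (σ τ : ℝ) :
    ∃ D η : ℝ, 0 < η ∧ ∀ m k : ℕ, (pieceFocus C a σ τ m k).bound p q ≤
      D * 2 ^ (-(η * ((m : ℝ) + k))) := by
  generalize hx : 1 / p = x at *
  generalize hy : 1 / q = y at *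
  set η := min (1 - 2 * x + y - y * a) (1 / 2 - x + y - y * a) with hη
  refine ⟨C ^ y * 2 ^ (2 + 2 * y - x + 4 * (1 - x + y) + y * a), η,
    lt_min (by linarith) (by linarith), fun m k => ?_⟩
  rw [Piece.bound_eq_two_rpow hC rfl rfl rfl rfl rfl, hx, hy, mul_assoc (C ^ y),
    ← Real.rpow_add (by norm_num)]
  refine mul_le_mul_of_nonneg_left (two_rpow_le ?_) (by positivity)
  have h1 : η * m ≤ (1 - 2 * x + y - y * a) * m := by gcongr; exact min_le_left _ _
  have h2 : η * k ≤ (1 / 2 - x + y - y * a) * k := by gcongr; exact min_le_right _ _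
  nlinarith

/-- The weight l interpolates between the global count, which grows in m and in k, and the local
count, which up to ε grows only in k. The two hypotheses say that the rates in m and in k are
positive. -/
lemma pieceNear_bound {C a a' ε p q l : ℝ} (hC : 0 < C) (hq : 0 ≤ 1 / q) (hl : l ∈ Icc (0 : ℝ) 1)
    (h' : 1 / q * (l * a + (1 - l) * ε) < 2 * (1 / q) - 1 / p)
    (h : 1 / q * (l * a + (1 - l) * (a' + ε)) < 1 / 2 - 1 / p + 1 / q) (σ τ : ℝ) :
    ∃ D η : ℝ, 0 < η ∧ ∀ m k : ℕ, (pieceNear C a a' ε σ τ m k).bound p q ≤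
      D * 2 ^ (-(η * ((m : ℝ) + k))) := by
  generalize hx : 1 / p = x at *
  generalize hy : 1 / q = y at *
  set c₁ := 2 * y - x - y * (l * a + (1 - l) * ε) with hc₁
  set c₂ := 1 / 2 - x + y - y * (l * a + (1 - l) * (a' + ε)) with hc₂
  set η := min c₁ c₂ with hη
  refine ⟨C ^ y * 2 ^ (2 + x + 2 * (1 - x + y) + y * (l * a + (1 - l) * (ε + 3 * a'))), η,
    lt_min (by linarith) (by linarith), fun m k => ?_⟩
  rw [Piece.bound_eq_two_rpow hC rfl rfl rfl rfl rfl, hx, hy, mul_assoc (C ^ y),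
    ← Real.rpow_add (by norm_num)]
  refine mul_le_mul_of_nonneg_left (two_rpow_le ?_) (by positivity)
  have h1 : η * m ≤ c₁ * m := by gcongr; exact min_le_left _ _
  have h2 : η * k ≤ c₂ * k := by gcongr; exact min_le_right _ _
  -- The minimum is at most any convex combination.
  have h3 : min (((m : ℝ) + k + 1) * a) (((m : ℝ) + k + 1) * ε + (k + 3) * a') ≤
      l * (((m : ℝ) + k + 1) * a) + (1 - l) * (((m : ℝ) + k + 1) * ε + (k + 3) * a') := by
    have e1 := mul_le_mul_of_nonneg_left (min_le_left (((m : ℝ) + k + 1) * a)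
      (((m : ℝ) + k + 1) * ε + (k + 3) * a')) hl.1
    have e2 := mul_le_mul_of_nonneg_left (min_le_right (((m : ℝ) + k + 1) * a)
      (((m : ℝ) + k + 1) * ε + (k + 3) * a')) (sub_nonneg.2 hl.2)
    linarith
  have h4 := mul_le_mul_of_nonneg_right h3 hq
  rw [hc₁] at h1
  rw [hc₂] at h2
  linarith

/-! ### Boundedness in the interior of the quadrilateral -/

lemma exists_two_rpow_near_of_one_le {x : ℝ} (h1 : 1 ≤ x) :
    ∃ m : ℕ, (2 : ℝ) ^ (m : ℝ) ≤ x ∧ x ≤ (2 : ℝ) ^ ((m : ℝ) + 1) := by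
  obtain ⟨m, hm1, hm2⟩ := exists_nat_pow_near h1 (y := 2) (by norm_num)
  refine ⟨m, by rwa [Real.rpow_natCast], ?_⟩
  rw [show (m : ℝ) + 1 = ((m + 1 : ℕ) : ℝ) by push_cast; ring, Real.rpow_natCast]
  exact hm2.le

lemma two_rpow_mul {x y : ℝ} (z : ℝ) (h : x + y = z) : (2 : ℝ) ^ x * 2 ^ y = 2 ^ z := by
  rw [← h, Real.rpow_add (by norm_num)]

lemma two_rpow_sq (x : ℝ) : ((2 : ℝ) ^ x) ^ 2 = 2 ^ (2 * x) := by
  rw [← Real.rpow_natCast, two_rpow_rpow]; congr 1; push_cast; ring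

/-- The six families of pieces. -/
noncomputable def radialPieces (C a a' ε : ℝ) : Fin 6 → ℕ → ℕ → Piece :=
  ![pieceFar C a 1 1, pieceFar C a 1 (-1), pieceNear C a a' ε 1 1, pieceNear C a a' ε (-1) 1,
    pieceFocus C a 1 (-1), pieceFocus C a (-1) 1]

/-- A point is covered by a piece. -/
def Piece.Covers (P : Piece) (r t s : ℝ) : Prop :=
  r ∈ P.R ∧ s ∈ window P.S P.σ P.τ P.δ r t ∧ radialKernel r t s ≤ P.κ

variable {r t s : ℝ}

/-! ### Covering the support of the kernel by pieces. -/

lemma exists_far_range (hr : 1 / 2 ≤ r) :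
    ∃ m : ℕ, (2 : ℝ) ^ ((m : ℝ) - 1) ≤ r ∧ r ≤ 2 ^ (m : ℝ) := by
  obtain ⟨m, h1, h2⟩ := exists_two_rpow_near_of_one_le (x := 2 * r) (by linarith)
  refine ⟨m, ?_, ?_⟩
  · rw [← two_rpow_mul (x := (m : ℝ) - 1) (y := 1) m (by ring), Real.rpow_one] at h1
    linarith
  · rw [← two_rpow_mul (x := (m : ℝ)) (y := 1) (m + 1) (by ring), Real.rpow_one] at h2
    linarith

lemma exists_scale {x L : ℝ} (hx : 0 < x) {e : ℝ} (hL : L = 2 ^ e) (hxL : x ≤ L) :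
    ∃ k : ℕ, (2 : ℝ) ^ (e - k - 1) < x ∧ x ≤ 2 ^ (e - k) := by
  subst hL
  have h0 : (0 : ℝ) < 2 ^ e := by positivity
  obtain ⟨k, h1, h2⟩ := exists_two_rpow_near (x := x / 2 ^ e) (by positivity)
    ((div_le_one h0).2 hxL)
  rw [lt_div_iff₀ h0, two_rpow_mul (e - k - 1) (by ring)] at h1
  rw [div_le_iff₀ h0, two_rpow_mul (e - k) (by ring)] at h2
  exact ⟨k, h1, h2⟩

lemma exists_pieceFar_covers_of_max_le (C a : ℝ) (hr : 1 / 2 ≤ r) (ht : t ∈ Icc (1 : ℝ) 2)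
    (hs : s ∈ Ioo |r - t| (r + t)) (hmax : max r t ≤ s) :
    ∃ m k : ℕ, (pieceFar C a 1 1 m k).Covers r t s := by
  obtain ⟨m, hm1, hm2⟩ := exists_far_range hr
  have hrs : r ≤ s := (le_max_left _ _).trans hmax
  have hx : 0 < r + t - s := by linarith [hs.2]
  obtain ⟨k, hk1, hk2⟩ := exists_scale hx (L := 2) (e := 1) (by simp) (by linarith [ht.2])
  refine ⟨m, k, ⟨hm1, hm2⟩, ⟨?_, ?_⟩, ?_⟩
  · exact (two_rpow_le (by linarith)).trans (hm1.trans hrs)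
  · simp only [pieceFar]
    rw [abs_le]
    constructor <;> linarith
  · simp only [pieceFar]
    refine radialKernel_le_of_max_le (by linarith) (by linarith [ht.1]) hs (by positivity) hmax ?_
    rw [two_rpow_sq]
    have h1 : (2 : ℝ) ^ (2 * ((k : ℝ) / 2 + 3 / 2)) * 2 ^ (1 - (k : ℝ) - 1) = 8 := by
      rw [two_rpow_mul 3 (by ring)]; norm_num
    have h2 : 1 / 2 ≤ min r t := le_min hr (by linarith [ht.1])
    have h3 : (1 / 2 : ℝ) * 2 ^ (1 - (k : ℝ) - 1) ≤ min r t * (r + t - s) := by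
      gcongr
    have h4 : (0 : ℝ) < 2 ^ (2 * ((k : ℝ) / 2 + 3 / 2)) := by positivity
    nlinarith [mul_le_mul_of_nonneg_left h3 h4.le]

lemma exists_pieceFar_covers_of_le_max (C a : ℝ) (hr : 4 ≤ r) (ht : t ∈ Icc (1 : ℝ) 2)
    (hs : s ∈ Ioo |r - t| (r + t)) (hmax : s ≤ max r t) :
    ∃ m k : ℕ, (pieceFar C a 1 (-1) m k).Covers r t s := by
  obtain ⟨m, hm1, hm2⟩ := exists_far_range (r := r) (by linarith)
  rw [max_eq_left (by linarith [ht.2])] at hmax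
  have habs : |r - t| = r - t := abs_of_pos (by linarith [ht.2])
  have hy : 0 < s - |r - t| := by linarith [hs.1]
  obtain ⟨k, hk1, hk2⟩ := exists_scale hy (L := 2) (e := 1) (by simp) (by linarith [ht.2])
  refine ⟨m, k, ⟨hm1, hm2⟩, ⟨?_, ?_⟩, ?_⟩
  · have h1 : (2 : ℝ) ^ ((m : ℝ) - 2) * 2 ^ (1 : ℝ) = 2 ^ ((m : ℝ) - 1) :=
      two_rpow_mul _ (by ring)
    rw [Real.rpow_one] at h1
    show (2 : ℝ) ^ ((m : ℝ) - 2) ≤ s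
    linarith [hs.1, ht.2]
  · simp only [pieceFar]
    rw [abs_le]
    constructor <;> linarith
  · simp only [pieceFar]
    refine radialKernel_le_of_le_max (by linarith) (by linarith [ht.1]) hs (by positivity)
      (hmax.trans (le_max_left _ _)) ?_
    rw [two_rpow_sq]
    have h1 : (2 : ℝ) ^ (2 * ((k : ℝ) / 2 + 3 / 2)) * 2 ^ (1 - (k : ℝ) - 1) = 8 := by
      rw [two_rpow_mul 3 (by ring)]; norm_num
    have h4 : (0 : ℝ) < 2 ^ (2 * ((k : ℝ) / 2 + 3 / 2)) := by positivity
    have h5 : 8 ≤ 2 ^ (2 * ((k : ℝ) / 2 + 3 / 2)) * (s - |r - t|) := by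
      rw [← h1]; gcongr
    calc 4 * s ≤ 8 * (r * 1) := by linarith
      _ ≤ 2 ^ (2 * ((k : ℝ) / 2 + 3 / 2)) * (s - |r - t|) * (r * t) := by
        have := ht.1
        gcongr
      _ = _ := by ring

lemma exists_pieceNear_covers_of_max_le (C a a' ε : ℝ) (hr0 : 0 < r) (hr : r < 1 / 2)
    (ht : t ∈ Icc (1 : ℝ) 2) (hs : s ∈ Ioo |r - t| (r + t)) (hmax : max r t ≤ s) :
    ∃ m k : ℕ, (pieceNear C a a' ε 1 1 m k).Covers r t s := by
  obtain ⟨m, hm1, hm2⟩ := exists_two_rpow_near hr0 (by linarith)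
  have hts : t ≤ s := (le_max_right _ _).trans hmax
  have hx : 0 < r + t - s := by linarith [hs.2]
  obtain ⟨k, hk1, hk2⟩ := exists_scale hx (L := 2 ^ (-(m : ℝ))) rfl (by linarith)
  refine ⟨m, k, ⟨hm1.le, hm2⟩, ⟨?_, ?_⟩, ?_⟩
  · show (2 : ℝ) ^ (-1 : ℝ) ≤ s
    rw [Real.rpow_neg_one]
    linarith [ht.1]
  · simp only [pieceNear]
    rw [show -((m : ℝ) + k) = -(m : ℝ) - k by ring, abs_le]
    constructor <;> linarith
  · simp only [pieceNear]
    refine radialKernel_le_of_max_le hr0 (by linarith [ht.1]) hs (by positivity) hmax ?_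
    rw [two_rpow_sq, min_eq_left (by linarith [ht.1])]
    have h1 : (2 : ℝ) ^ (2 * ((m : ℝ) + k / 2 + 2)) *
        (2 ^ (-(m : ℝ) - 1) * 2 ^ (-(m : ℝ) - k - 1)) = 4 := by
      rw [two_rpow_mul (-(m : ℝ) - 1 + (-(m : ℝ) - k - 1)) rfl, two_rpow_mul 2 (by ring)]
      norm_num
    rw [← h1]
    gcongr

lemma exists_pieceNear_covers_of_le_max (C a a' ε : ℝ) (hr0 : 0 < r) (hr : r < 1 / 2)
    (ht : t ∈ Icc (1 : ℝ) 2) (hs : s ∈ Ioo |r - t| (r + t)) (hmax : s ≤ max r t) :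
    ∃ m k : ℕ, (pieceNear C a a' ε (-1) 1 m k).Covers r t s := by
  obtain ⟨m, hm1, hm2⟩ := exists_two_rpow_near hr0 (by linarith)
  rw [max_eq_right (by linarith [ht.1])] at hmax
  have habs : |r - t| = t - r := by rw [abs_sub_comm]; exact abs_of_pos (by linarith [ht.1])
  have hy : 0 < s - |r - t| := by linarith [hs.1]
  obtain ⟨k, hk1, hk2⟩ := exists_scale hy (L := 2 ^ (-(m : ℝ))) rfl (by linarith)
  have hs0 : 1 / 2 ≤ s := by linarith [hs.1, ht.1]
  refine ⟨m, k, ⟨hm1.le, hm2⟩, ⟨?_, ?_⟩, ?_⟩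
  · show (2 : ℝ) ^ (-1 : ℝ) ≤ s
    rw [Real.rpow_neg_one]
    linarith
  · simp only [pieceNear]
    rw [show -((m : ℝ) + k) = -(m : ℝ) - k by ring, abs_le]
    constructor <;> linarith
  · simp only [pieceNear]
    refine radialKernel_le_of_le_max hr0 (by linarith [ht.1]) hs (by positivity)
      (hmax.trans (le_max_right _ _)) ?_
    rw [two_rpow_sq]
    have h1 : (2 : ℝ) ^ (2 * ((m : ℝ) + k / 2 + 2)) *
        (2 ^ (-(m : ℝ) - 1) * 2 ^ (-(m : ℝ) - k - 1)) = 4 := by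
      rw [two_rpow_mul (-(m : ℝ) - 1 + (-(m : ℝ) - k - 1)) rfl, two_rpow_mul 2 (by ring)]
      norm_num
    calc 4 * s ≤ 2 ^ (2 * ((m : ℝ) + k / 2 + 2)) *
        (2 ^ (-(m : ℝ) - 1) * 2 ^ (-(m : ℝ) - k - 1)) * t := by rw [h1]; linarith
      _ ≤ 2 ^ (2 * ((m : ℝ) + k / 2 + 2)) * (r * (s - |r - t|)) * t := by
        have := ht.1
        gcongr
      _ = _ := by ring

lemma exists_pieceFocus_covers (C a : ℝ) (hr : 1 / 2 ≤ r) (hr4 : r < 4)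
    (ht : t ∈ Icc (1 : ℝ) 2) (hs : s ∈ Ioo |r - t| (r + t)) (hmax : s ≤ max r t) {σ τ : ℝ}
    (hστ : |r - t| = σ * r + τ * t) :
    ∃ m k : ℕ, (pieceFocus C a σ τ m k).Covers r t s := by
  have hs0 : 0 < s := (abs_nonneg _).trans_lt hs.1
  have hs4 : s ≤ 4 := hmax.trans (max_le hr4.le (by linarith [ht.2]))
  obtain ⟨m, hm1, hm2⟩ := exists_scale hs0 (L := 4) (e := 2) (by norm_num) hs4
  have hy : 0 < s - |r - t| := by linarith [hs.1]
  -- Since s - |r - t| ≤ s, the distance to the singularity is measured relative to the scale of s;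
  -- hence the window radius 2^{2-m-k}.
  obtain ⟨k, hk1, hk2⟩ := exists_scale hy (L := 2 ^ ((2 : ℝ) - m)) rfl
    (by linarith [abs_nonneg (r - t)])
  refine ⟨m, k, ⟨hr, hr4.le⟩, ⟨⟨?_, hm2⟩, ?_⟩, ?_⟩
  · show (2 : ℝ) ^ (1 - (m : ℝ)) ≤ s
    rw [show (1 : ℝ) - m = 2 - m - 1 by ring]
    exact hm1.le
  · simp only [pieceFocus]
    rw [show (2 : ℝ) - ((m : ℝ) + k) = 2 - m - k by ring, abs_le]
    constructor <;> linarith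
  · simp only [pieceFocus]
    refine radialKernel_le_of_le_max (by linarith) (by linarith [ht.1]) hs (by positivity) hmax ?_
    rw [two_rpow_sq]
    have h1 : (2 : ℝ) ^ (2 * ((k : ℝ) / 2 + 2)) * 2 ^ ((2 : ℝ) - m - k - 1) =
        8 * 2 ^ ((2 : ℝ) - m) := by
      rw [two_rpow_mul (3 + (2 - (m : ℝ))) (by ring), Real.rpow_add (by norm_num)]
      norm_num
    calc 4 * s ≤ 2 ^ (2 * ((k : ℝ) / 2 + 2)) * (1 / 2 * 1 * 2 ^ ((2 : ℝ) - m - k - 1)) := by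
          linarith
      _ ≤ _ := by
        have := ht.1
        gcongr

/-- Comparing s with max(r, t) selects the singularity. At the inner one s can be small only when r
and t are comparable, so the focusing pieces are confined to 1/2 ≤ r < 4, with the sign of r - t
fixing σ and τ. -/
lemma exists_radialPieces_covers (C a a' ε : ℝ) (hr : 0 < r) (ht : t ∈ Icc (1 : ℝ) 2)
    (hs : s ∈ Ioo |r - t| (r + t)) : ∃ c m k, (radialPieces C a a' ε c m k).Covers r t s := by
  rcases le_total (max r t) s with hmax | hmax
  · rcases le_or_gt (1 / 2) r with h | h
    · exact ⟨0, exists_pieceFar_covers_of_max_le C a h ht hs hmax⟩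
    · exact ⟨2, exists_pieceNear_covers_of_max_le C a a' ε hr h ht hs hmax⟩
  · rcases lt_or_ge r (1 / 2) with h | h
    · exact ⟨3, exists_pieceNear_covers_of_le_max C a a' ε hr h ht hs hmax⟩
    · rcases le_or_gt 4 r with h4 | h4
      · exact ⟨1, exists_pieceFar_covers_of_le_max C a h4 ht hs hmax⟩
      · rcases le_total t r with htr | htr
        · exact ⟨4, exists_pieceFocus_covers C a h h4 ht hs hmax (by
            rw [abs_of_nonneg (by linarith)]; ring)⟩
        · exact ⟨5, exists_pieceFocus_covers C a h h4 ht hs hmax (by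
            rw [abs_of_nonpos (by linarith)]; ring)⟩

/-- If l = 1 is not allowed, the critical weight is l₀ = (2y - x)/(yβ), where the first condition
becomes an equality. The second condition at l₀ is precisely the fourth half-plane inequality. -/
lemma exists_convex_weight {β γ x y : ℝ} (hβ : 0 ≤ β) (hγ : β ≤ γ) (hxy : x < 2 * y)
    (hy : 0 < y) (h3 : 2 * x < 1 + (1 - β) * y) (hyx : y < x)
    (h4 : 2 * γ * x < β + (4 * γ - 2 * β - 2 * β * γ) * y) :
    ∃ l ∈ Icc (0 : ℝ) 1, y * (l * β) < 2 * y - x ∧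
      y * (l * β + (1 - l) * γ) < 1 / 2 - x + y := by
  have h5 : y * β < 1 / 2 - x + y := by nlinarith
  rcases lt_or_ge (y * β) (2 * y - x) with h | h
  · exact ⟨1, ⟨zero_le_one, le_rfl⟩, by simpa using h, by simpa using h5⟩
  · have hyβ : 0 < y * β := by linarith
    have hβ0 : 0 < β := pos_of_mul_pos_right hyβ hy.le
    have key : y * γ - (2 * y - x) * (γ - β) / β < 1 / 2 - x + y := by
      have : y * γ - (2 * y - x) * (γ - β) / β = (y * γ * β - (2 * y - x) * (γ - β)) / β := by
        field_simp
      rw [this, div_lt_iff₀ hβ0]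
      nlinarith
    have hc : Continuous fun l : ℝ => y * (l * β + (1 - l) * γ) := by fun_prop
    set l₀ := (2 * y - x) / (y * β) with hl₀
    have hl0 : 0 < l₀ := div_pos (by linarith) hyβ
    have hl1 : l₀ ≤ 1 := (div_le_one hyβ).2 h
    have hval : y * (l₀ * β + (1 - l₀) * γ) < 1 / 2 - x + y := by
      have : y * (l₀ * β + (1 - l₀) * γ) = y * γ - (2 * y - x) * (γ - β) / β := by
        rw [hl₀]
        field_simp
        ring
      rw [this]
      exact key
    -- Decreasing l slightly makes the first inequality strict and, by continuity, preserves the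
    -- second.
    have hev : ∀ᶠ l in 𝓝[<] l₀, y * (l * β + (1 - l) * γ) < 1 / 2 - x + y ∧ l ∈ Ioo 0 l₀ :=
      ((hc.tendsto l₀).eventually_lt_const hval).filter_mono nhdsWithin_le_nhds |>.and
        (Ioo_mem_nhdsLT hl0)
    obtain ⟨l, hl, hl0', hl1'⟩ := hev.exists
    refine ⟨l, ⟨hl0'.le, hl1'.le.trans hl1⟩, ?_, hl⟩
    have := (lt_div_iff₀ hyβ).1 (hl1'.trans_eq hl₀)
    linarith

theorem profileBounded_of_interior {E : Set ℝ} (hE : E ⊆ Icc 1 2) {p q : ℝ} (hp : 1 < p)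
    (hpq : p < q) (h2 : 1 / p < 2 * (1 / q))
    (h3 : 2 * (1 / p) < 1 + (1 - minkowskiDim E) * (1 / q))
    (h4 : 2 * quasiAssouadDim E * (1 / p) < minkowskiDim E + (4 * quasiAssouadDim E -
      2 * minkowskiDim E - 2 * minkowskiDim E * quasiAssouadDim E) * (1 / q)) :
    ProfileBounded E p q := by
  have hβ := minkowskiDim_nonneg E
  have hγ := minkowskiDim_le_quasiAssouadDim hE
  have hp0 : 0 < p := by linarith
  have hq0 : 0 < q := by linarith
  have hyx : 1 / q < 1 / p := one_div_lt_one_div_of_lt hp0 hpq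
  have hy : 0 < 1 / q := by positivity
  obtain ⟨l, hl, hl1, hl2⟩ := exists_convex_weight hβ hγ h2 hy h3 hyx h4
  generalize hx' : 1 / p = x at *
  generalize hy' : 1 / q = y at *
  generalize hb : minkowskiDim E = β at *
  generalize hg : quasiAssouadDim E = γ at *
  -- The counting bounds hold only for exponents above the dimensions; the strict inequalities leave
  -- room for ε.
  have hev : ∀ᶠ ε in 𝓝[>] (0 : ℝ), (y * (β + ε) < 1 / 2 - x + y ∧
      y * (β + ε) < 1 - 2 * x + y ∧ y * (l * (β + ε) + (1 - l) * ε) < 2 * y - x ∧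
      y * (l * (β + ε) + (1 - l) * (γ + ε + ε)) < 1 / 2 - x + y) ∧ 0 < ε := by
    refine Eventually.and ?_ self_mem_nhdsWithin
    refine Eventually.filter_mono nhdsWithin_le_nhds ?_
    refine Eventually.and ?_ (Eventually.and ?_ (Eventually.and ?_ ?_))
    · have hc : Continuous fun ε : ℝ => y * (β + ε) := by fun_prop
      exact (hc.tendsto 0).eventually_lt_const (by simp only [add_zero]; nlinarith)
    · have hc : Continuous fun ε : ℝ => y * (β + ε) := by fun_prop
      exact (hc.tendsto 0).eventually_lt_const (by simp only [add_zero]; nlinarith)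
    · have hc : Continuous fun ε : ℝ => y * (l * (β + ε) + (1 - l) * ε) := by fun_prop
      exact (hc.tendsto 0).eventually_lt_const (by simpa using hl1)
    · have hc : Continuous fun ε : ℝ => y * (l * (β + ε) + (1 - l) * (γ + ε + ε)) := by fun_prop
      exact (hc.tendsto 0).eventually_lt_const (by simpa using hl2)
  obtain ⟨ε, ⟨e1, e2, e3, e4⟩, hε⟩ := hev.exists
  obtain ⟨C₁, hC₁, hcard⟩ := ncard_cells_le_rpow hE (a := β + ε) (by linarith)
  obtain ⟨C₂, hC₂, hnear⟩ := ncard_cells_near_le hE (a := γ + ε) (ε := ε) (by linarith)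
    (by linarith) hε
  set C := max C₁ C₂
  have hC : 0 < C := lt_max_of_lt_left hC₁
  have hcard' : ∀ δ ∈ Ioo (0 : ℝ) 1, ((cells E δ).ncard : ℝ) ≤ C * δ ^ (-(β + ε)) := by
    intro δ hδ
    have := hδ.1
    exact (hcard δ hδ).trans (by gcongr; exact le_max_left _ _)
  have hnear' : ∀ δ ∈ Ioo (0 : ℝ) 1, ∀ ρ x : ℝ, δ ≤ ρ →
      ({i ∈ cells E δ | |(i : ℝ) * δ - x| ≤ ρ}.ncard : ℝ) ≤
        C * (δ ^ (-ε) * (ρ / δ) ^ (γ + ε)) := by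
    intro δ hδ ρ x hρ
    have := hδ.1
    refine (hnear δ hδ ρ x hρ).trans ?_
    have h0 : 0 ≤ ρ / δ := div_nonneg (by linarith) this.le
    gcongr
    exact le_max_right _ _
  have h1' : |(-1 : ℝ)| = 1 := by simp
  refine profileBounded_of_pieces hp hpq.le (radialPieces C (β + ε) (γ + ε) ε) ?_ ?_ ?_
  · intro c m k
    fin_cases c
    · exact pieceFar_admissible hE hC abs_one abs_one hcard' m k
    · exact pieceFar_admissible hE hC abs_one h1' hcard' m k
    · exact pieceNear_admissible hE hC abs_one hcard' hnear' m k
    · exact pieceNear_admissible hE hC h1' hcard' hnear' m k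
    · exact pieceFocus_admissible hE hC abs_one h1' hcard' m k
    · exact pieceFocus_admissible hE hC h1' abs_one hcard' m k
  · subst hx' hy'
    intro c
    fin_cases c
    · exact pieceFar_bound hC hyx e1 _ _
    · exact pieceFar_bound hC hyx e1 _ _
    · exact pieceNear_bound hC hy.le hl e3 e4 _ _
    · exact pieceNear_bound hC hy.le hl e3 e4 _ _
    · exact pieceFocus_bound hC e2 e1 _ _
    · exact pieceFocus_bound hC e2 e1 _ _
  · intro r t s hr ht hs
    exact exists_radialPieces_covers C (β + ε) (γ + ε) ε hr (hE ht) hs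

/-! ### From polar coordinates to the plane -/

lemma eLpNorm_radial {f : Plane → ℂ} (hf : IsRadial f) {G : ℝ → ℂ} (hG : Measurable G)
    (hfG : ∀ᵐ r ∂(volume.restrict (Ioi (0 : ℝ))), profile f r = G r) {p : ℝ} (hp : 0 < p) :
    eLpNorm f (ENNReal.ofReal p) volume ^ p = circleMass * weightedEnergy p fun r => ‖G r‖ₑ := by
  rw [eLpNorm_eq_lintegral_rpow_enorm_toReal (by simp [hp]) (by simp), ENNReal.toReal_ofReal hp.le,
    ← ENNReal.rpow_mul, one_div, inv_mul_cancel₀ hp.ne', ENNReal.rpow_one]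
  have h1 : ∀ᵐ x : Plane, ‖f x‖ₑ ^ p = ‖G ‖x‖‖ₑ ^ p := by
    filter_upwards [ae_norm_of_ae hfG] with x hx
    rw [hf.eq_profile, hx]
  rw [lintegral_congr_ae h1, lintegral_norm_plane (h := fun r => ‖G r‖ₑ ^ p) (by fun_prop)]
  rfl

lemma lintegral_circle_le_profileMaximal {f : Plane → ℂ} (hf : IsRadial f) {G : ℝ → ℂ}
    (hfG : ∀ᵐ r ∂(volume.restrict (Ioi (0 : ℝ))), profile f r = G r) {E : Set ℝ}
    (hE : E ⊆ Icc 1 2) {x : Plane} (hx : x ≠ 0) {t : ℝ} (ht : t ∈ E) :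
    ∫⁻ φ in Ioc 0 (2 * Real.pi), ‖f (x - t • circlePoint φ)‖ₑ ≤
      2 * profileMaximal E (fun r => ‖G r‖ₑ) ‖x‖ := by
  have ht0 : 0 < t := by linarith [(hE ht).1]
  calc ∫⁻ φ in Ioc 0 (2 * Real.pi), ‖f (x - t • circlePoint φ)‖ₑ
      = ∫⁻ φ in Ioc 0 (2 * Real.pi), ‖G ‖x - t • circlePoint φ‖‖ₑ := by
        refine lintegral_congr_ae ?_
        filter_upwards [ae_circle_of_ae hfG hx ht0] with φ hφ
        rw [hf.eq_profile, hφ]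
    _ ≤ _ := lintegral_circle_le hx ht0 fun r => ‖G r‖ₑ
    _ ≤ _ := by
        gcongr
        exact le_iSup₂ (f := fun t _ => ∫⁻ s in Ioo |‖x‖ - t| (‖x‖ + t),
          ENNReal.ofReal (radialKernel ‖x‖ t s) * ‖G s‖ₑ) t ht

lemma enorm_circularMean_le (t : ℝ) (f : Plane → ℂ) (x : Plane) :
    ‖circularMean t f x‖ₑ ≤ ∫⁻ φ in Ioc 0 (2 * Real.pi), ‖f (x - t • circlePoint φ)‖ₑ := by
  rw [circularMean, enorm_smul, intervalIntegral.integral_of_le Real.two_pi_pos.le]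
  have h1 : ‖((2 * Real.pi)⁻¹ : ℝ)‖ₑ ≤ 1 := by
    rw [← ofReal_norm, Real.norm_of_nonneg (by positivity)]
    refine ENNReal.ofReal_le_one.2 (inv_le_one_of_one_le₀ ?_)
    linarith [Real.pi_gt_three]
  calc _ ≤ 1 * ∫⁻ φ in Ioc 0 (2 * Real.pi), ‖f (x - t • circlePoint φ)‖ₑ :=
        mul_le_mul' h1 (enorm_integral_le_lintegral_enorm _)
    _ = _ := one_mul _

/-- The maximal function of a finite union is controlled by the sum of the majorants, which is
measurable and can be integrated in polar coordinates. -/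
theorem isRadialStrongType_of_profileBounded {n : ℕ} {E : Fin n → Set ℝ}
    (hE : ∀ j, E j ⊆ Icc 1 2) {p q : ℝ} (hp : 0 < p) (hq : 0 < q)
    (hb : ∀ j, ProfileBounded (E j) p q) :
    IsRadialStrongType (⋃ j, E j) (ENNReal.ofReal p) (ENNReal.ofReal q) := by
  choose C hC hb using hb
  set D : ℝ≥0∞ := (2 ^ q * (circleMass * ∑ j, C j)) ^ (1 / q) * circleMass⁻¹ ^ (1 / p) with hD
  have hDtop : D ≠ ∞ := by
    refine ENNReal.mul_ne_top (ENNReal.rpow_ne_top_of_nonneg (by positivity) ?_)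
      (ENNReal.rpow_ne_top_of_nonneg (by positivity) (ENNReal.inv_ne_top.2 circleMass_ne_zero))
    refine ENNReal.mul_ne_top (ENNReal.rpow_ne_top_of_nonneg hq.le (by simp))
      (ENNReal.mul_ne_top circleMass_ne_top ?_)
    exact (ENNReal.sum_lt_top.2 fun j _ => (hC j).lt_top).ne
  refine ⟨D.toNNReal, fun f hf hfp => ?_⟩
  rw [ENNReal.coe_toNNReal hDtop]
  obtain ⟨G, hG, hfG⟩ := hf.exists_measurable_profile hfp.1
  set h : ℝ → ℝ≥0∞ := fun r => ‖G r‖ₑ with hh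
  have hhm : Measurable h := hG.enorm
  have hnorm := eLpNorm_radial hf hG hfG hp
  have hX : weightedEnergy p h = circleMass⁻¹ * eLpNorm f (ENNReal.ofReal p) volume ^ p := by
    rw [hnorm, ← mul_assoc, ENNReal.inv_mul_cancel circleMass_ne_zero circleMass_ne_top, one_mul]
  have hXtop : weightedEnergy p h ≠ ∞ := by
    rw [hX]
    exact ENNReal.mul_ne_top (ENNReal.inv_ne_top.2 circleMass_ne_zero)
      (ENNReal.rpow_ne_top_of_nonneg hp.le hfp.2.ne)
  choose B hBm hB1 hB2 using fun j => hb j h hhm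
  have hx0 : ∀ᵐ x : Plane, x ≠ 0 := by
    rw [ae_iff]
    simp
  constructor
  -- Finiteness of the majorants at almost every radius gives absolute convergence of the circular
  -- means for all t at once.
  · have hfin : ∀ᵐ r ∂(volume.restrict (Ioi (0 : ℝ))), ∀ j, B j r < ∞ := by
      rw [ae_all_iff]
      intro j
      have h1 : ∫⁻ r in Ioi (0 : ℝ), B j r * ENNReal.ofReal r ≠ ∞ :=
        ((hB2 j).trans_lt (ENNReal.mul_lt_top (hC j).lt_top
          (ENNReal.rpow_lt_top_of_nonneg (by positivity) hXtop))).ne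
      filter_upwards [ae_lt_top ((hBm j).mul (by fun_prop)) h1,
        ae_restrict_mem measurableSet_Ioi] with r hr hr0
      exact ENNReal.lt_top_of_mul_ne_top_left hr.ne (by simpa using hr0)
    filter_upwards [ae_norm_of_ae hfin, hx0] with x hx hx0 t ht
    obtain ⟨j, hj⟩ := mem_iUnion.1 ht
    have ht0 : 0 < t := by linarith [(hE j hj).1]
    rw [intervalIntegrable_iff_integrableOn_Ioc_of_le Real.two_pi_pos.le]
    refine ⟨?_, ?_⟩
    · have hc : Continuous fun φ : ℝ => ‖x - t • circlePoint φ‖ := by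
        unfold circlePoint
        fun_prop
      refine (hG.comp hc.measurable).aestronglyMeasurable.congr ?_
      filter_upwards [ae_circle_of_ae hfG hx0 ht0] with φ hφ
      rw [hf.eq_profile, hφ]
      rfl
    · rw [hasFiniteIntegral_iff_enorm]
      refine (lintegral_circle_le_profileMaximal hf hfG (hE j) hx0 hj).trans_lt ?_
      refine ENNReal.mul_lt_top (by simp) ?_
      have h2 := (hB1 j ‖x‖ (norm_pos_iff.2 hx0)).trans_lt (hx j)
      exact (ENNReal.rpow_lt_top_iff_of_pos hq).1 h2
  · have hmax : ∀ᵐ x : Plane, maximalFunction (⋃ j, E j) f x ^ q ≤ 2 ^ q * ∑ j, B j ‖x‖ := by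
      filter_upwards [hx0] with x hx
      have hle : maximalFunction (⋃ j, E j) f x ≤ 2 * (∑ j, B j ‖x‖) ^ q⁻¹ := by
        refine iSup₂_le fun t ht => ?_
        obtain ⟨j, hj⟩ := mem_iUnion.1 ht
        refine (enorm_circularMean_le t f x).trans
          ((lintegral_circle_le_profileMaximal hf hfG (hE j) hx hj).trans ?_)
        gcongr
        rw [ENNReal.le_rpow_inv_iff hq]
        exact (hB1 j ‖x‖ (norm_pos_iff.2 hx)).trans
          (Finset.single_le_sum (f := fun j => B j ‖x‖) (fun _ _ => zero_le) (Finset.mem_univ j))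
      calc _ ≤ (2 * (∑ j, B j ‖x‖) ^ q⁻¹) ^ q := by gcongr
        _ = _ := by
          rw [ENNReal.mul_rpow_of_nonneg _ _ hq.le, ← ENNReal.rpow_mul, inv_mul_cancel₀ hq.ne',
            ENNReal.rpow_one]
    have hBs : Measurable fun r => ∑ j, B j r := Finset.measurable_fun_sum _ fun j _ => hBm j
    have hint : ∫⁻ x : Plane, maximalFunction (⋃ j, E j) f x ^ q ≤
        2 ^ q * (circleMass * ∑ j, C j) * weightedEnergy p h ^ (q / p) := by
      calc _ ≤ ∫⁻ x : Plane, 2 ^ q * ∑ j, B j ‖x‖ := lintegral_mono_ae hmax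
        _ = 2 ^ q * (circleMass * ∫⁻ r in Ioi (0 : ℝ), (∑ j, B j r) * ENNReal.ofReal r) := by
          rw [← lintegral_norm_plane hBs]
          exact lintegral_const_mul _ (hBs.comp measurable_norm)
        _ = 2 ^ q * (circleMass * ∑ j, ∫⁻ r in Ioi (0 : ℝ), B j r * ENNReal.ofReal r) := by
          simp_rw [Finset.sum_mul]
          congr 2
          exact lintegral_finsetSum _ fun j _ => (hBm j).mul (by fun_prop)
        _ ≤ 2 ^ q * (circleMass * ∑ j, C j * weightedEnergy p h ^ (q / p)) := by
          gcongr with j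
          exact hB2 j
        _ = _ := by rw [← Finset.sum_mul]; ring
    rw [eLpNorm_eq_lintegral_rpow_enorm_toReal (by simp [hq]) (by simp), ENNReal.toReal_ofReal hq.le]
    simp only [enorm_eq_self]
    calc _ ≤ (2 ^ q * (circleMass * ∑ j, C j) * weightedEnergy p h ^ (q / p)) ^ (1 / q) := by
          gcongr
      _ = (2 ^ q * (circleMass * ∑ j, C j)) ^ (1 / q) * weightedEnergy p h ^ (1 / p) := by
          rw [ENNReal.mul_rpow_of_nonneg _ _ (by positivity), ← ENNReal.rpow_mul]
          congr 2
          field_simp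
      _ = _ := by
          have h1 : (circleMass⁻¹ * eLpNorm f (ENNReal.ofReal p) volume ^ p) ^ (1 / p) =
              circleMass⁻¹ ^ (1 / p) * eLpNorm f (ENNReal.ofReal p) volume := by
            rw [ENNReal.mul_rpow_of_nonneg _ _ (by positivity), ← ENNReal.rpow_mul,
              mul_one_div_cancel hp.ne', ENNReal.rpow_one]
          rw [hX, h1, hD, mul_assoc]

theorem mem_radialTypeSet_of_interior {n : ℕ} {E : Fin n → Set ℝ} (hE : ∀ j, E j ⊆ Icc 1 2)
    {a b : ℝ} (hb : 0 < b) (hba : b < a) (ha1 : a < 1) (hab : a < 2 * b)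
    (h3 : ∀ j, 2 * a < 1 + (1 - minkowskiDim (E j)) * b)
    (h4 : ∀ j, 2 * quasiAssouadDim (E j) * a < minkowskiDim (E j) + (4 * quasiAssouadDim (E j) -
      2 * minkowskiDim (E j) - 2 * minkowskiDim (E j) * quasiAssouadDim (E j)) * b) :
    (a, b) ∈ radialTypeSet (⋃ j, E j) := by
  have ha : 0 < a := hb.trans hba
  refine ⟨⟨ha.le, ha1.le⟩, ⟨hb.le, by simp only; linarith⟩, ?_⟩
  simp only
  rw [← ENNReal.ofReal_inv_of_pos ha, ← ENNReal.ofReal_inv_of_pos hb]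
  refine isRadialStrongType_of_profileBounded hE (inv_pos.2 ha) (inv_pos.2 hb) fun j => ?_
  refine profileBounded_of_interior (hE j) ((one_lt_inv₀ ha).2 ha1) (inv_strictAnti₀ hb hba) ?_ ?_ ?_
  · simpa using hab
  · simpa using h3 j
  · simpa using h4 j

/-! ### Testing the maximal operator on annuli -/

/-- The indicator function of the points whose norm lies in `S`. -/
noncomputable def annulus (S : Set ℝ) (x : Plane) : ℂ := S.indicator 1 ‖x‖

lemma annulus_isRadial (S : Set ℝ) : IsRadial (annulus S) := by
  intro x y h
  simp [annulus, h]

lemma annulus_eq_indicator (S : Set ℝ) :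
    annulus S = {x : Plane | ‖x‖ ∈ S}.indicator fun _ => (1 : ℂ) := by
  ext x
  by_cases h : ‖x‖ ∈ S
  · simp [annulus, h]
  · simp [annulus, h]

lemma volume_norm_mem {S : Set ℝ} (hS : MeasurableSet S) :
    volume {x : Plane | ‖x‖ ∈ S} =
      circleMass * ∫⁻ r in Ioi (0 : ℝ), S.indicator 1 r * ENNReal.ofReal r := by
  rw [← lintegral_norm_plane (measurable_one.indicator hS)]
  exact (lintegral_indicator_one (show MeasurableSet {x : Plane | ‖x‖ ∈ S} from
    measurable_norm hS)).symm

lemma volume_norm_mem_le {S : Set ℝ} (hS : MeasurableSet S) {s₁ S₀ : ℝ} (hs₁ : 0 ≤ s₁)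
    (hSs : ∀ s ∈ S, s ≤ s₁) (hvol : volume S ≤ ENNReal.ofReal S₀) :
    volume {x : Plane | ‖x‖ ∈ S} ≤ circleMass * ENNReal.ofReal (s₁ * S₀) := by
  rw [volume_norm_mem hS]
  gcongr
  calc ∫⁻ r in Ioi (0 : ℝ), S.indicator 1 r * ENNReal.ofReal r
      ≤ ∫⁻ r, S.indicator (fun _ => ENNReal.ofReal s₁) r := by
        refine (setLIntegral_le_lintegral _ _).trans (lintegral_mono fun r => ?_)
        by_cases hr : r ∈ S
        · simpa [hr] using ENNReal.ofReal_le_ofReal (hSs r hr)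
        · simp [hr]
    _ = ENNReal.ofReal s₁ * volume S := by rw [lintegral_indicator_const hS]
    _ ≤ _ := by
        rw [ENNReal.ofReal_mul hs₁]
        gcongr

lemma le_volume_norm_mem {U : Set ℝ} (hU : MeasurableSet U) {u₀ U₀ : ℝ} (hu₀ : 0 < u₀)
    (hUu : ∀ r ∈ U, u₀ ≤ r) (hvol : ENNReal.ofReal U₀ ≤ volume U) :
    circleMass * ENNReal.ofReal (u₀ * U₀) ≤ volume {x : Plane | ‖x‖ ∈ U} := by
  rw [volume_norm_mem hU]
  gcongr
  calc ENNReal.ofReal (u₀ * U₀) ≤ ENNReal.ofReal u₀ * volume U := by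
        rw [ENNReal.ofReal_mul hu₀.le]
        gcongr
    _ = ∫⁻ r, U.indicator (fun _ => ENNReal.ofReal u₀) r := by rw [lintegral_indicator_const hU]
    _ ≤ ∫⁻ r, (Ioi (0 : ℝ)).indicator (fun r => U.indicator 1 r * ENNReal.ofReal r) r := by
        refine lintegral_mono fun r => ?_
        by_cases hr : r ∈ U
        · have h1 : r ∈ Ioi (0 : ℝ) := hu₀.trans_le (hUu r hr)
          rw [indicator_of_mem hr, indicator_of_mem h1, indicator_of_mem hr]
          simpa using ENNReal.ofReal_le_ofReal (hUu r hr)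
        · simp [hr]
    _ = _ := by rw [lintegral_indicator measurableSet_Ioi]

lemma le_norm_circularMean_annulus {S : Set ℝ} (hS : MeasurableSet S) {t φ₀ φ₁ : ℝ} {x : Plane}
    (h0 : 0 ≤ φ₀) (h01 : φ₀ ≤ φ₁) (h1 : φ₁ ≤ 2 * Real.pi)
    (h : ∀ φ ∈ Icc φ₀ φ₁, chord ‖x‖ t φ ∈ S) :
    (φ₁ - φ₀) / (2 * Real.pi) ≤ ‖circularMean t (annulus S) x‖ := by
  have hint := integral_circle_norm x t (fun r => S.indicator (1 : ℝ → ℂ) r)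
  have hcoe : ∀ φ, S.indicator (1 : ℝ → ℂ) (chord ‖x‖ t φ) =
      ((S.indicator (1 : ℝ → ℝ) (chord ‖x‖ t φ) : ℝ) : ℂ) := by
    intro φ
    by_cases hφ : chord ‖x‖ t φ ∈ S <;> simp [hφ]
  simp only [hcoe] at hint
  rw [intervalIntegral.integral_ofReal] at hint
  have hmeas : Measurable fun φ => S.indicator (1 : ℝ → ℝ) (chord ‖x‖ t φ) :=
    (measurable_one.indicator hS).comp (chord_continuous _ _).measurable
  have hnn : ∀ φ, 0 ≤ S.indicator (1 : ℝ → ℝ) (chord ‖x‖ t φ) := fun φ =>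
    indicator_nonneg (fun _ _ => zero_le_one) _
  have hle1 : ∀ φ, S.indicator (1 : ℝ → ℝ) (chord ‖x‖ t φ) ≤ 1 := fun φ =>
    indicator_le_self' (f := (1 : ℝ → ℝ)) (fun _ _ => zero_le_one) _
  have hI : IntegrableOn (fun φ => S.indicator (1 : ℝ → ℝ) (chord ‖x‖ t φ))
      (Ioc 0 (2 * Real.pi)) := by
    refine Measure.integrableOn_of_bounded (M := 1) measure_Ioc_lt_top.ne
      hmeas.aestronglyMeasurable ?_
    filter_upwards with φ
    rw [Real.norm_of_nonneg (hnn φ)]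
    exact hle1 φ
  have hlow : φ₁ - φ₀ ≤ ∫ φ in (0 : ℝ)..(2 * Real.pi),
      S.indicator (1 : ℝ → ℝ) (chord ‖x‖ t φ) := by
    rw [intervalIntegral.integral_of_le Real.two_pi_pos.le]
    calc φ₁ - φ₀ = ∫ φ in Ioc φ₀ φ₁, (1 : ℝ) := by
          simp [h01]
      _ = ∫ φ in Ioc φ₀ φ₁, S.indicator (1 : ℝ → ℝ) (chord ‖x‖ t φ) := by
          refine setIntegral_congr_fun measurableSet_Ioc fun φ hφ => ?_
          simp [h φ ⟨hφ.1.le, hφ.2⟩]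
      _ ≤ _ := setIntegral_mono_set hI (Eventually.of_forall hnn)
          (Eventually.of_forall (Ioc_subset_Ioc h0 h1))
  have heq : ∫ φ in (0 : ℝ)..(2 * Real.pi), annulus S (x - t • circlePoint φ) =
      ((∫ φ in (0 : ℝ)..(2 * Real.pi), S.indicator (1 : ℝ → ℝ) (chord ‖x‖ t φ) : ℝ) : ℂ) := by
    rw [← hint]
    refine intervalIntegral.integral_congr fun φ _ => ?_
    simp only [annulus]
  rw [circularMean, heq, norm_smul, Complex.norm_real, Real.norm_of_nonneg (by positivity),
    Real.norm_of_nonneg (by linarith), div_eq_inv_mul]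
  gcongr

/-- Reduces every necessary condition to choosing two sets of radii S and U such that some mean of
the annulus over S is at least α at each point with norm in U. The exponents ∞, where a or b is 0,
are included. -/
lemma IsRadialStrongType.exists_test {E : Set ℝ} {a b : ℝ} (ha : 0 ≤ a) (hb : 0 ≤ b)
    (h : IsRadialStrongType E (ENNReal.ofReal a)⁻¹ (ENNReal.ofReal b)⁻¹) :
    ∃ C : ℝ, 0 < C ∧ ∀ (S U : Set ℝ) (s₁ S₀ u₀ U₀ α : ℝ), MeasurableSet S → MeasurableSet U →
      0 < s₁ → 0 < S₀ → 0 < u₀ → 0 < U₀ → 0 ≤ α → (∀ s ∈ S, s ≤ s₁) → (∀ r ∈ U, u₀ ≤ r) →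
      volume S ≤ ENNReal.ofReal S₀ → ENNReal.ofReal U₀ ≤ volume U →
      (∀ x : Plane, ‖x‖ ∈ U → ∃ t ∈ E, α ≤ ‖circularMean t (annulus S) x‖) →
      α * (u₀ * U₀) ^ b ≤ C * (s₁ * S₀) ^ a := by
  obtain ⟨C, hC⟩ := h
  have ha' : (ENNReal.ofReal a)⁻¹ ≠ 0 := by simp
  have hb' : (ENNReal.ofReal b)⁻¹ ≠ 0 := by simp
  have hta : 1 / (ENNReal.ofReal a)⁻¹.toReal = a := by
    rw [ENNReal.toReal_inv, ENNReal.toReal_ofReal ha, one_div, inv_inv]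
  have htb : 1 / (ENNReal.ofReal b)⁻¹.toReal = b := by
    rw [ENNReal.toReal_inv, ENNReal.toReal_ofReal hb, one_div, inv_inv]
  set c := circleMass.toReal with hc
  have hc0 : 0 < c := ENNReal.toReal_pos circleMass_ne_zero circleMass_ne_top
  have hcm : circleMass = ENNReal.ofReal c := (ENNReal.ofReal_toReal circleMass_ne_top).symm
  refine ⟨(C + 1) * c ^ a / c ^ b, by positivity, ?_⟩
  intro S U s₁ S₀ u₀ U₀ α hS hU hs₁ hS₀ hu₀ hU₀ hα hSs hUu hvS hvU hx
  have hSm : MeasurableSet {x : Plane | ‖x‖ ∈ S} := measurable_norm hS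
  have hUm : MeasurableSet {x : Plane | ‖x‖ ∈ U} := measurable_norm hU
  have hS1 := volume_norm_mem_le hS hs₁.le hSs hvS
  have hU1 := le_volume_norm_mem hU hu₀ hUu hvU
  rw [hcm, ← ENNReal.ofReal_mul hc0.le] at hS1 hU1
  have hmem : MemLp (annulus S) (ENNReal.ofReal a)⁻¹ volume := by
    rw [annulus_eq_indicator]
    exact memLp_indicator_const _ hSm _ (Or.inr (hS1.trans_lt ENNReal.ofReal_lt_top).ne)
  obtain ⟨-, hbd⟩ := hC _ (annulus_isRadial S) hmem
  have hup : eLpNorm (annulus S) (ENNReal.ofReal a)⁻¹ volume ≤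
      ENNReal.ofReal ((c * (s₁ * S₀)) ^ a) := by
    rw [annulus_eq_indicator]
    refine (eLpNorm_indicator_const_le _ _).trans ?_
    rw [hta, enorm_one, one_mul, ← ENNReal.ofReal_rpow_of_pos (by positivity)]
    gcongr
  have hlow : ENNReal.ofReal (α * (c * (u₀ * U₀)) ^ b) ≤
      eLpNorm (maximalFunction E (annulus S)) (ENNReal.ofReal b)⁻¹ volume := by
    have hne : volume {x : Plane | ‖x‖ ∈ U} ≠ 0 := by
      refine (lt_of_lt_of_le ?_ hU1).ne'
      rw [ENNReal.ofReal_pos]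
      positivity
    calc ENNReal.ofReal (α * (c * (u₀ * U₀)) ^ b)
        ≤ ENNReal.ofReal α * volume {x : Plane | ‖x‖ ∈ U} ^ b := by
          rw [ENNReal.ofReal_mul hα, ← ENNReal.ofReal_rpow_of_pos (by positivity)]
          gcongr
      _ = eLpNorm ({x : Plane | ‖x‖ ∈ U}.indicator fun _ => α) (ENNReal.ofReal b)⁻¹ volume := by
          rw [eLpNorm_indicator_const' hUm hne hb', htb, ← ofReal_norm, Real.norm_of_nonneg hα]
      _ ≤ _ := by
          refine eLpNorm_mono_enorm fun x => ?_
          by_cases hxU : ‖x‖ ∈ U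
          · obtain ⟨t, ht, hαt⟩ := hx x hxU
            rw [indicator_of_mem (show x ∈ {x : Plane | ‖x‖ ∈ U} from hxU), enorm_eq_self,
              ← ofReal_norm, Real.norm_of_nonneg hα]
            calc ENNReal.ofReal α ≤ ENNReal.ofReal ‖circularMean t (annulus S) x‖ :=
                  ENNReal.ofReal_le_ofReal hαt
              _ = ‖circularMean t (annulus S) x‖ₑ := ofReal_norm _
              _ ≤ _ := le_iSup₂ (f := fun t _ => ‖circularMean t (annulus S) x‖ₑ) t ht
          · rw [indicator_of_notMem (show x ∉ {x : Plane | ‖x‖ ∈ U} from hxU), enorm_zero]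
            exact zero_le
  have hall : ENNReal.ofReal (α * (c * (u₀ * U₀)) ^ b) ≤
      ENNReal.ofReal ((C + 1) * (c * (s₁ * S₀)) ^ a) := by
    refine (hlow.trans hbd).trans ?_
    rw [ENNReal.ofReal_mul (by positivity)]
    refine mul_le_mul' ?_ hup
    rw [← ENNReal.ofReal_coe_nnreal]
    exact ENNReal.ofReal_le_ofReal (by linarith)
  rw [ENNReal.ofReal_le_ofReal_iff (by positivity), Real.mul_rpow hc0.le (by positivity),
    Real.mul_rpow hc0.le (by positivity)] at hall
  rw [div_mul_eq_mul_div, le_div_iff₀ (by positivity)]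
  linarith

/-! ### The measure of a union of short intervals -/

lemma isOpen_iUnion_Ioo (F : Set ℝ) (δ : ℝ) : IsOpen (⋃ t ∈ F, Ioo t (t + δ)) :=
  isOpen_biUnion fun _ _ => isOpen_Ioo

/-- One point of F is chosen in each occupied cell. A given r lies in at most two of the
corresponding intervals, so their total length is at most twice the measure of the union. -/
lemma coveringNumber_mul_le_volume {F : Set ℝ} (hF : F ⊆ Icc 1 2) {δ : ℝ} (hδ : 0 < δ) :
    ENNReal.ofReal (coveringNumber F δ * δ / 2) ≤ volume (⋃ t ∈ F, Ioo t (t + δ)) := by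
  have hf := cells_finite hF hδ
  set U := ⋃ t ∈ F, Ioo t (t + δ) with hU
  have hUm : MeasurableSet U := (isOpen_iUnion_Ioo F δ).measurableSet
  have hch : ∀ i : ℤ, ∃ t, i ∈ cells F δ → t ∈ F ∧ ⌊t / δ⌋ = i := by
    intro i
    by_cases hi : i ∈ cells F δ
    · obtain ⟨t, ht, hti⟩ := hi
      exact ⟨t, fun _ => ⟨ht, hti⟩⟩
    · exact ⟨0, fun h => absurd h hi⟩
  choose τ hτ using hch
  have h1 : (hf.toFinset.card : ℝ≥0∞) * ENNReal.ofReal δ ≤ 2 * volume U := by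
    calc (hf.toFinset.card : ℝ≥0∞) * ENNReal.ofReal δ
        = ∑ i ∈ hf.toFinset, volume (Ioo (τ i) (τ i + δ)) := by
          simp [Real.volume_Ioo]
      _ = ∫⁻ r, ∑ i ∈ hf.toFinset, (Ioo (τ i) (τ i + δ)).indicator 1 r := by
          rw [lintegral_finsetSum _ fun i _ => measurable_one.indicator measurableSet_Ioo]
          simp_rw [lintegral_indicator_one measurableSet_Ioo]
      _ ≤ ∫⁻ r, U.indicator (fun _ => 2) r := by
          refine lintegral_mono fun r => ?_
          by_cases hr : r ∈ U
          · rw [indicator_of_mem hr]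
            -- An interval containing r starts in the cell of r or in the preceding one.
            have hsub : ∀ i ∈ hf.toFinset, (Ioo (τ i) (τ i + δ)).indicator (1 : ℝ → ℝ≥0∞) r ≤
                if i ∈ ({⌊r / δ⌋, ⌊r / δ⌋ - 1} : Finset ℤ) then 1 else 0 := by
              intro i hi
              by_cases hri : r ∈ Ioo (τ i) (τ i + δ)
              · obtain ⟨-, hi2⟩ := hτ i (by simpa using hi)
                have h2 : ⌊τ i / δ⌋ ≤ ⌊r / δ⌋ := Int.floor_le_floor (by gcongr; exact hri.1.le)
                have h3 : ⌊r / δ⌋ ≤ ⌊τ i / δ⌋ + 1 := by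
                  rw [← Int.floor_add_one]
                  apply Int.floor_le_floor
                  rw [div_add_one hδ.ne']
                  gcongr
                  exact hri.2.le
                rw [indicator_of_mem hri, if_pos]
                · simp
                · simp only [Finset.mem_insert, Finset.mem_singleton]
                  omega
              · rw [indicator_of_notMem hri]
                exact zero_le
            refine (Finset.sum_le_sum hsub).trans ?_
            rw [← Finset.sum_filter, Finset.sum_const, nsmul_eq_mul, mul_one]
            have hcard : (hf.toFinset.filter
                (· ∈ ({⌊r / δ⌋, ⌊r / δ⌋ - 1} : Finset ℤ))).card ≤ 2 := by
              refine (Finset.card_le_card (t := {⌊r / δ⌋, ⌊r / δ⌋ - 1}) ?_).trans Finset.card_le_two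
              intro i hi
              exact (Finset.mem_filter.1 hi).2
            exact_mod_cast hcard
          · rw [indicator_of_notMem hr, nonpos_iff_eq_zero]
            refine Finset.sum_eq_zero fun i hi => indicator_of_notMem (fun hri => hr ?_) _
            exact mem_iUnion₂.2 ⟨τ i, (hτ i (by simpa using hi)).1, hri⟩
      _ = 2 * volume U := lintegral_indicator_const hUm 2
  have h2 : (coveringNumber F δ : ℝ) ≤ hf.toFinset.card := by
    have := coveringNumber_le_ncard_cells hF hδ
    rw [Set.ncard_eq_toFinset_card _ hf] at this
    exact_mod_cast this
  rw [ENNReal.ofReal_div_of_pos two_pos]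
  refine ENNReal.div_le_of_le_mul' ?_
  rw [ENNReal.ofReal_ofNat]
  refine le_trans ?_ h1
  rw [ENNReal.ofReal_mul (by positivity), ENNReal.ofReal_natCast]
  gcongr
  exact_mod_cast h2

/-! ### Necessary conditions -/

lemma exponent_le_of_forall_rpow_le {x y C : ℝ}
    (h : ∀ δ ∈ Ioo (0 : ℝ) (1 / 4), δ ^ x ≤ C * δ ^ y) : y ≤ x := by
  by_contra! hxy
  have ht := tendsto_rpow_neg_nhdsGT_zero (y := x - y) (by linarith)
  have hev := (ht.eventually_gt_atTop C).and (Ioo_mem_nhdsGT (show (0 : ℝ) < 1 / 4 by norm_num))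
  obtain ⟨δ, h1, h2⟩ := hev.exists
  have h3 := h δ h2
  have h4 : δ ^ x = δ ^ (x - y) * δ ^ y := by rw [← Real.rpow_add h2.1]; congr 1; ring
  rw [h4] at h3
  have h5 := le_of_mul_le_mul_right h3 (Real.rpow_pos_of_pos h2.1 y)
  linarith

lemma chord_le {r t φ : ℝ} (hr : 0 ≤ r) (ht : 0 ≤ t) : chord r t φ ≤ r + t := by
  rw [chord]
  refine Real.sqrt_le_iff.2 ⟨by positivity, ?_⟩
  nlinarith [Real.neg_one_le_cos φ, mul_nonneg hr ht]

lemma le_chord {r t φ : ℝ} (hr : 0 ≤ r) (ht : 0 ≤ t) : t - r ≤ chord r t φ := by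
  rw [chord]
  refine Real.le_sqrt_of_sq_le ?_
  nlinarith [Real.cos_le_one φ, mul_nonneg hr ht]

/-- Test on the ball of radius 1/δ: all means equal 1 on a comparable annulus. -/
lemma IsRadialStrongType.snd_le_fst {E : Set ℝ} {a b : ℝ} (ha : 0 ≤ a) (hb : 0 ≤ b)
    (h : IsRadialStrongType E (ENNReal.ofReal a)⁻¹ (ENNReal.ofReal b)⁻¹) (hE : E ⊆ Icc 1 2)
    (hne : E.Nonempty) : b ≤ a := by
  obtain ⟨C, hC0, hC⟩ := h.exists_test ha hb
  obtain ⟨t, ht⟩ := hne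
  have ht1 := (hE ht).1
  have ht2 := (hE ht).2
  suffices h : -(2 * a) ≤ -(2 * b) by linarith
  refine exponent_le_of_forall_rpow_le (C := C / (1 / 16) ^ b) fun δ hδ => ?_
  have hδ0 := hδ.1
  have hR : 4 ≤ δ⁻¹ := by
    rw [le_inv_comm₀ (by norm_num) hδ0]
    linarith [hδ.2]
  have key := hC (Icc 0 δ⁻¹) (Icc (δ⁻¹ / 4) (δ⁻¹ / 2)) δ⁻¹ δ⁻¹ (δ⁻¹ / 4) (δ⁻¹ / 4) 1
    measurableSet_Icc measurableSet_Icc (by positivity) (by positivity) (by positivity)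
    (by positivity) zero_le_one (fun s hs => hs.2) (fun r hr => hr.1)
    (by simp) (by rw [Real.volume_Icc]; exact ENNReal.ofReal_le_ofReal (by linarith)) ?_
  · have e1 : ∀ c : ℝ, (δ⁻¹ * δ⁻¹) ^ c = δ ^ (-(2 * c)) := by
      intro c
      rw [← pow_two, ← Real.rpow_natCast, ← Real.rpow_mul (by positivity), Real.inv_rpow hδ0.le,
        ← Real.rpow_neg hδ0.le]
      norm_num
    rw [one_mul, show δ⁻¹ / 4 * (δ⁻¹ / 4) = 1 / 16 * (δ⁻¹ * δ⁻¹) by ring,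
      Real.mul_rpow (by norm_num) (by positivity), e1, e1] at key
    rw [div_mul_eq_mul_div, le_div_iff₀ (by positivity)]
    linarith
  · intro x hx
    refine ⟨t, ht, ?_⟩
    have h1 := le_norm_circularMean_annulus (S := Icc 0 δ⁻¹) measurableSet_Icc (t := t) (x := x)
      le_rfl Real.two_pi_pos.le le_rfl fun φ _ => ⟨Real.sqrt_nonneg _, ?_⟩
    · rwa [sub_zero, div_self Real.two_pi_pos.ne'] at h1
    · refine (chord_le (norm_nonneg _) (by linarith)).trans ?_
      linarith [hx.2]

/-- Focusing test: for |x| ≤ δ the whole circle of radius t lies in the annulus of width 2δ around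
radius t, so a function of mass about δ yields 1 on a set of area about δ². -/
lemma IsRadialStrongType.fst_le_two_mul_snd {E : Set ℝ} {a b : ℝ} (ha : 0 ≤ a) (hb : 0 ≤ b)
    (h : IsRadialStrongType E (ENNReal.ofReal a)⁻¹ (ENNReal.ofReal b)⁻¹) (hE : E ⊆ Icc 1 2)
    (hne : E.Nonempty) : a ≤ 2 * b := by
  obtain ⟨C, hC0, hC⟩ := h.exists_test ha hb
  obtain ⟨t, ht⟩ := hne
  have ht1 := (hE ht).1
  have ht2 := (hE ht).2
  refine exponent_le_of_forall_rpow_le (C := C * 6 ^ a / (1 / 4) ^ b) fun δ hδ => ?_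
  have hδ0 := hδ.1
  have hδ1 := hδ.2
  have key := hC (Icc (t - δ) (t + δ)) (Icc (δ / 2) δ) 3 (2 * δ) (δ / 2) (δ / 2) 1
    measurableSet_Icc measurableSet_Icc (by positivity) (by positivity) (by positivity)
    (by positivity) zero_le_one (fun s hs => by linarith [hs.2]) (fun r hr => hr.1)
    (by rw [Real.volume_Icc]; exact ENNReal.ofReal_le_ofReal (by linarith))
    (by rw [Real.volume_Icc]; exact ENNReal.ofReal_le_ofReal (by linarith)) ?_
  · rw [one_mul, show δ / 2 * (δ / 2) = 1 / 4 * δ ^ 2 by ring, show 3 * (2 * δ) = 6 * δ by ring,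
      Real.mul_rpow (by norm_num) (by positivity), Real.mul_rpow (by norm_num) (by positivity),
      ← Real.rpow_natCast, ← Real.rpow_mul hδ0.le] at key
    push_cast at key
    rw [div_mul_eq_mul_div, le_div_iff₀ (by positivity)]
    linarith
  · intro x hx
    refine ⟨t, ht, ?_⟩
    have h1 := le_norm_circularMean_annulus (S := Icc (t - δ) (t + δ)) measurableSet_Icc (t := t)
      (x := x) le_rfl Real.two_pi_pos.le le_rfl fun φ _ => ⟨?_, ?_⟩
    · rwa [sub_zero, div_self Real.two_pi_pos.ne'] at h1
    · refine le_trans ?_ (le_chord (norm_nonneg _) (by linarith))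
      linarith [hx.2]
    · refine (chord_le (norm_nonneg _) (by linarith)).trans ?_
      linarith [hx.2]

/-- Test on a ball of radius about δ: the mean is at least a multiple of δ whenever |x| is within δ
above a point of E, a set of area at least about N(E, δ)δ. -/
lemma IsRadialStrongType.exists_coveringNumber_le {E : Set ℝ} {a b : ℝ} (ha : 0 ≤ a) (hb : 0 ≤ b)
    (h : IsRadialStrongType E (ENNReal.ofReal a)⁻¹ (ENNReal.ofReal b)⁻¹) (hE : E ⊆ Icc 1 2)
    (hne : E.Nonempty) :
    ∃ C : ℝ, 0 < C ∧ ∀ δ ∈ Ioo (0 : ℝ) 1,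
      δ * (coveringNumber E δ * δ) ^ b ≤ C * δ ^ (2 * a) := by
  obtain ⟨C, hC0, hC⟩ := h.exists_test ha hb
  refine ⟨2 * Real.pi * C * 9 ^ a * 2 ^ b, by positivity, fun δ hδ => ?_⟩
  have hδ0 := hδ.1
  have hδ1 := hδ.2
  have hN : (0 : ℝ) < coveringNumber E δ := by
    rw [Nat.cast_pos, Nat.pos_iff_ne_zero]
    intro h0
    obtain ⟨c, hc⟩ := exists_cover hE hδ0
    obtain ⟨t, ht⟩ := hne
    obtain ⟨i, -⟩ := mem_iUnion.1 (hc ht)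
    rw [h0] at i
    exact i.elim0
  -- For angles up to δ the squared chord is at most δ² + 6δ², which is below (3δ)².
  have key := hC (Icc 0 (3 * δ)) (⋃ t ∈ E, Ioo t (t + δ)) (3 * δ) (3 * δ) 1
    (coveringNumber E δ * δ / 2) (δ / (2 * Real.pi)) measurableSet_Icc
    (isOpen_iUnion_Ioo E δ).measurableSet (by positivity) (by positivity) one_pos (by positivity)
    (by positivity) (fun s hs => hs.2) ?_ (by simp) (coveringNumber_mul_le_volume hE hδ0) ?_
  · rw [one_mul, show 3 * δ * (3 * δ) = 9 * δ ^ 2 by ring,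
      Real.mul_rpow (by norm_num) (by positivity), ← Real.rpow_natCast, ← Real.rpow_mul hδ0.le,
      Real.div_rpow (by positivity) (by norm_num), div_mul_div_comm,
      div_le_iff₀ (by positivity)] at key
    push_cast at key
    calc _ ≤ _ := key
      _ = _ := by ring
  · intro r hr
    obtain ⟨t, ht, hrt⟩ := mem_iUnion₂.1 hr
    linarith [(hE ht).1, hrt.1]
  · intro x hx
    obtain ⟨t, ht, hrt⟩ := mem_iUnion₂.1 hx
    have ht1 := (hE ht).1
    have ht2 := (hE ht).2
    refine ⟨t, ht, ?_⟩
    have h1 := le_norm_circularMean_annulus (S := Icc 0 (3 * δ)) measurableSet_Icc (t := t)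
      (x := x) le_rfl hδ0.le (by linarith [Real.pi_gt_three]) fun φ hφ => ⟨Real.sqrt_nonneg _, ?_⟩
    · rwa [sub_zero] at h1
    · rw [chord]
      refine Real.sqrt_le_iff.2 ⟨by positivity, ?_⟩
      have hcos := Real.one_sub_sq_div_two_le_cos (x := φ)
      have hφ2 : φ ^ 2 ≤ δ ^ 2 := pow_le_pow_left₀ hφ.1 hφ.2 2
      have h2 : 1 - Real.cos φ ≤ δ ^ 2 / 2 := by linarith
      have h3 : ‖x‖ * t ≤ 3 * 2 := by
        refine mul_le_mul ?_ ht2 (by linarith) (by norm_num)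
        linarith [hrt.2]
      have h4 : 0 ≤ ‖x‖ * t := mul_nonneg (norm_nonneg _) (by linarith)
      have h5 : (‖x‖ - t) ^ 2 ≤ δ ^ 2 := by
        refine pow_le_pow_left₀ ?_ ?_ 2 <;> linarith [hrt.1, hrt.2]
      have h6 : ‖x‖ * t * (1 - Real.cos φ) ≤ 6 * (δ ^ 2 / 2) :=
        mul_le_mul (by linarith) h2 (by linarith [Real.cos_le_one φ]) (by norm_num)
      nlinarith

/-- Test at the outer singularity with radii r of size l = v - u: near the antipodal angle π, the
chord stays within O(δ) of r + t on an arc of angle (δ/l)^{1/2}. Radii with r + t nearly equal to a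
fixed s₀ form a reflected copy of the δ-neighbourhood of E ∩ [u, v]. -/
lemma IsRadialStrongType.exists_local_coveringNumber_le {E : Set ℝ} {a b : ℝ} (ha : 0 ≤ a) (hb : 0 ≤ b)
    (h : IsRadialStrongType E (ENNReal.ofReal a)⁻¹ (ENNReal.ofReal b)⁻¹) (hE : E ⊆ Icc 1 2) :
    ∃ C : ℝ, 0 < C ∧ ∀ δ u v : ℝ, 0 < δ → δ ≤ v - u → v - u ≤ 1 →
      (E ∩ Icc u v).Nonempty →
      (δ / (v - u)) ^ (1 / 2 : ℝ) * ((v - u) * (coveringNumber (E ∩ Icc u v) δ * δ)) ^ b ≤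
        C * δ ^ a := by
  obtain ⟨C, hC0, hC⟩ := h.exists_test ha hb
  refine ⟨2 * Real.pi * C * 35 ^ a * 2 ^ b, by positivity, fun δ u v hδ0 hδl hl1 hne => ?_⟩
  set l := v - u with hl
  have hl0 : 0 < l := hδ0.trans_le hδl
  set F := E ∩ Icc u v with hF
  have hF1 : F ⊆ Icc 1 2 := inter_subset_left.trans hE
  have hN : (0 : ℝ) < coveringNumber F δ := by
    rw [Nat.cast_pos, Nat.pos_iff_ne_zero]
    intro h0
    obtain ⟨c, hc⟩ := exists_cover hF1 hδ0
    obtain ⟨t, ht⟩ := hne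
    obtain ⟨i, -⟩ := mem_iUnion.1 (hc ht)
    rw [h0] at i
    exact i.elim0
  have hv : 1 ≤ v ∧ v ≤ 3 := by
    obtain ⟨t, ht⟩ := hne
    have := hF1 ht
    constructor <;> linarith [this.1, this.2, ht.2.1, ht.2.2]
  set s₀ := v + 2 * l
  set η := √(δ / l) with hη
  have hη1 : η ≤ 1 := by
    rw [hη]
    exact Real.sqrt_le_one.2 ((div_le_one hl0).2 hδl)
  have hη2 : η ^ 2 = δ / l := Real.sq_sqrt (by positivity)
  have hη0 : 0 ≤ η := Real.sqrt_nonneg _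
  have hUpre : MeasurableSet ((fun r => s₀ - r) ⁻¹' ⋃ t ∈ F, Ioo t (t + δ)) :=
    (by fun_prop : Measurable fun r => s₀ - r) (isOpen_iUnion_Ioo F δ).measurableSet
  have hUvol : volume ((fun r => s₀ - r) ⁻¹' ⋃ t ∈ F, Ioo t (t + δ)) =
      volume (⋃ t ∈ F, Ioo t (t + δ)) :=
    (Measure.measurePreserving_sub_left volume s₀).measure_preimage
      (isOpen_iUnion_Ioo F δ).measurableSet.nullMeasurableSet
  have hmem : ∀ r ∈ (fun r => s₀ - r) ⁻¹' ⋃ t ∈ F, Ioo t (t + δ), ∃ t ∈ F, l ≤ r ∧ r ≤ 3 * l ∧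
      s₀ - δ ≤ r + t ∧ r + t ≤ s₀ := by
    intro r hr
    obtain ⟨t, ht, h1, h2⟩ := mem_iUnion₂.1 hr
    refine ⟨t, ht, ?_, ?_, ?_, ?_⟩ <;> linarith [ht.2.1, ht.2.2]
  -- With s₀ = v + 2l the radii fill part of [l, 3l]. The width 7δ allows δ for s₀ - (r + t) and 6δ
  -- for the curvature of the arc.
  have key := hC (Icc (s₀ - 7 * δ) s₀) ((fun r => s₀ - r) ⁻¹' ⋃ t ∈ F, Ioo t (t + δ)) 5 (7 * δ) l
    (coveringNumber F δ * δ / 2) (η / (2 * Real.pi)) measurableSet_Icc hUpre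
    (by norm_num) (by positivity) hl0 (by positivity) (by positivity)
    (fun s hs => by linarith [hs.2]) ?_ (by
      rw [Real.volume_Icc]; exact ENNReal.ofReal_le_ofReal (by linarith))
    (by rw [hUvol]; exact coveringNumber_mul_le_volume hF1 hδ0) ?_
  · rw [← Real.sqrt_eq_rpow, ← hη]
    rw [show (5 : ℝ) * (7 * δ) = 35 * δ by ring, Real.mul_rpow (by norm_num) hδ0.le,
      ← mul_div_assoc, Real.div_rpow (by positivity) (by norm_num), div_mul_div_comm,
      div_le_iff₀ (by positivity)] at key
    calc _ ≤ _ := key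
      _ = _ := by ring
  · intro r hr
    obtain ⟨t, -, h1, -⟩ := hmem r hr
    exact h1
  · intro x hx
    obtain ⟨t, ht, h1, h2, h3, h4⟩ := hmem _ hx
    have ht1 := (hF1 ht).1
    have ht2 := (hF1 ht).2
    refine ⟨t, ht.1, ?_⟩
    have h5 := le_norm_circularMean_annulus (S := Icc (s₀ - 7 * δ) s₀) measurableSet_Icc (t := t)
      (x := x) (φ₀ := Real.pi - η) (φ₁ := Real.pi) (by linarith [Real.pi_gt_three]) (by linarith)
      (by linarith [Real.pi_gt_three]) fun φ hφ => ⟨?_, ?_⟩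
    · rwa [sub_sub_cancel] at h5
    · generalize ‖x‖ = r at *
      have hcos := Real.one_sub_sq_div_two_le_cos (x := Real.pi - φ)
      rw [Real.cos_pi_sub] at hcos
      have h6 : (Real.pi - φ) ^ 2 ≤ δ / l := by
        rw [← hη2]
        refine pow_le_pow_left₀ ?_ ?_ 2 <;> linarith [hφ.1, hφ.2]
      have h7 : r * t * (2 * (1 + Real.cos φ)) ≤ 6 * δ := by
        calc r * t * (2 * (1 + Real.cos φ)) ≤ (3 * l) * 2 * (δ / l) := by
              refine mul_le_mul (mul_le_mul h2 ht2 (by linarith) (by positivity)) (by linarith) ?_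
                (by positivity)
              linarith [Real.neg_one_le_cos φ]
          _ = 6 * δ := by field_simp; ring
      refine le_trans (show s₀ - 7 * δ ≤ r + t - 6 * δ by linarith) ?_
      rcases le_or_gt (r + t - 6 * δ) 0 with h8 | h8
      · exact h8.trans (Real.sqrt_nonneg _)
      · rw [chord]
        refine Real.le_sqrt_of_sq_le ?_
        nlinarith
    · exact (chord_le (by linarith) (by linarith)).trans h4

/-! ### Necessary conditions in terms of the dimensions -/

lemma coveringNumber_empty (δ : ℝ) : coveringNumber ∅ δ = 0 := by
  rw [← Nat.le_zero]
  exact Nat.sInf_le ⟨Fin.elim0, empty_subset _⟩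

lemma quasiAssouadDim_empty : quasiAssouadDim ∅ ≤ 0 := by
  refine le_of_tendsto (tendsto_upperAssouadSpectrum ∅) (Eventually.of_forall fun θ => ?_)
  refine le_of_forall_pos_le_add fun ε hε => ?_
  rw [zero_add]
  refine csInf_le (spectrum_bddBelow ∅ θ) ⟨hε, 1, one_pos, fun δ hδ u v huv => ?_⟩
  rw [empty_inter, coveringNumber_empty, Nat.cast_zero, one_mul]
  have h1 : 0 < δ ^ θ := Real.rpow_pos_of_pos hδ.1 θ
  exact Real.rpow_nonneg (div_nonneg hδ.1.le (by linarith)) _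

lemma coveringNumber_mono {F F' : Set ℝ} (h : F ⊆ F') (hF' : F' ⊆ Icc 1 2) {δ : ℝ} (hδ : 0 < δ) :
    coveringNumber F δ ≤ coveringNumber F' δ := by
  obtain ⟨c, hc⟩ := exists_cover hF' hδ
  exact Nat.sInf_le ⟨c, h.trans hc⟩

/-- Closes the dimension arguments: below its infimum a covering bound fails for every constant c,
possibly at an uncontrolled scale δ. The powers of δ are therefore cancelled and the contradiction
comes from large c, leaving only b = 0. -/
lemma eq_zero_of_forall_rpow_le {b C : ℝ} (hb : 0 ≤ b) (h : ∀ c : ℝ, 0 < c → c ^ b ≤ C) :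
    b = 0 := by
  by_contra hb0
  have hb' : 0 < b := lt_of_le_of_ne hb (Ne.symm hb0)
  have hC : 0 < C := (Real.rpow_pos_of_pos one_pos b).trans_le (h 1 one_pos)
  have h1 := h ((C + 1) ^ b⁻¹) (by positivity)
  rw [← Real.rpow_mul (by positivity), inv_mul_cancel₀ hb0, Real.rpow_one] at h1
  linarith

theorem IsRadialStrongType.minkowski_condition {E : Set ℝ} {a b : ℝ} (ha : 0 ≤ a) (hb : 0 ≤ b)
    (h : IsRadialStrongType E (ENNReal.ofReal a)⁻¹ (ENNReal.ofReal b)⁻¹) (hE : E ⊆ Icc 1 2)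
    (hne : E.Nonempty) : 2 * a ≤ 1 + (1 - minkowskiDim E) * b := by
  obtain ⟨C, hC0, hC⟩ := h.exists_coveringNumber_le ha hb hE hne
  have hab := h.fst_le_two_mul_snd ha hb hE hne
  -- For β = 0 there is no positive exponent below the dimension; there the covering number is only
  -- bounded below by 1.
  rcases (minkowskiDim_nonneg E).eq_or_lt with hβ | hβ
  · rw [← hβ, sub_zero, one_mul]
    refine exponent_le_of_forall_rpow_le (C := C) fun δ hδ => ?_
    have hδ1 : δ < 1 := by linarith [hδ.2]
    have hδ0 := hδ.1
    refine le_trans ?_ (hC δ ⟨hδ0, hδ1⟩)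
    rw [Real.rpow_add hδ0, Real.rpow_one]
    have hN : (1 : ℝ) ≤ coveringNumber E δ := by
      rw [Nat.one_le_cast, Nat.one_le_iff_ne_zero]
      intro h0
      obtain ⟨c, hc⟩ := exists_cover hE hδ0
      obtain ⟨t, ht⟩ := hne
      obtain ⟨i, -⟩ := mem_iUnion.1 (hc ht)
      rw [h0] at i
      exact i.elim0
    gcongr
    nlinarith
  · by_contra! hcon
    have hc : Continuous fun a' : ℝ => 1 + (1 - a') * b := by fun_prop
    have hev : ∀ᶠ a' in 𝓝[<] minkowskiDim E, 1 + (1 - a') * b < 2 * a ∧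
        a' ∈ Ioo 0 (minkowskiDim E) :=
      (((hc.tendsto _).eventually_lt_const hcon).filter_mono nhdsWithin_le_nhds).and
        (Ioo_mem_nhdsLT hβ)
    obtain ⟨a', h1, h2, h3⟩ := hev.exists
    have hnot := notMem_of_lt_csInf h3 (minkowski_bddBelow E)
    have hb0 : b = 0 := by
      refine eq_zero_of_forall_rpow_le (C := C) hb fun c hc0 => ?_
      have hex : ∃ δ ∈ Ioo (0 : ℝ) 1, c * δ ^ (-a') < coveringNumber E δ := by
        by_contra! hall
        exact hnot ⟨h2, c, hc0, hall⟩
      obtain ⟨δ, hδ, hN⟩ := hex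
      have hδ0 := hδ.1
      have h4 : c ^ b * δ ^ (1 + (1 - a') * b) ≤ C * δ ^ (2 * a) := by
        refine le_trans (le_of_eq ?_) ((mul_le_mul_of_nonneg_left (Real.rpow_le_rpow (by positivity)
          (mul_le_mul_of_nonneg_right hN.le hδ0.le) hb) hδ0.le).trans (hC δ hδ))
        rw [mul_assoc, ← Real.rpow_add_one hδ0.ne', Real.mul_rpow hc0.le (by positivity),
          ← Real.rpow_mul hδ0.le, mul_left_comm, ← Real.rpow_one_add' hδ0.le]
        · congr 3; ring
        · have : (-a' + 1) * b = (1 - a') * b := by ring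
          rw [this]
          have := minkowskiDim_le_quasiAssouadDim hE
          have := quasiAssouadDim_le_one E
          have : 0 ≤ (1 - a') * b := mul_nonneg (by linarith) hb
          linarith
      have h5 : δ ^ (2 * a) ≤ δ ^ (1 + (1 - a') * b) :=
        Real.rpow_le_rpow_of_exponent_ge hδ0 hδ.2.le h1.le
      have h6 : 0 < δ ^ (1 + (1 - a') * b) := by positivity
      nlinarith
    rw [hb0] at hab h1
    linarith

/-- An interval longer than 1 may be replaced by [1, 2]: this loses no point of E and lowers the
bound to be exceeded. -/
lemma exists_large_coveringNumber {E : Set ℝ} (hE : E ⊆ Icc 1 2) {θ a' c : ℝ}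
    (hθ : θ ∈ Ioo (0 : ℝ) 1) (ha' : 0 < a') (h : a' < upperAssouadSpectrum E θ) (hc : 0 < c) :
    ∃ δ u v : ℝ, δ ∈ Ioo (0 : ℝ) 1 ∧ δ ^ θ ≤ v - u ∧ v - u ≤ 1 ∧
      c * (δ / (v - u)) ^ (-a') < coveringNumber (E ∩ Icc u v) δ := by
  have hnot := notMem_of_lt_csInf h (spectrum_bddBelow E θ)
  have hex : ∃ δ ∈ Ioo (0 : ℝ) 1, ∃ u v : ℝ, δ ^ θ ≤ v - u ∧
      c * (δ / (v - u)) ^ (-a') < coveringNumber (E ∩ Icc u v) δ := by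
    by_contra! hall
    exact hnot ⟨ha', c, hc, hall⟩
  obtain ⟨δ, hδ, u, v, huv, hN⟩ := hex
  have hδ0 := hδ.1
  rcases le_or_gt (v - u) 1 with h1 | h1
  · exact ⟨δ, u, v, hδ, huv, h1, hN⟩
  · refine ⟨δ, 1, 2, hδ, ?_, by norm_num, ?_⟩
    · rw [show (2 : ℝ) - 1 = 1 by norm_num]
      exact Real.rpow_le_one hδ0.le hδ.2.le hθ.1.le
    · rw [inter_eq_left.2 hE]
      have h2 : (coveringNumber (E ∩ Icc u v) δ : ℝ) ≤ coveringNumber E δ := by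
        exact_mod_cast coveringNumber_mono inter_subset_left hE hδ0
      refine lt_of_le_of_lt ?_ (hN.trans_le h2)
      gcongr c * ?_
      rw [show (2 : ℝ) - 1 = 1 by norm_num]
      refine Real.rpow_le_rpow_of_nonpos (div_pos hδ0 (by linarith)) ?_ (by linarith)
      gcongr

theorem IsRadialStrongType.assouad_condition {E : Set ℝ} {a b : ℝ} (ha : 0 ≤ a) (hb : 0 ≤ b)
    (h : IsRadialStrongType E (ENNReal.ofReal a)⁻¹ (ENNReal.ofReal b)⁻¹) (hE : E ⊆ Icc 1 2)
    (hne : E.Nonempty) (hγ : 0 < quasiAssouadDim E)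
    (hreg : ∀ θ ∈ Ioo (1 - minkowskiDim E / quasiAssouadDim E) 1,
      upperAssouadSpectrum E θ = quasiAssouadDim E) :
    2 * quasiAssouadDim E * a ≤ minkowskiDim E + (4 * quasiAssouadDim E -
      2 * minkowskiDim E - 2 * minkowskiDim E * quasiAssouadDim E) * b := by
  obtain ⟨C, hC0, hC⟩ := h.exists_local_coveringNumber_le ha hb hE
  have hab := h.fst_le_two_mul_snd ha hb hE hne
  have hβ0 := minkowskiDim_nonneg E
  have hβγ := minkowskiDim_le_quasiAssouadDim hE
  generalize hβ : minkowskiDim E = β at *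
  generalize hγ' : quasiAssouadDim E = γ at *
  -- For β = 0 the inequality is just a ≤ 2b, and the critical θ would be 1.
  rcases hβ0.eq_or_lt with hβ1 | hβ1
  · rw [← hβ1]
    nlinarith
  by_contra! hcon
  have hθ0 : 0 ≤ 1 - β / γ := by rw [sub_nonneg, div_le_one hγ]; exact hβγ
  have hθ1 : 1 - β / γ < 1 := by have := div_pos hβ1 hγ; linarith
  -- The local test with |I| = δ^θ and covering number (δ/|I|)^{-γ} has left side δ to the power
  -- (1-θ)/2 + (1+θ-γ(1-θ))b. At θ = 1 - β/γ, comparing this power with a is the claimed inequality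
  -- divided by 2γ.
  have hval : (1 - (1 - β / γ)) / 2 + (1 + (1 - β / γ) - γ * (1 - (1 - β / γ))) * b < a := by
    have e : (1 - (1 - β / γ)) / 2 + (1 + (1 - β / γ) - γ * (1 - (1 - β / γ))) * b =
        (β + (4 * γ - 2 * β - 2 * β * γ) * b) / (2 * γ) := by
      field_simp
      ring
    rw [e, div_lt_iff₀ (by positivity)]
    linarith
  have hc1 : Continuous fun θ : ℝ => (1 - θ) / 2 + (1 + θ - γ * (1 - θ)) * b := by fun_prop
  have hev1 : ∀ᶠ θ in 𝓝[>] (1 - β / γ), (1 - θ) / 2 + (1 + θ - γ * (1 - θ)) * b < a ∧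
      θ ∈ Ioo (1 - β / γ) 1 :=
    (((hc1.tendsto _).eventually_lt_const hval).filter_mono nhdsWithin_le_nhds).and
      (Ioo_mem_nhdsGT hθ1)
  obtain ⟨θ, hθa, hθ⟩ := hev1.exists
  have hc2 : Continuous fun a' : ℝ => (1 - θ) / 2 + (1 + θ - a' * (1 - θ)) * b := by fun_prop
  have hev2 : ∀ᶠ a' in 𝓝[<] γ, (1 - θ) / 2 + (1 + θ - a' * (1 - θ)) * b < a ∧ a' ∈ Ioo 0 γ :=
    (((hc2.tendsto _).eventually_lt_const hθa).filter_mono nhdsWithin_le_nhds).and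
      (Ioo_mem_nhdsLT hγ)
  obtain ⟨a', ha', ha'0, ha'γ⟩ := hev2.exists
  rw [← hreg θ hθ] at ha'γ
  have hθ' : θ ∈ Ioo (0 : ℝ) 1 := ⟨hθ0.trans_lt hθ.1, hθ.2⟩
  set ω := b - 1 / 2 + a' * b with hω
  -- The interval may be longer than δ^θ. A nonnegative power of its length allows replacing that
  -- length by δ^θ, and the sign follows from a ≤ 2b together with the strict inequality for a'.
  have hω0 : 0 ≤ ω := by
    by_contra! hneg
    nlinarith [hθ'.1, hθ'.2]
  have hb0 : b = 0 := by
    refine eq_zero_of_forall_rpow_le (C := C) hb fun c hc0 => ?_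
    obtain ⟨δ, u, v, hδ, huv, huv1, hN⟩ := exists_large_coveringNumber hE hθ' ha'0 ha'γ hc0
    have hδ0 := hδ.1
    generalize hl : v - u = l at *
    have hl0 : 0 < l := (Real.rpow_pos_of_pos hδ0 θ).trans_le huv
    have hδl : δ ≤ l := by
      refine le_trans ?_ huv
      simpa using Real.rpow_le_rpow_of_exponent_ge hδ0 hδ.2.le hθ'.2.le
    have hFne : (E ∩ Icc u v).Nonempty := by
      rw [nonempty_iff_ne_empty]
      intro h0
      rw [h0, coveringNumber_empty, Nat.cast_zero] at hN
      have : 0 < c * (δ / l) ^ (-a') := by positivity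
      linarith
    have h1 := hC δ u v hδ0 (by rwa [hl]) (by rwa [hl]) hFne
    rw [hl] at h1
    have h2 : (δ / l) ^ (1 / 2 : ℝ) * (l * (c * (δ / l) ^ (-a') * δ)) ^ b ≤ C * δ ^ a := by
      refine le_trans ?_ h1
      gcongr
    have h3 : (δ / l) ^ (1 / 2 : ℝ) * (l * (c * (δ / l) ^ (-a') * δ)) ^ b =
        c ^ b * (l ^ ω * δ ^ (1 / 2 + b - a' * b)) := by
      have e1 : l * (c * (δ / l) ^ (-a') * δ) = c * (l ^ (1 + a') * δ ^ (1 - a')) := by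
        rw [Real.div_rpow hδ0.le hl0.le, Real.rpow_neg hl0.le, div_inv_eq_mul,
          Real.rpow_one_add' hl0.le (by linarith), sub_eq_neg_add, Real.rpow_add_one hδ0.ne']
        ring
      rw [e1, Real.mul_rpow hc0.le (by positivity), Real.mul_rpow (by positivity) (by positivity),
        ← Real.rpow_mul hl0.le, ← Real.rpow_mul hδ0.le, Real.div_rpow hδ0.le hl0.le,
        show ω = (1 + a') * b - 1 / 2 by rw [hω]; ring, Real.rpow_sub hl0,
        show 1 / 2 + b - a' * b = (1 - a') * b + 1 / 2 by ring, Real.rpow_add hδ0]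
      ring
    rw [h3] at h2
    have h4 : δ ^ a ≤ l ^ ω * δ ^ (1 / 2 + b - a' * b) := by
      calc δ ^ a ≤ δ ^ (θ * ω + (1 / 2 + b - a' * b)) := by
            refine Real.rpow_le_rpow_of_exponent_ge hδ0 hδ.2.le ?_
            rw [hω]
            nlinarith
        _ = (δ ^ θ) ^ ω * δ ^ (1 / 2 + b - a' * b) := by
            rw [Real.rpow_add hδ0, Real.rpow_mul hδ0.le]
        _ ≤ _ := by gcongr
    have h5 : 0 < δ ^ a := by positivity
    have h6 : c ^ b * δ ^ a ≤ C * δ ^ a := le_trans (by gcongr) h2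
    exact le_of_mul_le_mul_right h6 h5
  subst hb0
  nlinarith

lemma IsRadialStrongType.mono {E F : Set ℝ} (hEF : E ⊆ F) {p q : ℝ≥0∞}
    (h : IsRadialStrongType F p q) : IsRadialStrongType E p q := by
  obtain ⟨C, hC⟩ := h
  refine ⟨C, fun f hf hfp => ⟨?_, ?_⟩⟩
  · filter_upwards [(hC f hf hfp).1] with x hx t ht using hx t (hEF ht)
  · refine (eLpNorm_mono_enorm fun x => ?_).trans (hC f hf hfp).2
    simp only [enorm_eq_self]
    exact biSup_mono hEF

/-! ### The quadrilateral as an intersection of half-planes -/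

/-- The intersection of half-planes that equals the quadrilateral. -/
def halfPlanes (β γ : ℝ) : Set (ℝ × ℝ) :=
  {P | P.2 ≤ P.1 ∧ P.1 ≤ 2 * P.2 ∧ 2 * P.1 ≤ 1 + (1 - β) * P.2 ∧
    2 * γ * P.1 ≤ β + (4 * γ - 2 * β - 2 * β * γ) * P.2}

lemma halfPlanes_convex (β γ : ℝ) : Convex ℝ (halfPlanes β γ) := by
  rintro ⟨a, b⟩ ⟨h1, h2, h3, h4⟩ ⟨a', b'⟩ ⟨h1', h2', h3', h4'⟩ u v hu hv huv
  obtain rfl : v = 1 - u := by linarith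
  simp only at h1 h2 h3 h4 h1' h2' h3' h4'
  simp only [halfPlanes, mem_ofPred_eq, Prod.smul_mk, Prod.mk_add_mk, smul_eq_mul]
  refine ⟨?_, ?_, ?_, ?_⟩
  · linarith [mul_le_mul_of_nonneg_left h1 hu, mul_le_mul_of_nonneg_left h1' hv]
  · linarith [mul_le_mul_of_nonneg_left h2 hu, mul_le_mul_of_nonneg_left h2' hv]
  · linarith [mul_le_mul_of_nonneg_left h3 hu, mul_le_mul_of_nonneg_left h3' hv]
  · linarith [mul_le_mul_of_nonneg_left h4 hu, mul_le_mul_of_nonneg_left h4' hv]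

lemma thetaParam_spec {β γ : ℝ} (hβγ : β ≤ γ) (hγ : γ ≤ 1) (h : β + 1 ≤ 2 * γ) :
    2 * thetaParam β γ * (γ - β) = 1 - β ∧ 0 ≤ thetaParam β γ ∧ thetaParam β γ ≤ 1 ∧
      (β = 1 → thetaParam β γ = 1) := by
  rw [thetaParam]
  split_ifs with h1
  · subst h1
    have : γ = 1 := le_antisymm hγ hβγ
    subst this
    norm_num
  · have hβ1 : β < 1 := lt_of_le_of_ne (hβγ.trans hγ) h1
    have hd : 0 < γ - β := by linarith
    refine ⟨by field_simp, div_nonneg (by linarith) (by linarith),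
      (div_le_one (by linarith)).2 (by linarith), fun h => absurd h h1⟩

lemma vertexQ₂_eq {γ : ℝ} (hγ : 0 ≤ γ) :
    vertexQ₂ (2 * γ - 1) = (1 / (1 + γ), 1 / (2 * (1 + γ))) := by
  have h : (1 + γ) ≠ 0 := by linarith
  have h' : 3 + (2 * γ - 1) ≠ 0 := by linarith
  rw [vertexQ₂, Prod.mk.injEq]
  constructor
  · rw [div_eq_div_iff h' h]; ring
  · congr 1; ring

lemma quadrilateral_subset_halfPlanes {β γ : ℝ} (hβ : 0 ≤ β) (hβγ : β ≤ γ) (hγ : γ ≤ 1)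
    (h : β + 1 ≤ 2 * γ) : quadrilateral β γ ⊆ halfPlanes β γ := by
  obtain ⟨hθ, hθ0, hθ1, -⟩ := thetaParam_spec hβγ hγ h
  refine convexHull_min ?_ (halfPlanes_convex β γ)
  rintro P (rfl | rfl | rfl | rfl)
  · simp [halfPlanes, hβ]
  · have h1 : 0 < 1 + β := by linarith
    simp only [vertexQ₁, halfPlanes, mem_ofPred_eq, mul_one_div]
    refine ⟨le_rfl, ?_, ?_, ?_⟩
    · gcongr; norm_num
    · rw [← sub_nonneg, show 1 + (1 - β) / (1 + β) - 2 / (1 + β) = 0 by field_simp; ring]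
    · rw [← sub_nonneg, show β + (4 * γ - 2 * β - 2 * β * γ) / (1 + β) - 2 * γ / (1 + β) =
        (1 - β) * (2 * γ - β) / (1 + β) by field_simp; ring]
      exact div_nonneg (mul_nonneg (by linarith) (by linarith)) h1.le
  · rw [vertexQ₃]
    generalize thetaParam β γ = θ at *
    have hD : 0 < 2 * (1 + γ * θ) := by nlinarith [mul_nonneg (hβ.trans hβγ) hθ0]
    have hn : β * (1 - θ) ≤ 1 := by nlinarith
    have hn0 : 0 ≤ β * (1 - θ) := mul_nonneg hβ (by linarith)
    simp only [halfPlanes, mem_ofPred_eq, mul_one_div]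
    refine ⟨by gcongr; linarith, by gcongr; linarith, ?_, ?_⟩
    · rw [← mul_div_assoc, div_le_iff₀ hD, add_mul, div_mul_cancel₀ _ hD.ne']
      linarith
    · rw [← mul_div_assoc, div_le_iff₀ hD, add_mul, div_mul_cancel₀ _ hD.ne']
      linarith
  · rw [vertexQ₂_eq (hβ.trans hβγ)]
    have h1 : 0 < 1 + γ := by linarith
    simp only [halfPlanes, mem_ofPred_eq, mul_one_div]
    refine ⟨?_, le_of_eq (by field_simp), ?_, le_of_eq ?_⟩
    · gcongr; linarith
    · rw [← sub_nonneg, show 1 + (1 - β) / (2 * (1 + γ)) - 2 / (1 + γ) =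
        (2 * γ - (β + 1)) / (2 * (1 + γ)) by field_simp; ring]
      exact div_nonneg (by linarith) (by linarith)
    · field_simp
      ring

lemma Convex.smul_add_smul_mem_of_zero_mem {V : Type*} [AddCommGroup V] [Module ℝ V] {s : Set V}
    (hs : Convex ℝ s) (h0 : (0 : V) ∈ s) {x y : V} (hx : x ∈ s) (hy : y ∈ s) {u v : ℝ}
    (hu : 0 ≤ u) (hv : 0 ≤ v) (huv : u + v ≤ 1) : u • x + v • y ∈ s := by
  rcases (add_nonneg hu hv).eq_or_lt with h | h
  · obtain rfl : u = 0 := by linarith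
    obtain rfl : v = 0 := by linarith
    simpa using h0
  · have h1 : (u / (u + v)) • x + (v / (u + v)) • y ∈ s :=
      hs hx hy (by positivity) (by positivity) (by field_simp)
    have h2 := hs.smul_mem_of_zero_mem h0 h1 ⟨h.le, huv⟩
    rwa [smul_add, smul_smul, smul_smul, mul_div_cancel₀ _ h.ne', mul_div_cancel₀ _ h.ne'] at h2

/-- The ray from the origin through `vertexQ₃` splits the region into two triangles with apex 0. In
each, a point has explicit nonnegative coordinates, and the edge opposite the origin (third or
fourth inequality) bounds their sum by 1. -/
lemma halfPlanes_subset_quadrilateral {β γ : ℝ} (hβ : 0 ≤ β) (hβγ : β ≤ γ) (hγ : γ ≤ 1)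
    (h : β + 1 ≤ 2 * γ) : halfPlanes β γ ⊆ quadrilateral β γ := by
  obtain ⟨hθ, hθ0, hθ1, hβθ⟩ := thetaParam_spec hβγ hγ h
  rintro ⟨a, b⟩ ⟨h1, h2, h3, h4⟩
  simp only at h1 h2 h3 h4
  have hconv : Convex ℝ (quadrilateral β γ) := convex_convexHull ℝ _
  have m0 : (0 : ℝ × ℝ) ∈ quadrilateral β γ := subset_convexHull ℝ _ (by left; rfl)
  have m1 : vertexQ₁ β ∈ quadrilateral β γ := subset_convexHull ℝ _ (by simp)
  have m3 : vertexQ₃ β γ ∈ quadrilateral β γ := subset_convexHull ℝ _ (by simp)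
  have m2 : vertexQ₂ (2 * γ - 1) ∈ quadrilateral β γ := subset_convexHull ℝ _ (by simp)
  rw [vertexQ₂_eq (hβ.trans hβγ)] at m2
  rw [vertexQ₁] at m1
  rw [vertexQ₃] at m3
  generalize quadrilateral β γ = Q at *
  generalize thetaParam β γ = θ at *
  have hD : 0 < 1 + γ * θ := by nlinarith [mul_nonneg (hβ.trans hβγ) hθ0]
  generalize hDd : 1 + γ * θ = D at *
  have hβ' : 0 < 1 + β := by linarith
  have hγ' : 0 < 1 + γ := by linarith
  have hn1 : β * (1 - θ) < 1 := by
    rcases (hβγ.trans hγ).eq_or_lt with h5 | h5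
    · rw [hβθ h5]; norm_num
    · nlinarith
  rcases le_or_gt a ((2 - β * (1 - θ)) * b) with hc | hc
  · have hn : 0 < 1 - β * (1 - θ) := by linarith
    have key := Convex.smul_add_smul_mem_of_zero_mem hconv m0 m1 m3
      (u := (1 + β) * (((2 - β * (1 - θ)) * b - a) / (1 - β * (1 - θ))))
      (v := 2 * D * ((a - b) / (1 - β * (1 - θ))))
      (mul_nonneg hβ'.le (div_nonneg (by linarith) hn.le))
      (mul_nonneg (by linarith) (div_nonneg (by linarith) hn.le)) ?_
    · convert key using 1
      simp only [Prod.smul_mk, Prod.mk_add_mk, smul_eq_mul, Prod.mk.injEq]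
      constructor
      · field_simp
        ring
      · field_simp
        ring
    · rw [← mul_div_assoc, ← mul_div_assoc, ← add_div, div_le_one hn]
      have e : (1 + β) * ((2 - β * (1 - θ)) * b - a) + 2 * D * (a - b) =
          (1 - β * (1 - θ)) * (2 * a - (1 - β) * b) +
            (2 * θ * (γ - β) - (1 - β)) * (a - b) := by
        rw [← hDd]
        ring
      rw [e, hθ]
      nlinarith
  -- If β(1-θ) vanished, the ray would be a = 2b and nothing would lie beyond it.
  · have hn : 0 < β * (1 - θ) := by
      have hb : 0 ≤ b := by linarith
      by_contra! hle
      nlinarith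
    have hβ0 : 0 < β := by
      rcases hβ.eq_or_lt with h5 | h5
      · rw [← h5] at hn; simp at hn
      · exact h5
    have hθ' : 0 < 1 - θ := pos_of_mul_pos_right hn hβ
    have key := Convex.smul_add_smul_mem_of_zero_mem hconv m0 m3 m2
      (u := 2 * D * ((2 * b - a) / (β * (1 - θ))))
      (v := 2 * (1 + γ) * ((a - (2 - β * (1 - θ)) * b) / (β * (1 - θ))))
      (mul_nonneg (by linarith) (div_nonneg (by linarith) hn.le))
      (mul_nonneg (by linarith) (div_nonneg (by linarith) hn.le)) ?_
    · convert key using 1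
      simp only [Prod.smul_mk, Prod.mk_add_mk, smul_eq_mul, Prod.mk.injEq]
      constructor
      · field_simp
        ring
      · field_simp
        ring
    · rw [← mul_div_assoc, ← mul_div_assoc, ← add_div, div_le_one hn]
      have e : 2 * D * (2 * b - a) + 2 * (1 + γ) * (a - (2 - β * (1 - θ)) * b) =
          (1 - θ) * (2 * γ * a - (4 * γ - 2 * β - 2 * β * γ) * b) := by
        rw [← hDd]
        ring
      rw [e]
      nlinarith

/-! ### The closure of the radial type set -/

lemma radialTypeSet_subset_halfPlanes {F E : Set ℝ} (hEF : E ⊆ F) (hE : IsQuasiAssouadRegular E)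
    (h : minkowskiDim E + 1 ≤ 2 * quasiAssouadDim E) :
    radialTypeSet F ⊆ halfPlanes (minkowskiDim E) (quasiAssouadDim E) := by
  rintro ⟨a, b⟩ ⟨⟨ha, -⟩, ⟨hb, -⟩, hst⟩
  have hst' := hst.mono hEF
  have hγ : 0 < quasiAssouadDim E := by linarith [minkowskiDim_nonneg E]
  have hne : E.Nonempty := by
    rw [nonempty_iff_ne_empty]
    rintro rfl
    exact absurd hγ quasiAssouadDim_empty.not_gt
  exact ⟨hst'.snd_le_fst ha hb hE.1 hne, hst'.fst_le_two_mul_snd ha hb hE.1 hne,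
    hst'.minkowski_condition ha hb hE.1 hne,
    hst'.assouad_condition ha hb hE.1 hne hγ (hE.2.resolve_left hγ.ne')⟩

/-- The point (3/100, 1/50) satisfies all four inequalities strictly for every admissible pair β, γ;
here γ ≥ 1/2 is used. Every other point of the open segment from a point of the intersection to it
is therefore also strictly inside each region, so no separate interior argument for the intersection
is needed. -/
lemma iInter_halfPlanes_subset_closure {n : ℕ} (hn : 1 ≤ n) {E : Fin n → Set ℝ}
    (hE : ∀ j, E j ⊆ Icc 1 2) (h : ∀ j, minkowskiDim (E j) + 1 ≤ 2 * quasiAssouadDim (E j)) :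
    ⋂ j, halfPlanes (minkowskiDim (E j)) (quasiAssouadDim (E j)) ⊆
      closure (radialTypeSet (⋃ j, E j)) := by
  rintro ⟨a, b⟩ hP
  rw [mem_iInter] at hP
  have hc : Continuous fun t : ℝ => ((1 - t) * a + t * (3 / 100), (1 - t) * b + t * (1 / 50)) := by
    fun_prop
  have ht := (hc.tendsto 0).mono_left (nhdsWithin_le_nhds (s := Ioi 0))
  simp only [sub_zero, one_mul, zero_mul, add_zero] at ht
  refine mem_closure_of_tendsto ht ?_
  filter_upwards [Ioo_mem_nhdsGT (show (0 : ℝ) < 1 by norm_num)] with t ht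
  have ht0 := ht.1
  have ht1 : 0 ≤ 1 - t := by linarith [ht.2]
  -- A single index suffices for the inequalities independent of j; without any index the
  -- intersection would be the whole plane.
  obtain ⟨h1, h2, h3, -⟩ := hP ⟨0, hn⟩
  simp only at h1 h2 h3
  have hb0 : 0 ≤ b := by linarith
  have ha1 : a ≤ 1 := by nlinarith [minkowskiDim_nonneg (E ⟨0, hn⟩)]
  refine mem_radialTypeSet_of_interior hE ?_ ?_ ?_ ?_ (fun j => ?_) (fun j => ?_)
  · linarith [mul_nonneg ht1 hb0]
  · linarith [mul_le_mul_of_nonneg_left h1 ht1]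
  · linarith [mul_le_mul_of_nonneg_left ha1 ht1]
  · linarith [mul_le_mul_of_nonneg_left h2 ht1]
  · obtain ⟨-, -, h3, -⟩ := hP j
    have hβ := (minkowskiDim_le_quasiAssouadDim (hE j)).trans (quasiAssouadDim_le_one (E j))
    have h5 := mul_le_mul_of_nonneg_left h3 ht1
    have h6 : 0 ≤ t * ((1 - minkowskiDim (E j)) * (1 / 50)) :=
      mul_nonneg ht0.le (mul_nonneg (by linarith) (by norm_num))
    simp only at h5
    linarith
  · obtain ⟨-, -, -, h4⟩ := hP j
    have hβ := minkowskiDim_nonneg (E j)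
    have hγ := quasiAssouadDim_le_one (E j)
    have hd := h j
    have h5 := mul_le_mul_of_nonneg_left h4 ht1
    simp only at h5
    generalize minkowskiDim (E j) = β at *
    generalize quasiAssouadDim (E j) = γ at *
    have hβγ : β * γ ≤ β := by nlinarith
    have h6 : 0 < t * (β + (4 * γ - 2 * β - 2 * β * γ) * (1 / 50) - 2 * γ * (3 / 100)) :=
      mul_pos ht0 (by nlinarith)
    linarith

end RadialCircular

theorem mainTheorem6 (m : ℕ) (hm : 1 ≤ m) (E : Fin m → Set ℝ)
    (hreg : ∀ j, RadialCircular.IsQuasiAssouadRegular (E j))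
    (hdim : ∀ j, RadialCircular.minkowskiDim (E j) + 1 ≤ 2 * RadialCircular.quasiAssouadDim (E j)) :
    closure (RadialCircular.radialTypeSet (⋃ j, E j)) =
      ⋂ j, RadialCircular.quadrilateral (RadialCircular.minkowskiDim (E j))
        (RadialCircular.quasiAssouadDim (E j)) := by
  have hβ := fun j => RadialCircular.minkowskiDim_nonneg (E j)
  have hβγ := fun j => RadialCircular.minkowskiDim_le_quasiAssouadDim (hreg j).1
  have hγ := fun j => RadialCircular.quasiAssouadDim_le_one (E j)
  apply Subset.antisymm
  · refine closure_minimal (subset_iInter fun j => ?_) (isClosed_iInter fun j => ?_)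
    · exact (RadialCircular.radialTypeSet_subset_halfPlanes (subset_iUnion E j) (hreg j)
        (hdim j)).trans (RadialCircular.halfPlanes_subset_quadrilateral (hβ j) (hβγ j) (hγ j)
          (hdim j))
    · exact (Set.Finite.isCompact_convexHull ℝ (Set.toFinite _)).isClosed
  · exact (iInter_mono fun j => RadialCircular.quadrilateral_subset_halfPlanes (hβ j) (hβγ j)
      (hγ j) (hdim j)).trans (RadialCircular.iInter_halfPlanes_subset_closure hm
        (fun j => (hreg j).1) hdim)
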